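/- **Setting.** A *unit cell* is a triple consisting of a lattice $\mathcal L\subset\mathbb R^3$ of rank 3, an offset $f\in\mathbb R^3$ and a bounded measurable set $\Box\subset\mathbb R^3$ such that the sets $i+f+\Box$, $i\in\mathcal L$, tile $\mathbb R^3$. For $l>0$ the *corner* $\hat x_l$ of $x\in\mathbb R^3$ is $l(i+f)$, where $i\in\mathcal L$ is the unique lattice vector with $x\in l(i+f)+l\Box$. For a function $\rho$ on $\mathbb R^3$ the cell charge and the average dipole moment of the cell containing $x$ are $$q_l[\rho](x)=\int_\Box\rho(\hat x_l+ly)\,dy,\qquad p_l[\rho](x)=\frac1{|\Box|}\int_\Box y\,\rho(\hat x_l+ly)\,dy .$$ Let $\mathcal U$ be a collection of unit cells (the choices under consideration). Let $l_n\in(0,1]$, $l_n\to0$, and let $\tilde\rho_n:(0,\infty)\times\mathbb R^3\to\mathbb R$ and $j_n:(0,\infty)\times\mathbb R^3\to\mathbb R^3$ be measurable, such that 1. (bulk charge neutrality) for every $t>0$, every cell in $\mathcal U$ and every $\varphi\in L^2(\mathbb R^3)$ the functions $\varphi\, q_{l_n}[\tilde\rho_n(t,\cdot)/l_n]$ are integrable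 and their integrals tend to $0$ as $n\to\infty$; 2. for every cell in $\mathcal U$ there is $B\in L^1_{\rm loc}(0,\infty)$ with $\|\tilde\rho_n(t,\hat x_{l_n}+l_n\,\cdot)\|_{L^2(\Box)}\le B(t)$ for all $n$, $t>0$, $x$; 3. $\tilde\rho_n(t,x)\to0$ as $|x|\to\infty$, for all $n$ and $t>0$; 4. there is $M\in L^1_{\rm loc}(0,\infty)$ with $\|j_n(t,\cdot)\|_{L^2(\mathbb R^3)}\le M(t)$ for all $n$ and $t>0$; 5. (the current is generated by the charge) $\partial_t(\tilde\rho_n/l_n)+\operatorname{div}j_n=0$ in $\mathcal D'((0,\infty)\times\mathbb R^3)$. Write $p_n(t,x)=p_{l_n}[\tilde\rho_n(t,\cdot)](x)$ for the polarization with respect to a given cell. Weak limits of vector fields are locally integrable and are taken against continuous, compactly supported vector fields. The operators $\operatorname{div}$ and $\Delta$ act in $x$, and all equations hold in the sense of distributions. A *potential* of a source $S\in\mathcal D'((0,\infty)\times\mathbb R^3)$ is a locally integrable $\Phi$ with $-\Delta\Phi=S$ that vanishes at infinity, in the sense that $\int_{B(x,1)}|\Phi(t,y)|\,dy\to0$ as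 $|x|\to\infty$ for almost every $t>0$. **Theorem.** (a) Fix $t>0$. For each cell in $\mathcal U$ every subsequence of $p_n(t,\cdot)$ has a further subsequence that converges weakly on $\mathbb R^3$. If, along a subsequence, $p_n(t,\cdot)$ converges weakly for one cell in $\mathcal U$, then along it $\tilde\rho_n(t,\cdot)/l_n$ converges in $\mathcal D'(\mathbb R^3)$ to some $\rho_b(t)$, the bound charge, and $\operatorname{div}p'=-\rho_b(t)$ for every weak limit $p'$, along any further subsequence, of the polarizations at time $t$ with respect to any cell in $\mathcal U$. So the bound charge is independent of the unit cell. (b) For each cell in $\mathcal U$ every subsequence has a further subsequence along which $p_n$ and $j_n$ converge weakly on $(0,\infty)\times\mathbb R^3$. (c) Suppose that, along a subsequence, $p_n\rightharpoonup p$ (for one cell in $\mathcal U$) and $j_n\rightharpoonup j$ on $(0,\infty)\times\mathbb R^3$. Then along it $\tilde\rho_n/l_n\to\rho_b$ in $\mathcal D'((0,\infty)\times\mathbb R^3)$ for some $\rho_b$; $\operatorname{div}p'=-\rho_b$ for every weak limit $p'$, along any further subsequence, of the polarizations with respect to any cell in $\mathcal U$; and $$\operatorname{div}\dot p=-\dot\rho_b=\operatorname{div}j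 .$$ Moreover, the macroscopic potentials of the infinite system coincide: * if $\Phi_n$ is a potential of $\tilde\rho_n/l_n$ and, along the subsequence, $\Phi_n\to\Phi_0\in L^1_{\rm loc}$ in $\mathcal D'$, then $\Delta\Phi_0=\operatorname{div}p$; * a potential of $-\operatorname{div}\dot p$ and a potential of $-\operatorname{div}j$ (rates of change of the potential) agree almost everywhere; * if $p_T\in L^1_{\rm loc}$ is a transport polarization, i.e. $\partial_tp_T=j$, and $\Phi_{cl}$, $\Phi_T$ are potentials of $-\operatorname{div}p$ and $-\operatorname{div}p_T$, then $\Phi_{cl}(t,\cdot)-\Phi_{cl}(s,\cdot)=\Phi_T(t,\cdot)-\Phi_T(s,\cdot)$ almost everywhere, for almost all $s,t>0$. -/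

import Mathlib

open MeasureTheory Filter Topology TopologicalSpace
open scoped Distributions LineDeriv

noncomputable section

namespace Polarization

/-- Physical space `ℝ³`. -/
abbrev Space : Type := EuclideanSpace ℝ (Fin 3)

/-! ### Unit cells -/

/-- A choice of unit cell: a lattice with basis `basis`, an offset `offset` and a bounded measurable
set `shape`, such that the translates of `offset + shape` by the lattice vectors tile `ℝ³`
(every point lies in exactly one translate). The lattice is part of the choice. -/
structure UnitCell where
  basis : Module.Basis (Fin 3) ℝ Space
  offset : Space
  shape : Set Space
  measurableSet_shape : MeasurableSet shape
  isBounded_shape : Bornology.IsBounded shape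
  tiles : ∀ x : Space,
    ∃! i : Submodule.span ℤ (Set.range basis), x - ((i : Space) + offset) ∈ shape

namespace UnitCell

/-- The corner map at scale `l > 0`: the point `x` lies in exactly one scaled cell
`l (i + offset) + l shape` with `i` in the lattice; its corner is `l (i + offset)`. -/
def corner (C : UnitCell) (l : ℝ) (x : Space) : Space :=
  l • (((C.tiles (l⁻¹ • x)).choose : Space) + C.offset)

/-- The charge `∫ ρ(x̂ + l y) dy` (integral over the unit cell) of the scaled cell containing `x`,
`x̂` being its corner. -/
def cellCharge (C : UnitCell) (l : ℝ) (ρ : Space → ℝ) (x : Space) : ℝ :=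
  ∫ y in C.shape, ρ (C.corner l x + l • y)

/-- The average dipole moment of the scaled cell containing `x`, that is
`|l □|⁻¹ ∫ (z - x̂) / l * ρ(z) dz` over that cell, written with `z = x̂ + l y`. -/
def dipole (C : UnitCell) (l : ℝ) (ρ : Space → ℝ) (x : Space) : Space :=
  (volume.real C.shape)⁻¹ • ∫ y in C.shape, ρ (C.corner l x + l • y) • y

end UnitCell

/-- Bulk charge neutrality on `ℝ³` of the charge distributions `ρ n` at the scales `l n`, for the
unit cells in the collection `𝒰`: the cell charges tend to zero weakly in `L²`. -/
def BulkChargeNeutral (𝒰 : Set UnitCell) (l : ℕ → ℝ) (ρ : ℕ → Space → ℝ) : Prop :=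
  ∀ C ∈ 𝒰, ∀ φ : Space → ℝ, MemLp φ 2 volume →
    (∀ n, Integrable (fun x => φ x * C.cellCharge (l n) (ρ n) x)) ∧
      Tendsto (fun n => ∫ x, φ x * C.cellCharge (l n) (ρ n) x) atTop (𝓝 0)

/-! ### Distributions and weak limits -/

section

variable {E : Type*} [NormedAddCommGroup E] [NormedSpace ℝ E] [MeasureSpace E]
  [OpensMeasurableSpace E]

/-- The distribution on `Ω` given by a function `f` locally integrable on `Ω`
(it is zero if `f` is not locally integrable on `Ω`). -/
def ofFun (Ω : Opens E) (f : E → ℝ) : 𝓓'(Ω, ℝ) where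
  toFun ψ := TestFunction.integralAgainstBilinCLM (ContinuousLinearMap.mul ℝ ℝ) volume f ψ
  map_add' := map_add _
  map_smul' := map_smul _
  cont := (TestFunction.integralAgainstBilinCLM (ContinuousLinearMap.mul ℝ ℝ) volume f).cont

theorem ofFun_apply {Ω : Opens E} {f : E → ℝ} (hf : LocallyIntegrableOn f Ω) (ψ : 𝓓(Ω, ℝ)) :
    ofFun Ω f ψ = ∫ z, ψ z * f z :=
  TestFunction.integralAgainstBilinCLM_eq_integral hf

/-- `G` is locally integrable on `Ω`, and the vector fields `F n` converge to `G` weakly on `Ω`,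
tested with the continuous vector fields with compact support in `Ω`. -/
def IsWeakLimit (Ω : Opens E) (F : ℕ → E → Space) (G : E → Space) : Prop :=
  LocallyIntegrableOn G Ω ∧
    ∀ η : E → Space, Continuous η → HasCompactSupport η → tsupport η ⊆ Ω →
      Tendsto (fun n => ∫ z, inner ℝ (F n z) (η z)) atTop (𝓝 (∫ z, inner ℝ (G z) (η z)))

end

/-- The distributional divergence on `ℝ³`. -/
def divergence (F : Space → Space) : 𝓓'((⊤ : Opens Space), ℝ) :=
  ∑ i : Fin 3, ∂_{EuclideanSpace.single i (1 : ℝ)} (ofFun ⊤ fun x => F x i)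

/-- Space-time `(0, ∞) × ℝ³`; its points are the pairs `(t, x)`. -/
def spaceTime : Opens (ℝ × Space) :=
  ⟨Set.Ioi 0 ×ˢ Set.univ, isOpen_Ioi.prod isOpen_univ⟩

/-- The partial derivative with respect to time of a distribution on space-time. -/
def timeDeriv (T : 𝓓'(spaceTime, ℝ)) : 𝓓'(spaceTime, ℝ) :=
  ∂_{((1, 0) : ℝ × Space)} T

/-- The partial derivative with respect to the `i`-th space variable of a distribution on
space-time. -/
def spaceDeriv (i : Fin 3) (T : 𝓓'(spaceTime, ℝ)) : 𝓓'(spaceTime, ℝ) :=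
  ∂_{((0, EuclideanSpace.single i 1) : ℝ × Space)} T

/-- The Laplacian in the space variables of a distribution on space-time. -/
def spaceLaplacian (T : 𝓓'(spaceTime, ℝ)) : 𝓓'(spaceTime, ℝ) :=
  ∑ i : Fin 3, spaceDeriv i (spaceDeriv i T)

/-- The `i`-th component of a vector field on space-time, as a distribution. -/
def component (F : ℝ × Space → Space) (i : Fin 3) : 𝓓'(spaceTime, ℝ) :=
  ofFun spaceTime fun z => F z i

/-- The divergence in the space variables of a vector field on space-time. -/
def spaceDiv (F : ℝ × Space → Space) : 𝓓'(spaceTime, ℝ) :=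
  ∑ i : Fin 3, spaceDeriv i (component F i)

/-- The divergence in the space variables of the time derivative of a vector field on
space-time. -/
def spaceDivTimeDeriv (F : ℝ × Space → Space) : 𝓓'(spaceTime, ℝ) :=
  ∑ i : Fin 3, spaceDeriv i (timeDeriv (component F i))

/-! ### Potentials -/

/-- `Φ` is an electrostatic potential on `ℝ³`, at (almost) all positive times, of the source `S`:
`-ΔΦ = S`, and `Φ(t, x)` vanishes as `|x| → ∞`. As `Φ` is defined almost everywhere only, this
decay is asked of the local averages of `|Φ(t, ·)|`; it holds when `Φ(t, x) → 0` as `|x| → ∞`. -/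
structure IsPotential (Φ : ℝ × Space → ℝ) (S : 𝓓'(spaceTime, ℝ)) : Prop where
  locallyIntegrable : LocallyIntegrableOn Φ spaceTime
  vanishes : ∀ᵐ t ∂volume.restrict (Set.Ioi (0 : ℝ)),
    Tendsto (fun x : Space => ∫⁻ y in Metric.ball x 1, ‖Φ (t, y)‖ₑ) (cocompact Space) (𝓝 0)
  poisson : -spaceLaplacian (ofFun spaceTime Φ) = S

/-- `P` is a transport polarization of the current density `j`: its change in time is the time
integral of the current, that is `∂P/∂t = j` in the sense of distributions. -/
def IsTransportPolarization (P j : ℝ × Space → Space) : Prop :=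
  LocallyIntegrableOn P spaceTime ∧ ∀ i, timeDeriv (component P i) = component j i

/-! ### Microscopic charges and currents -/

/-- The charge densities `ρ n` at scale `l n` (the charge distributions are `ρ n / l n`) and the
current densities `j n`, with the standing assumptions on them; `𝒰` is the collection of unit cells
under consideration. -/
structure ChargeSequence (𝒰 : Set UnitCell) (l : ℕ → ℝ) (ρ : ℕ → ℝ × Space → ℝ)
    (j : ℕ → ℝ × Space → Space) : Prop where
  scale_mem : ∀ n, l n ∈ Set.Ioc (0 : ℝ) 1
  scale_tendsto : Tendsto l atTop (𝓝 0)
  measurable_charge : ∀ n, Measurable (ρ n)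
  measurable_current : ∀ n, Measurable (j n)
  /-- At every time the charge distributions `ρ n / l n` are bulk charge neutral. -/
  neutral : ∀ t > 0, BulkChargeNeutral 𝒰 l fun n x => ρ n (t, x) / l n
  /-- The rescaled charge densities are bounded in `L²` of the unit cell, uniformly in the scale and
  in the cell, by a locally integrable function of time. -/
  cell_bound : ∀ C ∈ 𝒰, ∃ B : ℝ → ℝ, LocallyIntegrableOn B (Set.Ioi 0) ∧
    ∀ n, ∀ t > 0, ∀ x : Space,
      eLpNorm (fun y => ρ n (t, C.corner (l n) x + l n • y)) 2 (volume.restrict C.shape)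
        ≤ ENNReal.ofReal (B t)
  decay : ∀ n, ∀ t > 0, Tendsto (fun x => ρ n (t, x)) (cocompact Space) (𝓝 0)
  /-- The currents are bounded in `L²(ℝ³)`, uniformly in the scale, by a locally integrable function
  of time. -/
  current_bound : ∃ M : ℝ → ℝ, LocallyIntegrableOn M (Set.Ioi 0) ∧
    ∀ n, ∀ t > 0, eLpNorm (fun x => j n (t, x)) 2 volume ≤ ENNReal.ofReal (M t)
  /-- Conservation of charge: the charge distribution `ρ n / l n` generates the current `j n`. -/
  continuity : ∀ n,
    timeDeriv (ofFun spaceTime fun z => ρ n z / l n) + spaceDiv (j n) = 0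

/-- The polarization at scale `l` as a field on space-time: at each time the average dipole moment
of the cell. -/
def polarization (C : UnitCell) (l : ℝ) (ρ : ℝ × Space → ℝ) (z : ℝ × Space) : Space :=
  C.dipole l (fun x => ρ (z.1, x)) z.2

end Polarization

end

open Polarization

noncomputable section

namespace Polarization

/-! Everything rests on one identity and one Taylor expansion. Averaging over cells preserves
volume: |□| ∫ g dx = ∫ dx ∫_□ g(x̂ + l y) dy (`UnitCell.map_corner_add`), because the corner x̂ is
constant on each cell. Take g = φ ρ / l with a test function φ and expand φ(x̂ + l y) about x. The
zeroth order term gives φ(x) times the cell charge q of ρ / l. The first order term splits along x̂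
+ l y - x = l y + (x̂ - x): the part l y produces |□| p · ∇φ, and the part x̂ - x produces a
multiple of q of size O(l). The remainder is O(l²) / l. Hence |□| (∫ φ ρ / l - ∫ p · ∇φ) - ∫ φ q =
O(l) (1 + ‖q‖ in local L¹), which is `abs_charge_sub_polarization_le`.

Neutrality sends ∫ φ q to zero. It also bounds q in local L¹, by the uniform boundedness principle
(`exists_integral_cellCharge_le`); the pointwise bound on q alone would blow up like 1 / l. So at
each fixed time the charges ρ / l have the same distributional limit as -div p, and the limit of the
charges does not know the cell (`tendsto_charge_sub_polarization`).

On space-time this convergence has to be integrated in t, and the uniform boundedness constant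
depends on t without control. The equation of continuity supplies the domination: the charge tested
with a fixed function of x has weak time derivative ∫ j · ∇φ, bounded by a locally integrable
function of t uniformly in n. Hence it oscillates by a bounded amount on a compact time interval,
and a bound at a single time spreads to almost all times (`ChargeSequence.exists_ae_abs_charge_le`).
Dominated convergence gives `ChargeSequence.tendsto_ofFun_charge`, and passing to the limit in the
equation of continuity gives ∂ₜ div p = div j.

Weak limits exist because a suitable weight turns the bounds, which are only L¹ in time, into a
bound in a Hilbert space (`exists_isWeakLimit_subseq_spaceTime`). The statements on potentials
follow from uniqueness: the difference of two potentials, mollified in x, is harmonic and vanishes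
at infinity, so the maximum principle makes it zero (`Vanishes.ae_eq_zero`). If only the time
derivatives of the sources agree, the same argument applies to the increment of the difference
between two times. -/

theorem two_le_smooth : (2 : WithTop ℕ∞) ≤ ((⊤ : ℕ∞) : WithTop ℕ∞) :=
  WithTop.coe_le_coe.2 (le_top : (2 : ℕ∞) ≤ ⊤)

/-! ### Gradients of test functions and the distributional divergence -/

section TestFunctions

variable {E : Type*} [NormedAddCommGroup E] [NormedSpace ℝ E]

theorem lineDerivOp_testFunction_apply {Ω : Opens E} (φ : 𝓓(Ω, ℝ)) (v x : E) :
    (∂_{v} φ) x = fderiv ℝ φ x v := by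
  rw [TestFunction.lineDerivOp_eq_lineDerivCLM ℝ, TestFunction.lineDerivCLM_apply]
  rw [if_pos (by simp), DifferentiableAt.lineDeriv_eq_fderiv]
  exact (φ.contDiff.differentiable (by simp)).differentiableAt

/-- The field of the partial derivatives of `φ` in the directions `L eᵢ`. -/
def gradAlong (L : Space →L[ℝ] E) (φ : E → ℝ) (z : E) : Space :=
  WithLp.toLp 2 fun i => fderiv ℝ φ z (L (EuclideanSpace.single i 1))

/-- The inclusion of space into space-time. -/
abbrev spaceIncl : Space →L[ℝ] ℝ × Space := ContinuousLinearMap.inr ℝ ℝ Space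

theorem gradAlong_apply (L : Space →L[ℝ] E) (φ : E → ℝ) (z : E) (i : Fin 3) :
    gradAlong L φ z i = fderiv ℝ φ z (L (EuclideanSpace.single i 1)) := rfl

theorem inner_gradAlong (L : Space →L[ℝ] E) (φ : E → ℝ) (z : E) (y : Space) :
    inner ℝ y (gradAlong L φ z) = fderiv ℝ φ z (L y) := by
  have hy : y = ∑ i : Fin 3, y i • EuclideanSpace.single i (1 : ℝ) := by
    ext k
    simp [Pi.single_apply]
  conv_rhs => rw [hy]
  simp [PiLp.inner_apply, gradAlong_apply, mul_comm]

/-- Pairing the gradient g with itself gives ‖g‖² = Dφ(L g) ≤ ‖Dφ‖ ‖L‖ ‖g‖. -/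
theorem norm_gradAlong_le (L : Space →L[ℝ] E) (φ : E → ℝ) (z : E) :
    ‖gradAlong L φ z‖ ≤ ‖fderiv ℝ φ z‖ * ‖L‖ := by
  have h := inner_gradAlong L φ z (gradAlong L φ z)
  rw [real_inner_self_eq_norm_sq] at h
  have h2 : fderiv ℝ φ z (L (gradAlong L φ z)) ≤ ‖fderiv ℝ φ z‖ * (‖L‖ * ‖gradAlong L φ z‖) :=
    (le_abs_self _).trans (((fderiv ℝ φ z).le_opNorm _).trans (by gcongr; exact L.le_opNorm _))
  rcases (norm_nonneg (gradAlong L φ z)).eq_or_lt with h0 | h0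
  · rw [← h0]; positivity
  · rw [← h] at h2
    nlinarith

theorem continuous_gradAlong (L : Space →L[ℝ] E) {φ : E → ℝ} (hφ : ContDiff ℝ 1 φ) :
    Continuous (gradAlong L φ) := by
  unfold gradAlong
  refine (PiLp.continuous_toLp 2 _).comp (continuous_pi fun i => ?_)
  exact (hφ.continuous_fderiv (by simp)).clm_apply continuous_const

theorem tsupport_gradAlong_subset (L : Space →L[ℝ] E) (φ : E → ℝ) :
    tsupport (gradAlong L φ) ⊆ tsupport φ := by
  refine closure_minimal (fun z hz => ?_) (isClosed_tsupport φ)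
  by_contra h
  have h0 : fderiv ℝ φ z = 0 := by
    by_contra h1
    exact h (support_fderiv_subset ℝ h1)
  apply hz
  ext i
  simp [gradAlong_apply, h0]

theorem hasCompactSupport_gradAlong (L : Space →L[ℝ] E) {φ : E → ℝ} (hφ : HasCompactSupport φ) :
    HasCompactSupport (gradAlong L φ) :=
  hφ.of_isClosed_subset (isClosed_tsupport _) (tsupport_gradAlong_subset L φ)

end TestFunctions

theorem _root_.MeasureTheory.LocallyIntegrableOn.coord {E : Type*} [TopologicalSpace E]
    [MeasurableSpace E] {μ : Measure E} {s : Set E} {F : E → Space}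
    (hF : LocallyIntegrableOn F s μ) (i : Fin 3) :
    LocallyIntegrableOn (fun z => F z i) s μ := fun x hx => by
  obtain ⟨u, hu, hi⟩ := hF x hx
  exact ⟨u, hu, (EuclideanSpace.proj (𝕜 := ℝ) i : Space →L[ℝ] ℝ).integrable_comp hi⟩

section Divergence

variable {E : Type*} [NormedAddCommGroup E] [NormedSpace ℝ E] [MeasureSpace E] [BorelSpace E]

theorem integrable_mul_testFunction {Ω : Opens E} {f : E → ℝ} (hf : LocallyIntegrableOn f Ω)
    (ψ : 𝓓(Ω, ℝ)) : Integrable fun z => ψ z * f z := by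
  simpa using ψ.integrable_bilin (ContinuousLinearMap.mul ℝ ℝ) hf

/-- A general `L` serves two cases at once: the identity gives the divergence on ℝ³, the inclusion
of space gives the spatial divergence on space-time. -/
theorem sum_lineDeriv_ofFun_apply {Ω : Opens E} {F : E → Space} (hF : LocallyIntegrableOn F Ω)
    (L : Space →L[ℝ] E) (φ : 𝓓(Ω, ℝ)) :
    (∑ i : Fin 3, ∂_{L (EuclideanSpace.single i (1 : ℝ))} (ofFun Ω fun x => F x i)) φ =
      -∫ z, inner ℝ (F z) (gradAlong L φ z) := by
  have : (∑ i : Fin 3, ∂_{L (EuclideanSpace.single i (1 : ℝ))} (ofFun Ω fun x => F x i)) φ =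
      ∑ i : Fin 3, (∂_{L (EuclideanSpace.single i (1 : ℝ))} (ofFun Ω fun x => F x i)) φ := by
    simp only [Fin.sum_univ_three]
    rfl
  rw [this]
  simp only [Distribution.lineDerivOp_apply_apply, map_neg, Finset.sum_neg_distrib, neg_inj]
  simp only [ofFun_apply (hF.coord _)]
  rw [← integral_finsetSum]
  · refine integral_congr_ae (.of_forall fun z => ?_)
    simp [PiLp.inner_apply, gradAlong_apply, lineDerivOp_testFunction_apply]
  · intro i _
    exact integrable_mul_testFunction (hF.coord i) _

end Divergence

theorem divergence_apply {F : Space → Space} (hF : LocallyIntegrableOn F (⊤ : Opens Space))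
    (φ : 𝓓((⊤ : Opens Space), ℝ)) :
    divergence F φ = -∫ z, inner ℝ (F z) (gradAlong (.id ℝ Space) φ z) :=
  sum_lineDeriv_ofFun_apply hF (.id ℝ Space) φ

theorem spaceDiv_apply {F : ℝ × Space → Space} (hF : LocallyIntegrableOn F spaceTime)
    (φ : 𝓓(spaceTime, ℝ)) :
    spaceDiv F φ = -∫ z, inner ℝ (F z) (gradAlong spaceIncl φ z) :=
  sum_lineDeriv_ofFun_apply hF spaceIncl φ

/-- By duality this is the symmetry of the second derivative of the test function. -/
theorem lineDerivOp_comm (T : 𝓓'(spaceTime, ℝ)) (v w : ℝ × Space) :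
    ∂_{v} (∂_{w} T) = ∂_{w} (∂_{v} T) := by
  ext φ
  simp only [Distribution.lineDerivOp_apply_apply, map_neg, neg_neg]
  congr 1
  ext z
  have key : ∀ a b : ℝ × Space, (∂_{a} (∂_{b} φ)) z = fderiv ℝ (fderiv ℝ φ) z a b := by
    intro a b
    rw [lineDerivOp_testFunction_apply]
    have : ⇑(∂_{b} φ : 𝓓(spaceTime, ℝ)) = fun z => fderiv ℝ φ z b :=
      funext fun z => lineDerivOp_testFunction_apply φ b z
    rw [this, fderiv_clm_apply]
    · simp
    · exact ((φ.contDiff.fderiv_right (m := 1) two_le_smooth).differentiable (by simp)).differentiableAt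
    · exact differentiableAt_const _
  rw [key, key]
  have := (φ.contDiff.contDiffAt (x := z)).isSymmSndFDerivAt
    (by simpa using two_le_smooth)
  exact this.eq _ _

theorem spaceDivTimeDeriv_eq (F : ℝ × Space → Space) :
    spaceDivTimeDeriv F = timeDeriv (spaceDiv F) := by
  simp only [spaceDivTimeDeriv, spaceDiv, spaceDeriv, timeDeriv, LineDeriv.lineDerivOp_sum]
  exact Finset.sum_congr rfl fun i _ => lineDerivOp_comm _ _ _

/-! ### Weak compactness of weighted fields -/

theorem lintegral_enorm_sq_eq {α : Type*} [MeasurableSpace α] {μ : Measure α} {F : Type*}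
    [NormedAddCommGroup F] (f : α → F) : ∫⁻ z, ‖f z‖ₑ ^ 2 ∂μ = eLpNorm f 2 μ ^ 2 := by
  have := eLpNorm_nnreal_pow_eq_lintegral (f := f) (μ := μ) (p := 2) (by norm_num)
  simp only [NNReal.coe_ofNat, ENNReal.rpow_ofNat, ENNReal.coe_ofNat] at this
  exact this.symm

/-- The fields s F n lie in a ball of L²(Ω), so sequential Banach–Alaoglu extracts a weak limit g,
and G = s⁻¹ g. Testing F n with η is testing s F n with s⁻¹ η, which is in L² because η is bounded
with compact support and s⁻¹ is square integrable on compact sets. The same property of s⁻¹ makes G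
locally integrable. -/
theorem exists_isWeakLimit_subseq {E : Type*} [NormedAddCommGroup E] [NormedSpace ℝ E]
    [SecondCountableTopology E] [LocallyCompactSpace E] [MeasureSpace E] [BorelSpace E]
    [SFinite (volume : Measure E)] (Ω : Opens E) {s : E → ℝ}
    (hsm : AEStronglyMeasurable s (volume.restrict Ω)) (hs : ∀ z ∈ Ω, 0 < s z)
    (hinv : ∀ K ⊆ (Ω : Set E), IsCompact K → MemLp (fun z => (s z)⁻¹) 2 (volume.restrict K))
    {F : ℕ → E → Space} (hF : ∀ n, AEStronglyMeasurable (F n) (volume.restrict Ω))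
    {C : ℝ} (hC : ∀ n, eLpNorm (fun z => s z • F n z) 2 (volume.restrict Ω) ≤ ENNReal.ofReal C) :
    ∃ τ : ℕ → ℕ, StrictMono τ ∧ ∃ G, IsWeakLimit Ω (fun n => F (τ n)) G := by
  have hΩ : MeasurableSet (Ω : Set E) := Ω.isOpen.measurableSet
  have hm : ∀ n, MemLp (fun z => s z • F n z) 2 (volume.restrict (Ω : Set E)) := fun n =>
    ⟨hsm.smul (hF n), (hC n).trans_lt ENNReal.ofReal_lt_top⟩
  let f : ℕ → Lp Space 2 (volume.restrict (Ω : Set E)) := fun n => (hm n).toLp _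
  have hf : ∀ n, ‖f n‖ ≤ max C 0 := fun n => by
    rw [Lp.norm_toLp]
    refine ENNReal.toReal_le_of_le_ofReal (le_max_right _ _) ((hC n).trans ?_)
    exact ENNReal.ofReal_le_ofReal (le_max_left _ _)
  have : Fact ((2 : ENNReal) ≠ ⊤) := ⟨by norm_num⟩
  let T : ℕ → WeakDual ℝ (Lp Space 2 (volume.restrict (Ω : Set E))) := fun n =>
    StrongDual.toWeakDual (InnerProductSpace.toDual ℝ _ (f n))
  obtain ⟨a, -, τ, hτ, hlim⟩ := WeakDual.isSeqCompact_closedBall ℝ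
    (Lp Space 2 (volume.restrict (Ω : Set E))) 0 (max C 0) (x := T) (fun n => by
      simpa [T] using hf n)
  let g := (InnerProductSpace.toDual ℝ _).symm (WeakDual.toStrongDual a)
  have hg : ∀ h, a h = inner ℝ g h := fun h => by
    simp only [g, InnerProductSpace.toDual_symm_apply]
    rfl
  refine ⟨τ, hτ, fun z => (s z)⁻¹ • g z, ?_, ?_⟩
  · rw [locallyIntegrableOn_iff Ω.isOpen.isLocallyClosed]
    intro K hK hKc
    exact memLp_one_iff_integrable.1 (((Lp.memLp g).mono_measure
      (Measure.restrict_mono hK le_rfl)).smul (hinv K hK hKc))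
  · intro η hη hηc hηΩ
    obtain ⟨D, hD⟩ := hη.bounded_above_of_compact_support hηc
    have hK : MeasurableSet (tsupport η) := (isClosed_tsupport η).measurableSet
    have hmem : MemLp (fun z => (s z)⁻¹ • η z) 2 (volume.restrict (Ω : Set E)) := by
      have h1 : MemLp (fun z => (s z)⁻¹ • η z) 2 (volume.restrict (tsupport η)) :=
        (memLp_top_of_bound hη.aestronglyMeasurable D (.of_forall hD)).smul (hinv _ hηΩ hηc)
      have h2 := (memLp_indicator_iff_restrict (μ := volume.restrict (Ω : Set E)) (p := 2)
        (f := fun z => (s z)⁻¹ • η z) hK).2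
        (h1.mono_measure (by
          rw [Measure.restrict_restrict hK]
          exact Measure.restrict_mono Set.inter_subset_left le_rfl))
      convert h2 using 1
      ext1 z
      by_cases hz : z ∈ tsupport η
      · rw [Set.indicator_of_mem hz]
      · rw [Set.indicator_of_notMem hz, image_eq_zero_of_notMem_tsupport hz, smul_zero]
    have key : ∀ G : E → Space, ∀ f : Lp Space 2 (volume.restrict (Ω : Set E)),
        (∀ᵐ z ∂volume.restrict (Ω : Set E), (s z)⁻¹ • f z = G z) →
        inner ℝ f (hmem.toLp _) = ∫ z, inner ℝ (G z) (η z) := by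
      intro G f hG
      have h0 : ∫ z in (Ω : Set E), inner ℝ (G z) (η z) = ∫ z, inner ℝ (G z) (η z) :=
        setIntegral_eq_integral_of_forall_compl_eq_zero fun z hz => by
          rw [image_eq_zero_of_notMem_tsupport (fun h => hz (hηΩ h)), inner_zero_right]
      rw [L2.inner_def, ← h0]
      refine integral_congr_ae ?_
      filter_upwards [hmem.coeFn_toLp, hG] with z h1 h2
      rw [h1, ← h2, real_inner_smul_left, real_inner_smul_right]
    have h1 := ((WeakDual.eval_continuous (hmem.toLp _)).tendsto a).comp hlim
    rw [hg, key _ g (.of_forall fun z => rfl)] at h1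
    refine h1.congr fun n => ?_
    rw [← key (F (τ n)) (f (τ n))]
    · simp [T]
    · filter_upwards [(hm (τ n)).coeFn_toLp, ae_restrict_mem hΩ] with z hz hzΩ
      rw [hz, smul_smul, inv_mul_cancel₀ (hs z hzΩ).ne', one_smul]


/-- A weight in time that makes `B` integrable on `(0, ∞)`. -/
theorem exists_time_weight {B : ℝ → ℝ} (hB : LocallyIntegrableOn B (Set.Ioi 0)) :
    ∃ w : ℝ → ℝ, Measurable w ∧ (∀ t, 0 < w t) ∧
      (∀ a b, 0 < a → ∃ c > 0, ∀ t ∈ Set.Icc a b, c ≤ w t) ∧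
      ∫⁻ t in Set.Ioi 0, ENNReal.ofReal (w t) * ‖B t‖ₑ ≤ 1 := by
  have hBm : AEMeasurable B (volume.restrict (Set.Ioi 0)) :=
    hB.aestronglyMeasurable.aemeasurable
  -- For t > 0, N(t) is the least k with t ∈ [1/k, k]. On a compact subset of (0, ∞) it takes
  -- finitely many values, so a weight of the form v ∘ N with v > 0 is bounded below there.
  let N : ℝ → ℕ := fun t => ⌈max t t⁻¹⌉₊
  have hN : Measurable N := Nat.measurable_ceil.comp (measurable_id.max measurable_id.inv)
  let J : ℕ → Set ℝ := fun k => Set.Icc (k : ℝ)⁻¹ k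
  have hJ : ∀ k : ℕ, 0 < k → J k ⊆ Set.Ioi 0 := fun k hk t ht =>
    lt_of_lt_of_le (by positivity) ht.1
  have hNJ : ∀ t ∈ Set.Ioi (0 : ℝ), ∀ k : ℕ, N t ≤ k → 0 < k ∧ t ∈ J k := by
    intro t ht k hk
    have ht : 0 < t := ht
    have h1 : max t t⁻¹ ≤ k := (Nat.ceil_le).1 hk
    have h2 : t ≤ k := (le_max_left _ _).trans h1
    have h3 : t⁻¹ ≤ k := (le_max_right _ _).trans h1
    have hk0 : (0 : ℝ) < k := ht.trans_le h2
    exact ⟨by exact_mod_cast hk0, inv_le_of_inv_le₀ ht h3, h2⟩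
  -- This makes the integral of w |B| over {N = k} at most 2⁻ᵏ⁻¹, and these bounds sum to 1.
  let v : ℕ → ℝ := fun k => (1 / 2 / 2 ^ k) / (1 + ∫ t in J k, ‖B t‖)
  have hpos : ∀ k, 0 < 1 + ∫ t in J k, ‖B t‖ := fun k => by positivity
  have hv : ∀ k, 0 < v k := fun k => div_pos (by positivity) (hpos k)
  refine ⟨fun t => v (N t), (measurable_from_nat (f := v)).comp hN, fun t => hv _, ?_, ?_⟩
  · intro a b ha
    obtain ⟨k, -, hk⟩ := (Finset.range (⌈max b a⁻¹⌉₊ + 1)).exists_min_image v ⟨0, by simp⟩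
    refine ⟨v k, hv k, fun t ht => hk _ ?_⟩
    rw [Finset.mem_range, Nat.lt_succ_iff]
    refine Nat.ceil_mono (max_le_max ht.2 ?_)
    exact inv_anti₀ ha ht.1
  · have hint : ∀ k : ℕ, 0 < k → ∫⁻ t in J k, ‖B t‖ₑ = ENNReal.ofReal (∫ t in J k, ‖B t‖) := by
      intro k hk
      have : IntegrableOn B (J k) := hB.integrableOn_compact_subset (hJ k hk) isCompact_Icc
      exact (ofReal_integral_norm_eq_lintegral_enorm this).symm
    have hterm : ∀ k : ℕ, (∫⁻ t in Set.Ioi 0 ∩ N ⁻¹' {k}, ENNReal.ofReal (v (N t)) * ‖B t‖ₑ) ≤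
        ENNReal.ofReal (1 / 2 / 2 ^ k) := by
      intro k
      rcases Nat.eq_zero_or_pos k with rfl | hk
      · have : Set.Ioi (0 : ℝ) ∩ N ⁻¹' {0} = ∅ := by
          ext t
          simp only [Set.mem_inter_iff, Set.mem_preimage, Set.mem_singleton_iff,
            Set.mem_empty_iff_false, iff_false, not_and]
          intro ht h0
          exact absurd (hNJ t ht 0 h0.le).1 (lt_irrefl 0)
        rw [this]
        simp
      calc (∫⁻ t in Set.Ioi 0 ∩ N ⁻¹' {k}, ENNReal.ofReal (v (N t)) * ‖B t‖ₑ)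
          = ∫⁻ t in Set.Ioi 0 ∩ N ⁻¹' {k}, ENNReal.ofReal (v k) * ‖B t‖ₑ := by
            refine setLIntegral_congr_fun (measurableSet_Ioi.inter (hN (measurableSet_singleton k)))
              fun t ht => ?_
            have : N t = k := ht.2
            simp only [this]
        _ ≤ ∫⁻ t in J k, ENNReal.ofReal (v k) * ‖B t‖ₑ :=
            lintegral_mono_set fun t ht => (hNJ t ht.1 k (le_of_eq ht.2)).2
        _ = ENNReal.ofReal (v k) * ENNReal.ofReal (∫ t in J k, ‖B t‖) := by
            rw [lintegral_const_mul' _ _ ENNReal.ofReal_ne_top, hint k hk]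
        _ = ENNReal.ofReal (v k * ∫ t in J k, ‖B t‖) := (ENNReal.ofReal_mul (hv k).le).symm
        _ ≤ _ := by
            refine ENNReal.ofReal_le_ofReal ?_
            have hI : 0 ≤ ∫ t in J k, ‖B t‖ := by positivity
            simp only [v]
            rw [div_mul_eq_mul_div, div_le_iff₀ (hpos k)]
            have : (0 : ℝ) < 1 / 2 / 2 ^ k := by positivity
            nlinarith
    have hunion : Set.Ioi (0 : ℝ) = ⋃ k, Set.Ioi 0 ∩ N ⁻¹' {k} := by
      ext t; simp
    calc _ ≤ ∑' k, ∫⁻ t in Set.Ioi 0 ∩ N ⁻¹' {k}, ENNReal.ofReal (v (N t)) * ‖B t‖ₑ := by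
            conv_lhs => rw [hunion]
            exact lintegral_iUnion_le _ _
      _ ≤ ∑' k : ℕ, ENNReal.ofReal (1 / 2 / 2 ^ k) := ENNReal.tsum_le_tsum hterm
      _ = 1 := by
            rw [← ENNReal.ofReal_tsum_of_nonneg (fun k => by positivity)
              (summable_geometric_two' 1), tsum_geometric_two' 1, ENNReal.ofReal_one]

/-- A weight on `ℝ³` with integrable square. -/
def spaceWeight (x : Space) : ℝ := ((1 + ‖x‖) ^ 2)⁻¹

theorem spaceWeight_pos (x : Space) : 0 < spaceWeight x := by
  unfold spaceWeight; positivity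

theorem spaceWeight_le_one (x : Space) : spaceWeight x ≤ 1 := by
  unfold spaceWeight
  exact inv_le_one_of_one_le₀ (one_le_pow₀ (by linarith [norm_nonneg x]))

theorem continuous_spaceWeight : Continuous spaceWeight := by
  unfold spaceWeight
  exact Continuous.inv₀ (by fun_prop) fun x => by positivity

/-- The square is (1 + ‖x‖)⁻⁴, and the exponent 4 exceeds the dimension 3. -/
theorem memLp_spaceWeight : MemLp spaceWeight 2 (volume : Measure Space) := by
  rw [memLp_two_iff_integrable_sq continuous_spaceWeight.aestronglyMeasurable]
  have := integrable_one_add_norm (E := Space) (μ := volume) (r := 4) (by simp; norm_num)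
  refine this.congr (.of_forall fun x => ?_)
  have h0 : (0 : ℝ) ≤ 1 + ‖x‖ := by positivity
  simp only [spaceWeight]
  rw [Real.rpow_neg h0, show (4 : ℝ) = (4 : ℕ) by norm_num, Real.rpow_natCast, inv_pow, ← pow_mul]

theorem restrict_spaceTime : (volume : Measure (ℝ × Space)).restrict spaceTime =
    (volume.restrict (Set.Ioi (0 : ℝ))).prod volume := by
  have : (spaceTime : Set (ℝ × Space)) = Set.Ioi 0 ×ˢ Set.univ := rfl
  rw [this, Measure.volume_eq_prod, ← Measure.prod_restrict, Measure.restrict_univ]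

theorem exists_box {K : Set (ℝ × Space)} (hK : IsCompact K)
    (hKs : K ⊆ (spaceTime : Set (ℝ × Space))) :
    ∃ a b R, 0 < a ∧ a < b ∧ 0 < R ∧ K ⊆ Set.Icc a b ×ˢ Metric.closedBall 0 R := by
  obtain ⟨R, hR⟩ := (hK.image continuous_snd).isBounded.subset_closedBall (0 : Space)
  obtain ⟨b, hb⟩ := (hK.image continuous_fst).bddAbove
  have : ∃ a > 0, ∀ z ∈ K, a ≤ z.1 := by
    rcases K.eq_empty_or_nonempty with rfl | hne
    · exact ⟨1, one_pos, by simp⟩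
    · obtain ⟨z, hz, hmin⟩ := hK.exists_isMinOn hne continuous_fst.continuousOn
      exact ⟨z.1, (hKs hz).1, fun y hy => hmin hy⟩
  obtain ⟨a, ha, hK'⟩ := this
  refine ⟨a, max b (a + 1), max R 1, ha, by simp, by simp, fun z hz => ⟨⟨hK' z hz, ?_⟩, ?_⟩⟩
  · exact (hb ⟨z, hz, rfl⟩).trans (le_max_left _ _)
  · exact Metric.closedBall_subset_closedBall (le_max_left _ _) (hR ⟨z, hz, rfl⟩)

theorem box_subset {a b R : ℝ} (ha : 0 < a) :
    Set.Icc a b ×ˢ Metric.closedBall (0 : Space) R ⊆ (spaceTime : Set (ℝ × Space)) :=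
  fun _ hz => ⟨ha.trans_le hz.1.1, trivial⟩

theorem restrict_box (a b R : ℝ) :
    (volume : Measure (ℝ × Space)).restrict (Set.Icc a b ×ˢ Metric.closedBall 0 R) =
      (volume.restrict (Set.Icc a b)).prod (volume.restrict (Metric.closedBall 0 R)) := by
  rw [Measure.volume_eq_prod, ← Measure.prod_restrict]

/-- The bound `B` is only L¹ in time, so the squares of the norms need not be integrable. The factor
w / (1 + |B|) in s² repairs this: w B² / (1 + |B|) ≤ w |B| is integrable, while s⁻² = (1 + ‖x‖)⁴ (1
+ |B|) / w is still locally integrable. -/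
theorem exists_isWeakLimit_subseq_spaceTime {F : ℕ → ℝ × Space → Space} (hF : ∀ n, Measurable (F n))
    {B : ℝ → ℝ} (hB : LocallyIntegrableOn B (Set.Ioi 0))
    (hFB : ∀ n, ∀ t > 0,
      eLpNorm (fun x => spaceWeight x • F n (t, x)) 2 volume ≤ ENNReal.ofReal (B t)) :
    ∃ τ : ℕ → ℕ, StrictMono τ ∧ ∃ G, IsWeakLimit spaceTime (fun n => F (τ n)) G := by
  obtain ⟨w, hwm, hw, hwc, hwB⟩ := exists_time_weight hB
  let s : ℝ × Space → ℝ := fun z => spaceWeight z.2 * √(w z.1 / (1 + |B z.1|))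
  have hBm : AEMeasurable B (volume.restrict (Set.Ioi 0)) :=
    hB.aestronglyMeasurable.aemeasurable
  have hsm : AEMeasurable s (volume.restrict spaceTime) := by
    rw [restrict_spaceTime]
    refine (continuous_spaceWeight.measurable.comp measurable_snd).aemeasurable.mul ?_
    have : AEMeasurable (fun t => √(w t / (1 + |B t|))) (volume.restrict (Set.Ioi 0)) :=
      (hwm.aemeasurable.div (hBm.abs.const_add 1)).sqrt
    exact this.comp_fst
  have hpos : ∀ z, 0 < s z := fun z =>
    mul_pos (spaceWeight_pos _) (Real.sqrt_pos.2 (div_pos (hw _) (by positivity)))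
  refine exists_isWeakLimit_subseq spaceTime (s := s) hsm.aestronglyMeasurable
    (fun z _ => hpos z) ?_ (fun n => (hF n).aestronglyMeasurable) (C := 1) ?_
  · intro K hK hKc
    obtain ⟨a, b, R, ha, hab, hR, hKb⟩ := exists_box hKc hK
    obtain ⟨c, hc, hwc⟩ := hwc a b ha
    have hsm' : AEStronglyMeasurable (fun z => (s z)⁻¹)
        (volume.restrict (Set.Icc a b ×ˢ Metric.closedBall 0 R)) :=
      ((hsm.mono_measure (Measure.restrict_mono (box_subset ha) le_rfl)).inv).aestronglyMeasurable
    suffices h : MemLp (fun z => (s z)⁻¹) 2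
        (volume.restrict (Set.Icc a b ×ˢ Metric.closedBall 0 R)) from
      h.mono_measure (Measure.restrict_mono hKb le_rfl)
    rw [memLp_two_iff_integrable_sq hsm']
    have hBi : IntegrableOn B (Set.Icc a b) :=
      hB.integrableOn_compact_subset (fun t ht => ha.trans_le ht.1) isCompact_Icc
    have hfin : IsFiniteMeasure (volume.restrict (Metric.closedBall (0 : Space) R)) :=
      ⟨by rw [Measure.restrict_apply_univ]; exact measure_closedBall_lt_top⟩
    have hβ : Integrable (fun z : ℝ × Space => (1 + R) ^ 4 / c * (1 + |B z.1|))
        (volume.restrict (Set.Icc a b ×ˢ Metric.closedBall 0 R)) := by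
      rw [restrict_box]
      have h1 : Integrable (fun t => (1 + R) ^ 4 / c * (1 + |B t|)) (volume.restrict (Set.Icc a b)) :=
        ((integrable_const 1).add hBi.abs).const_mul _
      exact h1.comp_fst _
    refine hβ.mono' (hsm'.pow 2) ?_
    filter_upwards [ae_restrict_mem (measurableSet_Icc.prod measurableSet_closedBall)] with z hz
    have h1 : ‖z.2‖ ≤ R := by simpa using hz.2
    have h2 : c ≤ w z.1 := hwc _ hz.1
    have h3 : 0 < 1 + |B z.1| := by positivity
    rw [Real.norm_of_nonneg (by positivity)]
    simp only [s, spaceWeight, mul_inv, inv_inv, mul_pow, inv_pow]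
    rw [Real.sq_sqrt (div_pos (hw _) h3).le, inv_div, ← pow_mul]
    rw [div_mul_eq_mul_div, mul_div_assoc]
    have h4 : 0 ≤ (1 + |B z.1|) / w z.1 := div_nonneg h3.le (hw _).le
    gcongr
  · intro n
    have hmeas : AEMeasurable (fun z => ‖s z • F n z‖ₑ ^ 2) (volume.restrict spaceTime) :=
      ((hsm.smul (hF n).aemeasurable).enorm.pow_const 2)
    rw [← ENNReal.pow_le_pow_left_iff two_ne_zero, ← lintegral_enorm_sq_eq,
      ENNReal.ofReal_one, one_pow]
    rw [restrict_spaceTime] at hmeas ⊢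
    rw [lintegral_prod _ hmeas]
    refine (setLIntegral_mono' measurableSet_Ioi fun t ht => ?_).trans hwB
    have h3 : 0 < 1 + |B t| := by positivity
    calc ∫⁻ x, ‖s (t, x) • F n (t, x)‖ₑ ^ 2
        = ∫⁻ x, ENNReal.ofReal (w t / (1 + |B t|)) * ‖spaceWeight x • F n (t, x)‖ₑ ^ 2 := by
          refine lintegral_congr fun x => ?_
          simp only [s, enorm_smul, enorm_mul, mul_pow]
          have : ‖√(w t / (1 + |B t|))‖ₑ ^ 2 = ENNReal.ofReal (w t / (1 + |B t|)) := by
            rw [Real.enorm_of_nonneg (Real.sqrt_nonneg _), ← ENNReal.ofReal_pow (Real.sqrt_nonneg _),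
              Real.sq_sqrt (div_pos (hw _) h3).le]
          rw [this]
          ring
      _ = ENNReal.ofReal (w t / (1 + |B t|)) *
          eLpNorm (fun x => spaceWeight x • F n (t, x)) 2 volume ^ 2 := by
          rw [lintegral_const_mul' _ _ ENNReal.ofReal_ne_top, lintegral_enorm_sq_eq]
      _ ≤ ENNReal.ofReal (w t / (1 + |B t|)) * ENNReal.ofReal |B t| ^ 2 := by
          gcongr
          exact (hFB n t ht).trans (ENNReal.ofReal_le_ofReal (le_abs_self _))
      _ = ENNReal.ofReal (w t / (1 + |B t|) * |B t| ^ 2) := by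
          rw [ENNReal.ofReal_mul (div_pos (hw _) h3).le, ENNReal.ofReal_pow (abs_nonneg _)]
      _ ≤ ENNReal.ofReal (w t) * ‖B t‖ₑ := by
          rw [← ofReal_norm, ← ENNReal.ofReal_mul (hw _).le, Real.norm_eq_abs]
          refine ENNReal.ofReal_le_ofReal ?_
          rw [div_mul_eq_mul_div, div_le_iff₀ h3]
          have := hw t
          have h4 := abs_nonneg (B t)
          nlinarith [mul_nonneg this.le h4]

theorem exists_isWeakLimit_subseq_space {F : ℕ → Space → Space} (hF : ∀ n, Measurable (F n)) {b : ℝ}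
    (hFb : ∀ n, eLpNorm (fun x => spaceWeight x • F n x) 2 volume ≤ ENNReal.ofReal b) :
    ∃ τ : ℕ → ℕ, StrictMono τ ∧ ∃ G, IsWeakLimit (⊤ : Opens Space) (fun n => F (τ n)) G := by
  refine exists_isWeakLimit_subseq ⊤ continuous_spaceWeight.aestronglyMeasurable
    (fun z _ => spaceWeight_pos z) ?_ (fun n => (hF n).aestronglyMeasurable) (C := b)
    (fun n => by simpa using hFb n)
  intro K _ hK
  have : IsFiniteMeasure (volume.restrict K) := ⟨by simpa using hK.measure_lt_top⟩
  have hc : Continuous fun z => (spaceWeight z)⁻¹ :=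
    continuous_spaceWeight.inv₀ fun x => (spaceWeight_pos x).ne'
  obtain ⟨D, hD⟩ := hK.exists_bound_of_continuousOn hc.continuousOn
  exact MemLp.of_bound hc.aestronglyMeasurable D
    ((ae_restrict_mem hK.measurableSet).mono fun x hx => hD x hx)

/-! ### Geometry of the scaled cells and the averaging identity -/

namespace UnitCell

variable (C : UnitCell)

/-- The scaled cell with index `i`. -/
def cell (l : ℝ) (i : Submodule.span ℤ (Set.range C.basis)) : Set Space :=
  {x | l⁻¹ • x - ((i : Space) + C.offset) ∈ C.shape}

instance : Countable (Submodule.span ℤ (Set.range C.basis)) := inferInstance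

theorem choose_eq_iff {l : ℝ} {x : Space} {i : Submodule.span ℤ (Set.range C.basis)} :
    (C.tiles (l⁻¹ • x)).choose = i ↔ x ∈ C.cell l i := by
  have h := (C.tiles (l⁻¹ • x)).choose_spec
  constructor
  · rintro rfl; exact h.1
  · exact fun hx => (h.2 i hx).symm

theorem corner_of_mem {l : ℝ} {x : Space} {i : Submodule.span ℤ (Set.range C.basis)}
    (hx : x ∈ C.cell l i) : C.corner l x = l • ((i : Space) + C.offset) := by
  rw [corner, C.choose_eq_iff.2 hx]

theorem measurableSet_cell (l : ℝ) (i) : MeasurableSet (C.cell l i) :=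
  C.measurableSet_shape.preimage
    (f := fun x : Space => l⁻¹ • x - ((i : Space) + C.offset)) (by fun_prop)

theorem pairwise_disjoint_cell (l : ℝ) : Pairwise (Function.onFun Disjoint (C.cell l)) := by
  intro i k hik
  rw [Function.onFun, Set.disjoint_left]
  intro x hi hk
  exact hik ((C.choose_eq_iff.2 hi).symm.trans (C.choose_eq_iff.2 hk))

theorem iUnion_cell (l : ℝ) : ⋃ i, C.cell l i = Set.univ :=
  Set.eq_univ_of_forall fun _ => Set.mem_iUnion.2 ⟨_, C.choose_eq_iff.1 rfl⟩

/-- The lattice is countable and the set where the index takes a given value is a cell. -/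
theorem measurable_corner (l : ℝ) : Measurable (C.corner l) := by
  have h : Measurable fun x => (C.tiles (l⁻¹ • x)).choose := by
    refine measurable_to_countable' fun i => ?_
    have : (fun x => (C.tiles (l⁻¹ • x)).choose) ⁻¹' {i} = C.cell l i := by
      ext x
      exact C.choose_eq_iff
    rw [this]
    exact C.measurableSet_cell l i
  exact ((measurable_subtype_coe.comp h).add_const _).const_smul l

/-- A bound for the norms of the points of the unit cell. -/
def radius : ℝ := max (Classical.choose (C.isBounded_shape.subset_closedBall (0 : Space))) 0

theorem radius_nonneg : 0 ≤ C.radius := le_max_right _ _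

theorem norm_le_radius {y : Space} (hy : y ∈ C.shape) : ‖y‖ ≤ C.radius := by
  have := Classical.choose_spec (C.isBounded_shape.subset_closedBall (0 : Space)) hy
  exact (by simpa using this : ‖y‖ ≤ _).trans (le_max_left _ _)

theorem norm_corner_sub_le {l : ℝ} (hl : 0 < l) (x : Space) :
    ‖C.corner l x - x‖ ≤ l * C.radius := by
  have h := C.norm_le_radius (C.tiles (l⁻¹ • x)).choose_spec.1
  have : C.corner l x - x = -(l • (l⁻¹ • x -
      (((C.tiles (l⁻¹ • x)).choose : Space) + C.offset))) := by
    rw [smul_sub, smul_inv_smul₀ hl.ne', corner]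
    abel
  rw [this, norm_neg, norm_smul, Real.norm_of_nonneg hl.le]
  gcongr

theorem norm_corner_add_sub_le {l : ℝ} (hl : 0 < l) (x : Space) {y : Space} (hy : y ∈ C.shape) :
    ‖C.corner l x + l • y - x‖ ≤ 2 * (l * C.radius) := by
  have h1 := C.norm_corner_sub_le hl x
  have h2 : ‖l • y‖ ≤ l * C.radius := by
    rw [norm_smul, Real.norm_of_nonneg hl.le]
    gcongr
    exact C.norm_le_radius hy
  calc _ = ‖(C.corner l x - x) + l • y‖ := by congr 1; abel
    _ ≤ _ := (norm_add_le _ _).trans (by linarith)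

theorem volume_shape_lt_top : volume C.shape < ⊤ := C.isBounded_shape.measure_lt_top

instance : IsFiniteMeasure ((volume : Measure Space).restrict C.shape) :=
  ⟨by rw [Measure.restrict_apply_univ]; exact C.volume_shape_lt_top⟩

theorem volume_affine_preimage {l : ℝ} (hl : 0 < l) (d : Space) (S : Set Space) :
    volume {x : Space | l⁻¹ • x - d ∈ S} = ENNReal.ofReal (l ^ 3) * volume S := by
  have : {x : Space | l⁻¹ • x - d ∈ S} = (l⁻¹ • ·) ⁻¹' ((· - d) ⁻¹' S) := rfl
  rw [this, Measure.addHaar_preimage_smul _ (inv_ne_zero hl.ne')]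
  simp only [sub_eq_add_neg, measure_preimage_add_right]
  congr 2
  simp [abs_of_pos hl]

/-- Otherwise countably many null sets would cover space. -/
theorem volume_shape_ne_zero : volume C.shape ≠ 0 := by
  intro h
  have h1 : volume (Set.univ : Set Space) = 0 := by
    rw [← C.iUnion_cell 1, measure_iUnion_null_iff]
    intro i
    have := volume_affine_preimage one_pos ((i : Space) + C.offset) C.shape
    rwa [h, mul_zero] at this
  exact isOpen_univ.measure_ne_zero volume Set.univ_nonempty h1

theorem volume_shape_pos : 0 < volume.real C.shape :=
  ENNReal.toReal_pos C.volume_shape_ne_zero C.volume_shape_lt_top.ne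

theorem measurable_corner_add (l : ℝ) :
    Measurable fun p : Space × Space => C.corner l p.1 + l • p.2 :=
  ((C.measurable_corner l).comp measurable_fst).add (measurable_snd.const_smul l)

/-- Averaging over the cells preserves the volume. -/
theorem map_corner_add {l : ℝ} (hl : 0 < l) :
    (volume.prod (volume.restrict C.shape)).map
      (fun p : Space × Space => C.corner l p.1 + l • p.2) = volume C.shape • volume := by
  ext A hA
  rw [Measure.map_apply (C.measurable_corner_add l) hA,
    Measure.prod_apply (C.measurable_corner_add l hA), ← setLIntegral_univ, ← C.iUnion_cell l,
    lintegral_iUnion (C.measurableSet_cell l) (C.pairwise_disjoint_cell l)]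
  -- On one cell the corner is constant, so the inner measure does not depend on x: it is the volume
  -- of S, the part of A in that cell seen in the coordinates of the unit cell. Integrating over x
  -- gives l³ |□| |S|, and |A ∩ cell| = l³ |S|.
  have key : ∀ i, (∫⁻ x in C.cell l i, volume.restrict C.shape (Prod.mk x ⁻¹'
      ((fun p : Space × Space => C.corner l p.1 + l • p.2) ⁻¹' A))) =
      volume C.shape * volume (A ∩ C.cell l i) := by
    intro i
    let S : Set Space := {y | l • ((i : Space) + C.offset) + l • y ∈ A} ∩ C.shape
    have hS : MeasurableSet {y : Space | l • ((i : Space) + C.offset) + l • y ∈ A} :=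
      hA.preimage (by fun_prop : Measurable fun y : Space => l • ((i : Space) + C.offset) + l • y)
    have h1 : A ∩ C.cell l i = {x : Space | l⁻¹ • x - ((i : Space) + C.offset) ∈ S} := by
      ext x
      simp only [Set.mem_inter_iff, cell, S, Set.mem_ofPred_eq]
      rw [smul_sub, smul_inv_smul₀ hl.ne', add_sub_cancel]
    rw [h1, volume_affine_preimage hl]
    have h2 : (∫⁻ x in C.cell l i, volume.restrict C.shape (Prod.mk x ⁻¹'
      ((fun p : Space × Space => C.corner l p.1 + l • p.2) ⁻¹' A))) =
      ∫⁻ _ in C.cell l i, volume S := by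
      refine setLIntegral_congr_fun (C.measurableSet_cell l i) fun x hx => ?_
      simp only [Set.preimage_preimage, C.corner_of_mem hx]
      exact Measure.restrict_apply hS
    rw [h2, setLIntegral_const, cell, volume_affine_preimage hl]
    ring
  simp_rw [key]
  rw [ENNReal.tsum_mul_left, Measure.smul_apply, smul_eq_mul]
  congr 1
  rw [← measure_iUnion (fun i k hik => ((C.pairwise_disjoint_cell l hik).mono
    Set.inter_subset_right Set.inter_subset_right))
    (fun i => hA.inter (C.measurableSet_cell l i)), ← Set.inter_iUnion, C.iUnion_cell,
    Set.inter_univ]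

theorem lintegral_lintegral_corner_add {l : ℝ} (hl : 0 < l) {g : Space → ENNReal}
    (hg : Measurable g) :
    ∫⁻ x, ∫⁻ y in C.shape, g (C.corner l x + l • y) = volume C.shape * ∫⁻ x, g x := by
  have h := lintegral_map (μ := volume.prod (volume.restrict C.shape)) hg
    (C.measurable_corner_add l)
  rw [C.map_corner_add hl, lintegral_smul_measure,
    lintegral_prod (fun p : Space × Space => g (C.corner l p.1 + l • p.2)) (hg.comp (C.measurable_corner_add l)).aemeasurable] at h
  exact h.symm

theorem integrable_corner_add {l : ℝ} (hl : 0 < l) {g : Space → ℝ} (hg : Integrable g) :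
    Integrable (fun p : Space × Space => g (C.corner l p.1 + l • p.2))
      (volume.prod (volume.restrict C.shape)) := by
  have h : Integrable g ((volume.prod (volume.restrict C.shape)).map
      (fun p : Space × Space => C.corner l p.1 + l • p.2)) := by
    rw [C.map_corner_add hl]
    exact hg.smul_measure C.volume_shape_lt_top.ne
  exact h.comp_measurable (C.measurable_corner_add l)

theorem integral_integral_corner_add {l : ℝ} (hl : 0 < l) {g : Space → ℝ} (hg : Integrable g) :
    ∫ x, ∫ y in C.shape, g (C.corner l x + l • y) = volume.real C.shape * ∫ x, g x := by
  have hm : AEStronglyMeasurable g ((volume.prod (volume.restrict C.shape)).map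
      (fun p : Space × Space => C.corner l p.1 + l • p.2)) := by
    rw [C.map_corner_add hl]
    exact hg.aestronglyMeasurable.mono_ac Measure.smul_absolutelyContinuous
  have h := integral_map (C.measurable_corner_add l).aemeasurable hm
  rw [C.map_corner_add hl, integral_smul_measure,
    integral_prod _ (C.integrable_corner_add hl hg)] at h
  exact h.symm

end UnitCell

/-- `f` is bounded by `b` in `L²` of the unit cell, uniformly in the cells of scale `l`. -/
def CellBound (C : UnitCell) (l : ℝ) (f : Space → ℝ) (b : ℝ) : Prop :=
  ∀ x : Space, eLpNorm (fun y => f (C.corner l x + l • y)) 2 (volume.restrict C.shape)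
    ≤ ENNReal.ofReal b

/-! ### Estimates from the L² bound on the cells -/

namespace UnitCell

variable (C : UnitCell)

/-- The norm of the embedding of `L²` of the unit cell in `L¹`. -/
def embConst : ℝ := (volume.real C.shape) ^ (1 / 2 : ℝ)

theorem embConst_nonneg : 0 ≤ C.embConst := by unfold embConst; positivity

variable {C} {l b : ℝ} {f : Space → ℝ}

theorem measurable_shifted (hf : Measurable f) (x : Space) :
    Measurable fun y => f (C.corner l x + l • y) :=
  hf.comp ((measurable_const_smul l).const_add _)

/-- Cauchy–Schwarz on the unit cell, which has finite volume. -/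
theorem lintegral_cell_le (hf : Measurable f) (hb : CellBound C l f b) (x : Space) :
    ∫⁻ y in C.shape, ‖f (C.corner l x + l • y)‖ₑ ≤ ENNReal.ofReal (C.embConst * b) := by
  have h := eLpNorm_le_eLpNorm_mul_rpow_measure_univ (p := 1) (q := 2) (by norm_num)
    (measurable_shifted (C := C) (l := l) hf x).aestronglyMeasurable (μ := volume.restrict C.shape)
  rw [eLpNorm_one_eq_lintegral_enorm] at h
  refine h.trans ?_
  rw [mul_comm, Measure.restrict_apply_univ, ENNReal.ofReal_mul C.embConst_nonneg, embConst,
    ← ENNReal.ofReal_rpow_of_nonneg measureReal_nonneg (by norm_num), Measure.real,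
    ENNReal.ofReal_toReal C.volume_shape_lt_top.ne]
  rw [show (1 / ENNReal.toReal 1 - 1 / ENNReal.toReal 2) = 1 / 2 by norm_num]
  gcongr
  exact hb x

theorem integrable_cell (hf : Measurable f) (hb : CellBound C l f b) (x : Space) :
    Integrable (fun y => f (C.corner l x + l • y)) (volume.restrict C.shape) :=
  ⟨(measurable_shifted hf x).aestronglyMeasurable,
    (lintegral_cell_le hf hb x).trans_lt ENNReal.ofReal_lt_top⟩

theorem integral_cell_le (hf : Measurable f) (hb0 : 0 ≤ b) (hb : CellBound C l f b) (x : Space) :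
    ∫ y in C.shape, ‖f (C.corner l x + l • y)‖ ≤ C.embConst * b := by
  rw [integral_norm_eq_lintegral_enorm (measurable_shifted hf x).aestronglyMeasurable]
  exact ENNReal.toReal_le_of_le_ofReal (mul_nonneg C.embConst_nonneg hb0)
    (lintegral_cell_le hf hb x)

theorem abs_integral_cell_mul_le (hf : Measurable f) (hb0 : 0 ≤ b) (hb : CellBound C l f b)
    (x : Space) {g : Space → ℝ} {D : ℝ} (hg : ∀ y ∈ C.shape, |g y| ≤ D) :
    |∫ y in C.shape, g y * f (C.corner l x + l • y)| ≤ D * (C.embConst * b) := by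
  rcases C.shape.eq_empty_or_nonempty with h0 | ⟨y0, hy0⟩
  · exact absurd (by rw [h0, measure_empty]) C.volume_shape_ne_zero
  have hD : 0 ≤ D := (abs_nonneg _).trans (hg y0 hy0)
  calc _ ≤ ∫ y in C.shape, D * ‖f (C.corner l x + l • y)‖ := by
        rw [← Real.norm_eq_abs]
        refine norm_integral_le_of_norm_le ((integrable_cell hf hb x).norm.const_mul D) ?_
        filter_upwards [ae_restrict_mem C.measurableSet_shape] with y hy
        rw [norm_mul]
        exact mul_le_mul_of_nonneg_right (hg y hy) (norm_nonneg _)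
    _ ≤ _ := by
        rw [integral_const_mul]
        exact mul_le_mul_of_nonneg_left (integral_cell_le hf hb0 hb x) hD

theorem norm_dipole_le (hf : Measurable f) (hb0 : 0 ≤ b) (hb : CellBound C l f b) (x : Space) :
    ‖C.dipole l f x‖ ≤ (volume.real C.shape)⁻¹ * (C.radius * (C.embConst * b)) := by
  rw [dipole, norm_smul, norm_inv, Real.norm_of_nonneg measureReal_nonneg]
  refine mul_le_mul_of_nonneg_left ?_ (by positivity)
  calc _ ≤ ∫ y in C.shape, C.radius * ‖f (C.corner l x + l • y)‖ := by
        refine norm_integral_le_of_norm_le ((integrable_cell hf hb x).norm.const_mul _) ?_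
        filter_upwards [ae_restrict_mem C.measurableSet_shape] with y hy
        rw [norm_smul, mul_comm]
        exact mul_le_mul_of_nonneg_right (C.norm_le_radius hy) (norm_nonneg _)
    _ ≤ _ := by
        rw [integral_const_mul]
        exact mul_le_mul_of_nonneg_left (integral_cell_le hf hb0 hb x) C.radius_nonneg

theorem norm_cellCharge_le (hf : Measurable f) (hb0 : 0 ≤ b) (hb : CellBound C l f b) (x : Space) :
    ‖C.cellCharge l f x‖ ≤ C.embConst * b :=
  (norm_integral_le_integral_norm _).trans (integral_cell_le hf hb0 hb x)

theorem measurable_cellCharge (hf : Measurable f) : Measurable (C.cellCharge l f) := by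
  have : StronglyMeasurable fun p : Space × Space => f (C.corner l p.1 + l • p.2) :=
    (hf.comp (C.measurable_corner_add l)).stronglyMeasurable
  exact (this.integral_prod_right' (ν := volume.restrict C.shape)).measurable

theorem cellCharge_div (a : ℝ) (x : Space) :
    C.cellCharge l (fun x => f x / a) x = C.cellCharge l f x / a :=
  integral_div _ _

/-- The averaging identity is applied to |f| cut off to the ball. A point x contributes only if its
cell meets the ball, and since l ≤ 1 such an x lies within 2 `radius` of it; each such x contributes
at most the L¹ bound on one cell. -/
theorem lintegral_closedBall_le (hl : l ∈ Set.Ioc (0 : ℝ) 1) (hf : Measurable f)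
    (hb : CellBound C l f b) (R : ℝ) :
    ∫⁻ x in Metric.closedBall (0 : Space) R, ‖f x‖ₑ ≤
      (volume C.shape)⁻¹ * (ENNReal.ofReal (C.embConst * b) *
        volume (Metric.closedBall (0 : Space) (R + 2 * C.radius))) := by
  rw [← ENNReal.mul_le_iff_le_inv C.volume_shape_ne_zero C.volume_shape_lt_top.ne,
    ← lintegral_indicator measurableSet_closedBall,
    ← C.lintegral_lintegral_corner_add hl.1 (hf.enorm.indicator measurableSet_closedBall),
    ← setLIntegral_const, ← lintegral_indicator measurableSet_closedBall]
  refine lintegral_mono fun x => ?_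
  by_cases hx : x ∈ Metric.closedBall (0 : Space) (R + 2 * C.radius)
  · rw [Set.indicator_of_mem hx]
    refine le_trans (lintegral_mono fun y => ?_) (lintegral_cell_le hf hb x)
    exact Set.indicator_le_self _ _ _
  · rw [Set.indicator_of_notMem hx, nonpos_iff_eq_zero]
    refine (setLIntegral_congr_fun C.measurableSet_shape fun y hy => ?_).trans lintegral_zero
    refine Set.indicator_of_notMem (fun h => hx ?_) _
    have h1 := C.norm_corner_add_sub_le hl.1 x hy
    have h2 : l * C.radius ≤ C.radius := mul_le_of_le_one_left C.radius_nonneg hl.2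
    rw [mem_closedBall_zero_iff] at h ⊢
    have := norm_sub_norm_le x (C.corner l x + l • y)
    rw [norm_sub_rev] at this
    linarith

/-- The constant in the local `L¹` bound. -/
def ballConst (C : UnitCell) (R : ℝ) : ℝ :=
  (volume.real C.shape)⁻¹ * (C.embConst *
    volume.real (Metric.closedBall (0 : Space) (R + 2 * C.radius)))

theorem lintegral_closedBall_le' (hl : l ∈ Set.Ioc (0 : ℝ) 1) (hf : Measurable f)
    (hb : CellBound C l f b) (R : ℝ) :
    ∫⁻ x in Metric.closedBall (0 : Space) R, ‖f x‖ₑ ≤ ENNReal.ofReal (C.ballConst R * b) := by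
  refine (lintegral_closedBall_le hl hf hb R).trans (le_of_eq ?_)
  have h1 := C.embConst_nonneg
  have h2 := C.volume_shape_pos
  rw [ballConst, show (volume.real C.shape)⁻¹ * (C.embConst * volume.real (Metric.closedBall
    (0 : Space) (R + 2 * C.radius))) * b = (volume.real C.shape)⁻¹ * (volume.real
    (Metric.closedBall (0 : Space) (R + 2 * C.radius)) * (C.embConst * b)) by ring,
    ENNReal.ofReal_mul (p := (volume.real C.shape)⁻¹) (by positivity),
    ENNReal.ofReal_mul (q := C.embConst * b) measureReal_nonneg, ENNReal.ofReal_inv_of_pos h2, ofReal_measureReal C.volume_shape_lt_top.ne,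
    ofReal_measureReal measure_closedBall_lt_top.ne]
  ring

theorem integrableOn_closedBall (hl : l ∈ Set.Ioc (0 : ℝ) 1) (hf : Measurable f)
    (hb : CellBound C l f b) (R : ℝ) : IntegrableOn f (Metric.closedBall 0 R) :=
  ⟨hf.aestronglyMeasurable, (lintegral_closedBall_le' hl hf hb R).trans_lt ENNReal.ofReal_lt_top⟩

end UnitCell

/-- The polarization is jointly measurable. -/
theorem measurable_polarization (C : UnitCell) (l : ℝ) {ρ : ℝ × Space → ℝ} (hρ : Measurable ρ) :
    Measurable (polarization C l ρ) := by
  let g : (ℝ × Space) × Space → ℝ × Space := fun p => (p.1.1, C.corner l p.1.2 + l • p.2)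
  have hg : Measurable g := by
    refine (measurable_fst.comp measurable_fst).prodMk ?_
    exact ((C.measurable_corner l).comp (measurable_snd.comp measurable_fst)).add
      (measurable_snd.const_smul l)
  have h2 : StronglyMeasurable fun p : (ℝ × Space) × Space => ρ (g p) • p.2 :=
    ((hρ.comp hg).smul measurable_snd).stronglyMeasurable
  have h3 := (h2.integral_prod_right' (ν := volume.restrict C.shape)).measurable
  exact h3.const_smul (volume.real C.shape)⁻¹

theorem UnitCell.measurable_dipole (C : UnitCell) (l : ℝ) {f : Space → ℝ} (hf : Measurable f) :
    Measurable (C.dipole l f) := by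
  have h1 : Measurable fun x : Space => ((0 : ℝ), x) := measurable_const.prodMk measurable_id
  have h2 := (measurable_polarization C l (hf.comp (measurable_snd (α := ℝ)))).comp h1
  exact h2

/-! ### Charge against polarization: the Taylor expansion at one scale -/

theorem integral_sub_sub {α : Type*} [MeasurableSpace α] {μ : Measure α} {f g h : α → ℝ}
    (hf : Integrable f μ) (hg : Integrable g μ) (hh : Integrable h μ) :
    (∫ x, f x ∂μ) - (∫ x, g x ∂μ) - ∫ x, h x ∂μ = ∫ x, (f x - g x - h x) ∂μ := by
  rw [← integral_sub hf hg]
  exact (integral_sub (hf.sub hg) hh).symm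

/-- Quantitative `C²` bounds and a bound for the support. -/
structure IsTame (φ : Space → ℝ) (R D : ℝ) : Prop where
  contDiff : ContDiff ℝ 1 φ
  eq_zero : ∀ x, R < ‖x‖ → φ x = 0
  bound : ∀ x, |φ x| ≤ D
  bound_fderiv : ∀ x, ‖fderiv ℝ φ x‖ ≤ D
  taylor : ∀ x y, |φ y - φ x - fderiv ℝ φ x (y - x)| ≤ D * ‖y - x‖ ^ 2

namespace IsTame

variable {φ : Space → ℝ} {R D : ℝ}

theorem nonneg (h : IsTame φ R D) : 0 ≤ D := (abs_nonneg _).trans (h.bound 0)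

theorem fderiv_eq_zero (h : IsTame φ R D) (x : Space) (hx : R < ‖x‖) : fderiv ℝ φ x = 0 := by
  have : φ =ᶠ[𝓝 x] fun _ => 0 := by
    filter_upwards [(isOpen_lt continuous_const continuous_norm).mem_nhds hx] with y hy
    exact h.eq_zero y hy
  rw [this.fderiv_eq, fderiv_const_apply]

theorem hasCompactSupport (h : IsTame φ R D) : HasCompactSupport φ :=
  HasCompactSupport.intro (isCompact_closedBall (0 : Space) R) fun x hx =>
    h.eq_zero x (by simpa using hx)

end IsTame

variable {C : UnitCell} {l b : ℝ} {f : Space → ℝ}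

theorem integrable_of_compactSupport_mul (hl : l ∈ Set.Ioc (0 : ℝ) 1) (hf : Measurable f)
    (hb : CellBound C l f b) {φ : Space → ℝ} (hφ : Continuous φ) (hc : HasCompactSupport φ) :
    Integrable fun x => φ x * f x := by
  obtain ⟨R, hR⟩ := hc.isCompact.isBounded.subset_closedBall (0 : Space)
  obtain ⟨D, hD⟩ := hφ.bounded_above_of_compact_support hc
  have h1 : IntegrableOn (fun x => φ x * f x) (Metric.closedBall 0 R) :=
    (UnitCell.integrableOn_closedBall hl hf hb R).bdd_mul hφ.aestronglyMeasurable (.of_forall hD)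
  refine (integrableOn_iff_integrable_of_support_subset fun x hx => hR ?_).1 h1
  exact subset_tsupport φ (left_ne_zero_of_mul hx)

theorem integrableOn_cellCharge (hf : Measurable f) (hb0 : 0 ≤ b) (hb : CellBound C l f b) (R : ℝ) :
    IntegrableOn (C.cellCharge l f) (Metric.closedBall 0 R) :=
  have : IsFiniteMeasure ((volume : Measure Space).restrict (Metric.closedBall 0 R)) :=
    ⟨by rw [Measure.restrict_apply_univ]; exact measure_closedBall_lt_top⟩
  Integrable.of_bound (UnitCell.measurable_cellCharge hf).aestronglyMeasurable _
    (.of_forall (UnitCell.norm_cellCharge_le hf hb0 hb))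

theorem integrable_mul_cellCharge (hf : Measurable f) (hb0 : 0 ≤ b) (hb : CellBound C l f b)
    {φ : Space → ℝ} (hφ : Continuous φ) (hc : HasCompactSupport φ) :
    Integrable fun x => φ x * C.cellCharge l f x :=
  (hφ.integrable_of_hasCompactSupport hc).mul_bdd
    (UnitCell.measurable_cellCharge hf).aestronglyMeasurable
    (.of_forall (UnitCell.norm_cellCharge_le hf hb0 hb))

theorem integrable_inner_dipole (hf : Measurable f) (hb0 : 0 ≤ b) (hb : CellBound C l f b)
    {η : Space → Space} (hη : Continuous η) (hc : HasCompactSupport η) :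
    Integrable fun x => inner ℝ (C.dipole l f x) (η x) := by
  have h1 := (hη.integrable_of_hasCompactSupport (μ := volume) hc).norm.const_mul
    ((volume.real C.shape)⁻¹ * (C.radius * (C.embConst * b)))
  refine h1.mono' ((C.measurable_dipole l hf).aestronglyMeasurable.inner
    hη.aestronglyMeasurable) (.of_forall fun x => ?_)
  refine (norm_inner_le_norm _ _).trans ?_
  gcongr
  exact UnitCell.norm_dipole_le hf hb0 hb x

/-- This identifies the dipole term with the first order Taylor term in y, which is how the
polarization enters. -/
theorem inner_dipole_gradAlong (hf : Measurable f) (hb : CellBound C l f b) (φ : Space → ℝ)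
    (x : Space) :
    inner ℝ (C.dipole l f x) (gradAlong (.id ℝ Space) φ x) =
      (volume.real C.shape)⁻¹ * ∫ y in C.shape, fderiv ℝ φ x y * f (C.corner l x + l • y) := by
  rw [inner_gradAlong, ContinuousLinearMap.id_apply, UnitCell.dipole, map_smul, smul_eq_mul]
  congr 1
  rw [← ContinuousLinearMap.integral_comp_comm]
  · simp [mul_comm]
  · refine ((UnitCell.integrable_cell hf hb x).norm.const_mul C.radius).mono'
      ((UnitCell.measurable_shifted hf x).smul measurable_id).aestronglyMeasurable ?_
    filter_upwards [ae_restrict_mem C.measurableSet_shape] with y hy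
    rw [norm_smul, mul_comm]
    exact mul_le_mul_of_nonneg_right (C.norm_le_radius hy) (norm_nonneg _)

/-- The contribution of a cell to the difference of charge, polarization and cell charge. -/
theorem abs_cell_error_le (hl : l ∈ Set.Ioc (0 : ℝ) 1) (hf : Measurable f) (hb0 : 0 ≤ b)
    (hb : CellBound C l f b) {φ : Space → ℝ} {R D : ℝ} (hφ : IsTame φ R D) (x : Space) :
    |(∫ y in C.shape, φ (C.corner l x + l • y) * (f (C.corner l x + l • y) / l)) -
      φ x * C.cellCharge l (fun x => f x / l) x -
      ∫ y in C.shape, fderiv ℝ φ x y * f (C.corner l x + l • y)| ≤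
    (Metric.closedBall (0 : Space) (R + 2 * C.radius)).indicator (fun x => l *
      (D * (4 * C.radius ^ 2 * (C.embConst * b) +
        C.radius * ‖C.cellCharge l (fun x => f x / l) x‖))) x := by
  have hl0 := hl.1
  have hr := C.radius_nonneg
  have hD := hφ.nonneg
  have hK := C.embConst_nonneg
  have hlr : l * C.radius ≤ C.radius := mul_le_of_le_one_left hr hl.2
  -- Off the enlarged ball φ vanishes near x and at all points of the cell of x, so the error is
  -- zero there and its integral over x is finite.
  by_cases hx : x ∈ Metric.closedBall (0 : Space) (R + 2 * C.radius)
  swap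
  · rw [Set.indicator_of_notMem hx]
    rw [mem_closedBall_zero_iff, not_le] at hx
    have h1 : ∫ y in C.shape, φ (C.corner l x + l • y) * (f (C.corner l x + l • y) / l) = 0 := by
      refine setIntegral_eq_zero_of_forall_eq_zero fun y hy => ?_
      have h1 := C.norm_corner_add_sub_le hl.1 x hy
      have := norm_sub_norm_le x (C.corner l x + l • y)
      rw [norm_sub_rev] at this
      rw [hφ.eq_zero _ (by linarith), zero_mul]
    rw [h1, hφ.eq_zero x (by linarith), hφ.fderiv_eq_zero x (by linarith)]
    simp
  rw [Set.indicator_of_mem hx]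
  have hint := UnitCell.integrable_cell hf hb x
  have hbd : ∀ (g : Space → ℝ) (A : ℝ), Measurable g → (∀ y ∈ C.shape, |g y| ≤ A) →
      Integrable (fun y => g y * f (C.corner l x + l • y)) (volume.restrict C.shape) := by
    intro g A hg hA
    refine hint.bdd_mul hg.aestronglyMeasurable (c := A) ?_
    filter_upwards [ae_restrict_mem C.measurableSet_shape] with y hy
    exact hA y hy
  have hmeas : Measurable fun y : Space => C.corner l x + l • y :=
    (measurable_const_smul l).const_add _
  have i1 := hbd (fun y => φ (C.corner l x + l • y) / l) (D / l)
    ((hφ.contDiff.continuous.measurable.comp hmeas).div_const l) (fun y _ => by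
      rw [abs_div, abs_of_pos hl0]; gcongr; exact hφ.bound _)
  have i2 := hbd (fun y => φ x / l) (D / l) measurable_const (fun y _ => by
      rw [abs_div, abs_of_pos hl0]; gcongr; exact hφ.bound _)
  have i3 := hbd (fun y => fderiv ℝ φ x y) (D * C.radius) (fderiv ℝ φ x).measurable (fun y hy =>
    ((fderiv ℝ φ x).le_opNorm y).trans (by
      gcongr
      · exact hφ.bound_fderiv x
      · exact C.norm_le_radius hy))
  have i4 := hbd (fun y => fderiv ℝ φ x (C.corner l x - x) / l) _ measurable_const
    (fun y _ => le_rfl)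
  have e2 : φ x * C.cellCharge l (fun x => f x / l) x =
      ∫ y in C.shape, φ x / l * f (C.corner l x + l • y) := by
    rw [integral_const_mul, UnitCell.cellCharge_div, UnitCell.cellCharge]; ring
  have e4 : fderiv ℝ φ x (C.corner l x - x) * C.cellCharge l (fun x => f x / l) x =
      ∫ y in C.shape, fderiv ℝ φ x (C.corner l x - x) / l * f (C.corner l x + l • y) := by
    rw [integral_const_mul, UnitCell.cellCharge_div, UnitCell.cellCharge]; ring
  have e1 : ∫ y in C.shape, φ (C.corner l x + l • y) * (f (C.corner l x + l • y) / l) =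
      ∫ y in C.shape, φ (C.corner l x + l • y) / l * f (C.corner l x + l • y) := by
    congr 1 with y; ring
  -- Splitting x̂ + l y - x into l y and x̂ - x isolates the dipole term. The term with x̂ - x does
  -- not involve y, so it multiplies the whole cell charge; it is small because ‖x̂ - x‖ ≤ l
  -- `radius`.
  have main : (∫ y in C.shape, φ (C.corner l x + l • y) * (f (C.corner l x + l • y) / l)) -
      φ x * C.cellCharge l (fun x => f x / l) x -
      (∫ y in C.shape, fderiv ℝ φ x y * f (C.corner l x + l • y)) =
      (∫ y in C.shape, (φ (C.corner l x + l • y) - φ x -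
        fderiv ℝ φ x (C.corner l x + l • y - x)) / l * f (C.corner l x + l • y)) +
      fderiv ℝ φ x (C.corner l x - x) * C.cellCharge l (fun x => f x / l) x := by
    rw [e1, e2, e4, integral_sub_sub i1 i2 i3, ← integral_add _ i4]
    · congr 1 with y
      have : C.corner l x + l • y - x = (C.corner l x - x) + l • y := by abel
      simp only [this, map_add, map_smul, smul_eq_mul]
      field_simp
      ring
    · convert ((i1.sub i2).sub i3).sub i4 using 1
      ext y
      have : C.corner l x + l • y - x = (C.corner l x - x) + l • y := by abel
      simp only [Pi.sub_apply, this, map_add, map_smul, smul_eq_mul]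
      field_simp
      ring
  rw [main]
  -- The Taylor remainder is at most D (2 l r)², r being the radius of the cell; the division by l
  -- leaves 4 l D r².
  have b1 := UnitCell.abs_integral_cell_mul_le hf hb0 hb x (D := l * (D * (4 * C.radius ^ 2)))
    (g := fun y => (φ (C.corner l x + l • y) - φ x -
        fderiv ℝ φ x (C.corner l x + l • y - x)) / l) (fun y hy => by
      rw [abs_div, abs_of_pos hl0, div_le_iff₀ hl0]
      refine (hφ.taylor _ _).trans ?_
      have h2 := pow_le_pow_left₀ (norm_nonneg _) (C.norm_corner_add_sub_le hl0 x hy) 2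
      calc _ ≤ D * (2 * (l * C.radius)) ^ 2 := by gcongr
        _ = _ := by ring)
  have b2 : |fderiv ℝ φ x (C.corner l x - x) * C.cellCharge l (fun x => f x / l) x| ≤
      D * (l * C.radius) * ‖C.cellCharge l (fun x => f x / l) x‖ := by
    rw [abs_mul, ← Real.norm_eq_abs, ← Real.norm_eq_abs]
    gcongr
    refine ((fderiv ℝ φ x).le_opNorm _).trans ?_
    gcongr
    · exact hφ.bound_fderiv x
    · exact C.norm_corner_sub_le hl0 x
  refine (abs_add_le _ _).trans ((add_le_add b1 b2).trans (le_of_eq ?_))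
  ring

/-- The averaging identity turns the charge integral into an integral of cell integrals, and the
cell error is then integrated over x. The prefactor l is what survives; the local L¹ norm of the
cell charge is left on the right, to be bounded by neutrality. -/
theorem abs_charge_sub_polarization_le (hl : l ∈ Set.Ioc (0 : ℝ) 1) (hf : Measurable f)
    (hb0 : 0 ≤ b) (hb : CellBound C l f b) {φ : Space → ℝ} {R D : ℝ} (hφ : IsTame φ R D) :
    |volume.real C.shape * ((∫ x, φ x * (f x / l)) -
      ∫ x, inner ℝ (C.dipole l f x) (gradAlong (.id ℝ Space) φ x)) -
      ∫ x, φ x * C.cellCharge l (fun x => f x / l) x| ≤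
    l * (D * (4 * C.radius ^ 2 * (C.embConst * b) *
      volume.real (Metric.closedBall (0 : Space) (R + 2 * C.radius)) +
        C.radius * ∫ x in Metric.closedBall (0 : Space) (R + 2 * C.radius),
          ‖C.cellCharge l (fun x => f x / l) x‖)) := by
  have hc := hφ.contDiff.continuous
  have hq : IntegrableOn (C.cellCharge l (fun x => f x / l))
      (Metric.closedBall (0 : Space) (R + 2 * C.radius)) := by
    have := (integrableOn_cellCharge hf hb0 hb (R + 2 * C.radius)).div_const l
    exact this.congr (.of_forall fun x => (UnitCell.cellCharge_div l x).symm)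
  have hi1 : Integrable fun x => φ x * (f x / l) := by
    have := (integrable_of_compactSupport_mul hl hf hb hc hφ.hasCompactSupport).div_const l
    exact this.congr (.of_forall fun x => mul_div_assoc _ _ _)
  have hi2 : Integrable fun x => φ x * C.cellCharge l (fun x => f x / l) x := by
    have := (integrable_mul_cellCharge hf hb0 hb hc hφ.hasCompactSupport).div_const l
    refine this.congr (.of_forall fun x => ?_)
    simp only [UnitCell.cellCharge_div, mul_div_assoc]
  have hi3 := integrable_inner_dipole hf hb0 hb (continuous_gradAlong (.id ℝ Space) hφ.contDiff)
    (hasCompactSupport_gradAlong _ hφ.hasCompactSupport)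
  have hfin : volume (Metric.closedBall (0 : Space) (R + 2 * C.radius)) ≠ ⊤ :=
    measure_closedBall_lt_top.ne
  have hconst : Integrable (fun _ : Space => 4 * C.radius ^ 2 * (C.embConst * b))
      (volume.restrict (Metric.closedBall (0 : Space) (R + 2 * C.radius))) :=
    integrableOn_const hfin
  rw [mul_sub, ← C.integral_integral_corner_add hl.1 hi1, ← integral_const_mul,
    integral_sub_sub (C.integrable_corner_add hl.1 hi1).integral_prod_left (hi3.const_mul _) hi2, ← Real.norm_eq_abs]
  refine (norm_integral_le_of_norm_le (g := (Metric.closedBall (0 : Space)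
    (R + 2 * C.radius)).indicator (fun x => l * (D * (4 * C.radius ^ 2 * (C.embConst * b) +
        C.radius * ‖C.cellCharge l (fun x => f x / l) x‖)))) ?_ ?_).trans (le_of_eq ?_)
  · rw [integrable_indicator_iff measurableSet_closedBall]
    exact ((hconst.add (hq.norm.const_mul _)).const_mul _).const_mul _
  · refine .of_forall fun x => ?_
    refine le_trans (le_of_eq ?_) (abs_cell_error_le hl hf hb0 hb hφ x)
    rw [inner_dipole_gradAlong hf hb, ← mul_assoc, mul_inv_cancel₀ C.volume_shape_pos.ne',
      one_mul, Real.norm_eq_abs]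
    congr 1
    ring
  · rw [integral_indicator measurableSet_closedBall, integral_const_mul, integral_const_mul,
      integral_add hconst (hq.norm.const_mul _), integral_const_mul C.radius,
      setIntegral_const, smul_eq_mul]
    ring

/-- The uniform boundedness principle for functions on a set of finite measure. -/
theorem exists_integral_norm_le_of_weakly_bounded {K : Set Space} (hK : MeasurableSet K)
    (hKfin : volume K < ⊤) {q : ℕ → Space → ℝ} (hq : ∀ n, MemLp (q n) 2 (volume.restrict K))
    (hbd : ∀ φ : Space → ℝ, MemLp φ 2 volume → ∃ A, ∀ n, |∫ x, φ x * q n x| ≤ A) :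
    ∃ Λ, ∀ n, ∫ x in K, ‖q n x‖ ≤ Λ := by
  let f : ℕ → Lp ℝ 2 (volume.restrict K) := fun n => (hq n).toLp _
  -- The functionals h ↦ ∫ h q n on L²(K) are bounded pointwise, since h extended by zero is an
  -- admissible φ. Their uniform bound is an L²(K) bound on q n, which gives L¹(K) by
  -- Cauchy–Schwarz.
  obtain ⟨A, hA⟩ := banach_steinhaus (g := fun n => InnerProductSpace.toDual ℝ _ (f n)) (by
    intro h
    have hm : MemLp (K.indicator h) 2 volume :=
      (memLp_indicator_iff_restrict hK).2 (Lp.memLp h)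
    obtain ⟨A, hA⟩ := hbd _ hm
    refine ⟨A, fun n => (le_of_eq ?_).trans (hA n)⟩
    rw [InnerProductSpace.toDual_apply_apply, L2.inner_def, Real.norm_eq_abs]
    have : ∀ x, K.indicator h x * q n x = K.indicator (fun x => h x * q n x) x := fun x => by
      by_cases hx : x ∈ K <;> simp [hx]
    simp_rw [this]
    rw [integral_indicator hK]
    congr 1
    refine integral_congr_ae ?_
    filter_upwards [(hq n).coeFn_toLp] with x hx
    simp [f, hx, mul_comm])
  refine ⟨(ENNReal.ofReal A * volume K ^ (1 / 2 : ℝ)).toReal, fun n => ?_⟩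
  rw [integral_norm_eq_lintegral_enorm (hq n).1, ← eLpNorm_one_eq_lintegral_enorm]
  refine ENNReal.toReal_mono (ENNReal.mul_ne_top ENNReal.ofReal_ne_top
    (ENNReal.rpow_ne_top_of_nonneg (by norm_num) hKfin.ne)) ?_
  have h := eLpNorm_le_eLpNorm_mul_rpow_measure_univ (p := 1) (q := 2) (by norm_num) (hq n).1
  rw [show (1 / ENNReal.toReal 1 - 1 / ENNReal.toReal 2) = 1 / 2 by norm_num,
    Measure.restrict_apply_univ] at h
  refine h.trans ?_
  gcongr
  have h1 : ‖f n‖ ≤ A := by simpa using hA n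
  rw [Lp.norm_toLp] at h1
  exact (ENNReal.le_ofReal_iff_toReal_le (hq n).2.ne
    (ENNReal.toReal_nonneg.trans h1)).2 h1

/-! ### The limit of vanishing cell size at a fixed time -/

section Sequences

variable {C : UnitCell} {l : ℕ → ℝ} {b : ℝ} {f : ℕ → Space → ℝ}

/-- For each n the cell charge is bounded, but only by a multiple of 1 / l n. A bound uniform in n
comes from neutrality: convergent sequences of numbers are bounded, and the uniform boundedness
principle applies. -/
theorem exists_integral_cellCharge_le (hf : ∀ n, Measurable (f n)) (hb0 : 0 ≤ b)
    (hb : ∀ n, CellBound C (l n) (f n) b)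
    (hN : ∀ φ : Space → ℝ, MemLp φ 2 volume →
      Tendsto (fun n => ∫ x, φ x * C.cellCharge (l n) (fun x => f n x / l n) x) atTop (𝓝 0))
    (R : ℝ) : ∃ Λ, ∀ n,
      ∫ x in Metric.closedBall (0 : Space) R, ‖C.cellCharge (l n) (fun x => f n x / l n) x‖ ≤ Λ := by
  have hfin : IsFiniteMeasure (volume.restrict (Metric.closedBall (0 : Space) R)) :=
    ⟨by rw [Measure.restrict_apply_univ]; exact measure_closedBall_lt_top⟩
  refine exists_integral_norm_le_of_weakly_bounded measurableSet_closedBall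
    measure_closedBall_lt_top (fun n => ?_) fun φ hφ => ?_
  · refine MemLp.of_bound
      (UnitCell.measurable_cellCharge ((hf n).div_const _)).aestronglyMeasurable
      (C.embConst * b / ‖l n‖) (.of_forall fun x => ?_)
    rw [UnitCell.cellCharge_div, norm_div]
    gcongr
    exact UnitCell.norm_cellCharge_le (hf n) hb0 (hb n) x
  · obtain ⟨A, hA⟩ := (Metric.isBounded_range_of_tendsto _ (hN φ hφ)).subset_closedBall (0 : ℝ)
    exact ⟨A, fun n => by simpa using hA ⟨n, rfl⟩⟩

/-- The error estimate is l n times a bounded quantity, and the term with the cell charge tends to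
zero by neutrality. Dividing by |□| removes the only remaining trace of the cell. -/
theorem tendsto_charge_sub_polarization (hl : ∀ n, l n ∈ Set.Ioc (0 : ℝ) 1)
    (hl0 : Tendsto l atTop (𝓝 0)) (hf : ∀ n, Measurable (f n)) (hb0 : 0 ≤ b)
    (hb : ∀ n, CellBound C (l n) (f n) b)
    (hN : ∀ φ : Space → ℝ, MemLp φ 2 volume →
      Tendsto (fun n => ∫ x, φ x * C.cellCharge (l n) (fun x => f n x / l n) x) atTop (𝓝 0))
    {φ : Space → ℝ} {R D : ℝ} (hφ : IsTame φ R D) :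
    Tendsto (fun n => (∫ x, φ x * (f n x / l n)) -
      ∫ x, inner ℝ (C.dipole (l n) (f n) x) (gradAlong (.id ℝ Space) φ x)) atTop (𝓝 0) := by
  obtain ⟨Λ, hΛ⟩ := exists_integral_cellCharge_le hf hb0 hb hN (R + 2 * C.radius)
  have hv := C.volume_shape_pos
  have hD := hφ.nonneg
  have hr := C.radius_nonneg
  have h1 := hN φ (hφ.contDiff.continuous.memLp_of_hasCompactSupport hφ.hasCompactSupport)
  have h2 : Tendsto (fun n => volume.real C.shape * ((∫ x, φ x * (f n x / l n)) -
      ∫ x, inner ℝ (C.dipole (l n) (f n) x) (gradAlong (.id ℝ Space) φ x)) -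
      ∫ x, φ x * C.cellCharge (l n) (fun x => f n x / l n) x) atTop (𝓝 0) := by
    refine squeeze_zero_norm (a := fun n => l n * (D * (4 * C.radius ^ 2 * (C.embConst * b) *
      volume.real (Metric.closedBall (0 : Space) (R + 2 * C.radius)) + C.radius * Λ)))
      (fun n => ?_) (by simpa using hl0.mul_const _)
    refine (abs_charge_sub_polarization_le (hl n) (hf n) hb0 (hb n) hφ).trans ?_
    have := (hl n).1
    gcongr
    exact hΛ n
  have h3 := (h2.add h1).const_mul (volume.real C.shape)⁻¹
  simp only [add_zero, mul_zero, sub_add_cancel] at h3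
  refine h3.congr fun n => ?_
  rw [← mul_assoc, inv_mul_cancel₀ hv.ne', one_mul]

/-- The bound is uniform in n and over all test functions with the same tameness constants. It
serves as the bound at a single time from which the space-time bound is propagated. -/
theorem exists_abs_charge_le (hl : ∀ n, l n ∈ Set.Ioc (0 : ℝ) 1)
    (hf : ∀ n, Measurable (f n)) (hb0 : 0 ≤ b)
    (hb : ∀ n, CellBound C (l n) (f n) b)
    (hN : ∀ φ : Space → ℝ, MemLp φ 2 volume →
      Tendsto (fun n => ∫ x, φ x * C.cellCharge (l n) (fun x => f n x / l n) x) atTop (𝓝 0))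
    (R D : ℝ) : ∃ Λ, ∀ φ : Space → ℝ, IsTame φ R D → ∀ n, |∫ x, φ x * (f n x / l n)| ≤ Λ := by
  obtain ⟨Λ, hΛ⟩ := exists_integral_cellCharge_le hf hb0 hb hN (R + 2 * C.radius)
  obtain ⟨Λ', hΛ'⟩ := exists_integral_cellCharge_le hf hb0 hb hN R
  have hv := C.volume_shape_pos
  have hr := C.radius_nonneg
  have hK := C.embConst_nonneg
  refine ⟨(volume.real C.shape)⁻¹ * (1 * (D * (4 * C.radius ^ 2 * (C.embConst * b) *
      volume.real (Metric.closedBall (0 : Space) (R + 2 * C.radius)) + C.radius * Λ)) + D * Λ' +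
      C.radius * (C.embConst * b) * D * volume.real (Metric.closedBall (0 : Space) R)),
    fun φ hφ n => ?_⟩
  have hD := hφ.nonneg
  have hsup : ∀ g : Space → ℝ, (∀ x, R < ‖x‖ → g x = 0) →
      ∫ x, g x = ∫ x in Metric.closedBall (0 : Space) R, g x := fun g hg =>
    (setIntegral_eq_integral_of_forall_compl_eq_zero fun x hx => hg x (by simpa using hx)).symm
  have h1 := abs_charge_sub_polarization_le (hl n) (hf n) hb0 (hb n) hφ
  have h2 : |∫ x, φ x * C.cellCharge (l n) (fun x => f n x / l n) x| ≤ D * Λ' := by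
    rw [hsup _ fun x hx => by rw [hφ.eq_zero x hx, zero_mul]]
    refine le_trans ?_ (mul_le_mul_of_nonneg_left (hΛ' n) hD)
    rw [← integral_const_mul, ← Real.norm_eq_abs]
    have hq := (integrableOn_cellCharge (hf n) hb0 (hb n) R).div_const (l n)
    have hq' : IntegrableOn (C.cellCharge (l n) (fun x => f n x / l n))
      (Metric.closedBall (0 : Space) R) :=
      hq.congr (.of_forall fun x => (UnitCell.cellCharge_div _ x).symm)
    refine norm_integral_le_of_norm_le (hq'.norm.const_mul D) (.of_forall fun x => ?_)
    rw [norm_mul]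
    gcongr
    exact hφ.bound x
  have h3 : |∫ x, inner ℝ (C.dipole (l n) (f n) x) (gradAlong (.id ℝ Space) φ x)| ≤
      (volume.real C.shape)⁻¹ * (C.radius * (C.embConst * b)) * D *
        volume.real (Metric.closedBall (0 : Space) R) := by
    rw [hsup _ fun x hx => by
      rw [inner_gradAlong, hφ.fderiv_eq_zero x hx]; rfl]
    rw [← Real.norm_eq_abs]
    refine norm_setIntegral_le_of_norm_le_const measure_closedBall_lt_top fun x _ => ?_
    rw [inner_gradAlong, ContinuousLinearMap.id_apply, mul_comm]
    refine ((fderiv ℝ φ x).le_opNorm _).trans ?_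
    gcongr
    · exact hφ.bound_fderiv x
    · exact UnitCell.norm_dipole_le (hf n) hb0 (hb n) x
  have h4 : l n * (D * (4 * C.radius ^ 2 * (C.embConst * b) *
      volume.real (Metric.closedBall (0 : Space) (R + 2 * C.radius)) +
        C.radius * ∫ x in Metric.closedBall (0 : Space) (R + 2 * C.radius),
          ‖C.cellCharge (l n) (fun x => f n x / l n) x‖)) ≤
      1 * (D * (4 * C.radius ^ 2 * (C.embConst * b) *
      volume.real (Metric.closedBall (0 : Space) (R + 2 * C.radius)) + C.radius * Λ)) := by
    have := (hl n).1
    gcongr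
    · exact (hl n).2
    · exact hΛ n
  replace h1 := h1.trans h4
  rw [abs_le] at h1 h2 h3 ⊢
  have h5 : volume.real C.shape * ((volume.real C.shape)⁻¹ * (C.radius * (C.embConst * b)) * D *
        volume.real (Metric.closedBall (0 : Space) R)) = C.radius * (C.embConst * b) * D *
        volume.real (Metric.closedBall (0 : Space) R) := by field_simp
  have h6 := mul_le_mul_of_nonneg_left h3.1 hv.le
  have h7 := mul_le_mul_of_nonneg_left h3.2 hv.le
  rw [mul_neg, h5] at h6
  rw [h5] at h7
  constructor
  · rw [← mul_neg, inv_mul_le_iff₀ hv]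
    linarith
  · rw [le_inv_mul_iff₀ hv]
    linarith

end Sequences

/-! ### Uniform tameness of slices of test functions -/

/-- The Taylor estimate is the mean value inequality for φ - Dφ(x) on the segment from x to y, where
Dφ differs from Dφ(x) by at most D ‖y - x‖. -/
theorem IsTame.of_lipschitz {φ : Space → ℝ} {R D : ℝ} (hφ : ContDiff ℝ 1 φ)
    (h0 : ∀ x, R < ‖x‖ → φ x = 0) (hD : ∀ x, |φ x| ≤ D) (hD' : ∀ x, ‖fderiv ℝ φ x‖ ≤ D)
    (hL : ∀ x y, ‖fderiv ℝ φ y - fderiv ℝ φ x‖ ≤ D * ‖y - x‖) : IsTame φ R D := by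
  refine ⟨hφ, h0, hD, hD', fun x y => ?_⟩
  have hd : Differentiable ℝ φ := hφ.differentiable one_ne_zero
  have hD0 : 0 ≤ D := (abs_nonneg _).trans (hD 0)
  have := (convex_segment x y).norm_image_sub_le_of_norm_hasFDerivWithin_le'
    (f := φ) (f' := fderiv ℝ φ) (φ := fderiv ℝ φ x) (C := D * ‖y - x‖) (x := x) (y := y)
    (fun z _ => (hd z).hasFDerivAt.hasFDerivWithinAt) (fun z hz => ?_)
    (left_mem_segment ℝ x y) (right_mem_segment ℝ x y)
  · rw [Real.norm_eq_abs] at this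
    exact this.trans (le_of_eq (by ring))
  · refine (hL x z).trans (mul_le_mul_of_nonneg_left ?_ hD0)
    exact norm_sub_le_of_mem_segment hz

section Slices

variable {E : Type*} [NormedAddCommGroup E] [NormedSpace ℝ E]

/-- The restrictions of a test function to affine images of space are uniformly tame. -/
theorem exists_isTame_comp {φ : E → ℝ} (hφ : ContDiff ℝ 2 φ) (hc : HasCompactSupport φ)
    (L : Space →L[ℝ] E) {R : ℝ} :
    ∃ D, ∀ e : E, (∀ x, R < ‖x‖ → φ (e + L x) = 0) → IsTame (fun x => φ (e + L x)) R D := by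
  obtain ⟨D1, hD1⟩ := hφ.continuous.bounded_above_of_compact_support hc
  have hφ' : ContDiff ℝ 1 (fderiv ℝ φ) := hφ.fderiv_right (m := 1) (by norm_num)
  obtain ⟨D2, hD2⟩ := hφ'.continuous.bounded_above_of_compact_support (hc.fderiv ℝ)
  obtain ⟨D3, hD3⟩ := hφ'.lipschitzWith_of_hasCompactSupport (hc.fderiv ℝ) one_ne_zero
  -- The three terms bound the function, its derivative and the Lipschitz constant of its
  -- derivative, with one factor ‖L‖ for each application of the chain rule; none depends on the
  -- base point e.
  refine ⟨D1 + D2 * ‖L‖ + D3 * ‖L‖ * ‖L‖, fun e h0 => ?_⟩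
  have h1 : 0 ≤ D1 := (norm_nonneg _).trans (hD1 0)
  have h2 : 0 ≤ D2 * ‖L‖ := mul_nonneg ((norm_nonneg _).trans (hD2 0)) (norm_nonneg _)
  have h3 : 0 ≤ D3 * ‖L‖ * ‖L‖ := by positivity
  have hfd : ∀ x, fderiv ℝ (fun x => φ (e + L x)) x = (fderiv ℝ φ (e + L x)).comp L := fun x =>
    ((hφ.differentiable two_ne_zero _).hasFDerivAt.comp x (L.hasFDerivAt.const_add e)).fderiv
  refine IsTame.of_lipschitz ?_ h0 (fun x => ?_) (fun x => ?_) fun x y => ?_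
  · exact (hφ.of_le (by norm_num)).comp (contDiff_const.add L.contDiff)
  · exact (hD1 _).trans (by linarith)
  · rw [hfd]
    refine (ContinuousLinearMap.opNorm_comp_le _ _).trans ?_
    have := mul_le_mul_of_nonneg_right (hD2 (e + L x)) (norm_nonneg L)
    linarith
  · rw [hfd, hfd, ← ContinuousLinearMap.sub_comp]
    refine (ContinuousLinearMap.opNorm_comp_le _ _).trans ?_
    have h4 : ‖fderiv ℝ φ (e + L y) - fderiv ℝ φ (e + L x)‖ ≤ D3 * (‖L‖ * ‖y - x‖) := by
      refine (hD3.norm_sub_le _ _).trans (mul_le_mul_of_nonneg_left ?_ D3.2)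
      rw [add_sub_add_left_eq_sub, ← map_sub]
      exact L.le_opNorm _
    calc _ ≤ D3 * (‖L‖ * ‖y - x‖) * ‖L‖ := mul_le_mul_of_nonneg_right h4 (norm_nonneg _)
      _ = D3 * ‖L‖ * ‖L‖ * ‖y - x‖ := by ring
      _ ≤ _ := mul_le_mul_of_nonneg_right (by linarith) (norm_nonneg _)

end Slices

theorem fderiv_slice {φ : ℝ × Space → ℝ} (hφ : Differentiable ℝ φ) (t : ℝ) (x : Space) :
    fderiv ℝ (fun x => φ (t, x)) x = (fderiv ℝ φ (t, x)).comp spaceIncl :=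
  ((hφ (t, x)).hasFDerivAt.comp x (hasFDerivAt_prodMk_right t x)).fderiv

theorem gradAlong_slice {φ : ℝ × Space → ℝ} (hφ : Differentiable ℝ φ) (t : ℝ) (x : Space) :
    gradAlong (.id ℝ Space) (fun x => φ (t, x)) x = gradAlong spaceIncl φ (t, x) := by
  ext i
  simp only [gradAlong_apply, fderiv_slice hφ]
  rfl

theorem exists_isTame {φ : Space → ℝ} (hφ : ContDiff ℝ 2 φ) (hc : HasCompactSupport φ) :
    ∃ R D, IsTame φ R D := by
  obtain ⟨R, hR⟩ := hc.isCompact.isBounded.subset_closedBall (0 : Space)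
  obtain ⟨D, hD⟩ := exists_isTame_comp hφ hc (.id ℝ Space) (R := R)
  refine ⟨R, D, ?_⟩
  have := hD 0 fun x hx => by
    rw [zero_add]
    exact image_eq_zero_of_notMem_tsupport fun h =>
      absurd (mem_closedBall_zero_iff.1 (hR h)) hx.not_ge
  simpa using this

theorem exists_isTame_slice {φ : ℝ × Space → ℝ} (hφ : ContDiff ℝ 2 φ) (hc : HasCompactSupport φ)
    {R : ℝ} (hR : ∀ t x, R < ‖x‖ → φ (t, x) = 0) :
    ∃ D, ∀ t, IsTame (fun x => φ (t, x)) R D := by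
  obtain ⟨D, hD⟩ := exists_isTame_comp hφ hc spaceIncl (R := R)
  refine ⟨D, fun t => ?_⟩
  have := hD (t, 0) fun x hx => by simpa using hR t x hx
  simpa using this

theorem eLpNorm_spaceWeight_smul_le {F : Space → Space} {c : ℝ} (hF : ∀ x, ‖F x‖ ≤ c) :
    eLpNorm (fun x => spaceWeight x • F x) 2 volume ≤
      ENNReal.ofReal (c * (eLpNorm spaceWeight 2 volume).toReal) := by
  have hc : 0 ≤ c := (norm_nonneg _).trans (hF 0)
  rw [ENNReal.ofReal_mul hc, ENNReal.ofReal_toReal memLp_spaceWeight.2.ne]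
  refine eLpNorm_le_mul_eLpNorm_of_ae_le_mul (.of_forall fun x => ?_) 2
  rw [norm_smul, mul_comm]
  exact mul_le_mul_of_nonneg_right (hF x) (norm_nonneg _)

variable {𝒰 : Set UnitCell} {l : ℕ → ℝ} {ρ : ℕ → ℝ × Space → ℝ} {j : ℕ → ℝ × Space → Space}

/-! ### The bound charge at a fixed time -/

namespace ChargeSequence

theorem comp (h : ChargeSequence 𝒰 l ρ j) {σ : ℕ → ℕ} (hσ : StrictMono σ) :
    ChargeSequence 𝒰 (fun n => l (σ n)) (fun n => ρ (σ n)) (fun n => j (σ n)) where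
  scale_mem n := h.scale_mem _
  scale_tendsto := h.scale_tendsto.comp hσ.tendsto_atTop
  measurable_charge n := h.measurable_charge _
  measurable_current n := h.measurable_current _
  neutral t ht C hC φ hφ :=
    ⟨fun n => (h.neutral t ht C hC φ hφ).1 _, (h.neutral t ht C hC φ hφ).2.comp hσ.tendsto_atTop⟩
  cell_bound C hC := by
    obtain ⟨B, hB, hb⟩ := h.cell_bound C hC
    exact ⟨B, hB, fun n => hb _⟩
  decay n := h.decay _
  current_bound := by
    obtain ⟨M, hM, hb⟩ := h.current_bound
    exact ⟨M, hM, fun n => hb _⟩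
  continuity n := h.continuity _

theorem exists_cellBound (h : ChargeSequence 𝒰 l ρ j) {C : UnitCell} (hC : C ∈ 𝒰) :
    ∃ B : ℝ → ℝ, LocallyIntegrableOn B (Set.Ioi 0) ∧ (∀ t, 0 ≤ B t) ∧
      ∀ n, ∀ t > 0, CellBound C (l n) (fun x => ρ n (t, x)) (B t) := by
  obtain ⟨B, hB, hb⟩ := h.cell_bound C hC
  exact ⟨fun t => |B t|, hB.norm, fun t => abs_nonneg _, fun n t ht x =>
    (hb n t ht x).trans (ENNReal.ofReal_le_ofReal (le_abs_self _))⟩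

theorem measurable_slice (h : ChargeSequence 𝒰 l ρ j) (n : ℕ) (t : ℝ) :
    Measurable fun x => ρ n (t, x) :=
  (h.measurable_charge n).comp measurable_prodMk_left

theorem neutral_tendsto (h : ChargeSequence 𝒰 l ρ j) {C : UnitCell} (hC : C ∈ 𝒰) {t : ℝ}
    (ht : 0 < t) (φ : Space → ℝ) (hφ : MemLp φ 2 volume) :
    Tendsto (fun n => ∫ x, φ x * C.cellCharge (l n) (fun x => ρ n (t, x) / l n) x) atTop (𝓝 0) :=
  (h.neutral t ht C hC φ hφ).2

theorem locallyIntegrable_slice (h : ChargeSequence 𝒰 l ρ j) {C : UnitCell} (hC : C ∈ 𝒰) {t : ℝ}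
    (ht : 0 < t) (n : ℕ) : LocallyIntegrable fun x => ρ n (t, x) / l n := by
  obtain ⟨B, hB, -, hb⟩ := h.exists_cellBound hC
  intro x
  refine ⟨Metric.closedBall 0 (‖x‖ + 1), ?_, ?_⟩
  · exact mem_of_superset (Metric.isOpen_ball.mem_nhds (by simp)) Metric.ball_subset_closedBall
  · exact (UnitCell.integrableOn_closedBall (h.scale_mem n) (h.measurable_slice n t)
      (hb n t ht) _).div_const _

/-- The limit of the charges is cell independent by nature; here it is expressed through the
polarization of an arbitrary cell, so any two weak limits have the same divergence. -/
theorem tendsto_ofFun_slice (h : ChargeSequence 𝒰 l ρ j) {C : UnitCell} (hC : C ∈ 𝒰) {t : ℝ}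
    (ht : 0 < t) {p : Space → Space}
    (hp : IsWeakLimit ⊤ (fun n => C.dipole (l n) fun x => ρ n (t, x)) p)
    (φ : 𝓓((⊤ : Opens Space), ℝ)) :
    Tendsto (fun n => ofFun ⊤ (fun x => ρ n (t, x) / l n) φ) atTop (𝓝 (-divergence p φ)) := by
  obtain ⟨B, hB, hB0, hb⟩ := h.exists_cellBound hC
  obtain ⟨R, D, hφ⟩ := exists_isTame (φ.contDiff.of_le two_le_smooth) φ.hasCompactSupport
  have h1 := tendsto_charge_sub_polarization h.scale_mem h.scale_tendsto
    (fun n => h.measurable_slice n t) (hB0 t) (fun n => hb n t ht) (h.neutral_tendsto hC ht) hφ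
  have h2 := hp.2 _ (continuous_gradAlong (.id ℝ Space) hφ.contDiff)
    (hasCompactSupport_gradAlong _ φ.hasCompactSupport) (fun _ _ => trivial)
  rw [divergence_apply hp.1, neg_neg]
  have h3 := h1.add h2
  rw [zero_add] at h3
  refine h3.congr fun n => ?_
  rw [sub_add_cancel, ofFun_apply ((h.locallyIntegrable_slice hC ht n).locallyIntegrableOn _)]

theorem exists_weakLimit_slice (h : ChargeSequence 𝒰 l ρ j) {C : UnitCell} (hC : C ∈ 𝒰) {t : ℝ}
    (ht : 0 < t) : ∃ τ : ℕ → ℕ, StrictMono τ ∧ ∃ p : Space → Space,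
      IsWeakLimit ⊤ (fun n => C.dipole (l (τ n)) fun x => ρ (τ n) (t, x)) p := by
  obtain ⟨B, hB, hB0, hb⟩ := h.exists_cellBound hC
  have hm : ∀ n, Measurable (C.dipole (l n) fun x => ρ n (t, x)) := fun n =>
    C.measurable_dipole (l n) (h.measurable_slice n t)
  exact exists_isWeakLimit_subseq_space (F := fun n => C.dipole (l n) fun x => ρ n (t, x)) hm
    fun n => eLpNorm_spaceWeight_smul_le
      (UnitCell.norm_dipole_le (h.measurable_slice n t) (hB0 t) (hb n t ht))

end ChargeSequence

/-! ### Mollification, and functions of time with an integrable weak derivative -/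

/-- A shrinking sequence of bump functions. -/
def bump (E : Type*) [NormedAddCommGroup E] (k : ℕ) : ContDiffBump (0 : E) where
  rIn := 1 / (2 * (k + 1))
  rOut := 1 / (k + 1)
  rIn_pos := by positivity
  rIn_lt_rOut := by
    apply one_div_lt_one_div_of_lt <;> [positivity; nlinarith [(k.cast_nonneg : (0 : ℝ) ≤ k)]]

theorem tendsto_bump_rOut (E : Type*) [NormedAddCommGroup E] :
    Tendsto (fun k => (bump E k).rOut) atTop (𝓝 0) :=
  tendsto_one_div_add_atTop_nhds_zero_nat

theorem bump_rOut_le_one (E : Type*) [NormedAddCommGroup E] (k : ℕ) : (bump E k).rOut ≤ 1 := by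
  simp only [bump]
  rw [div_le_one (by positivity)]
  linarith [(k.cast_nonneg : (0 : ℝ) ≤ k)]

section

variable {E : Type*} [NormedAddCommGroup E] [NormedSpace ℝ E] [HasContDiffBump E]
  [MeasurableSpace E] [BorelSpace E] [FiniteDimensional ℝ E]

theorem ae_tendsto_bump_average (μ : Measure E) [μ.IsAddHaarMeasure] {g : E → ℝ}
    (hg : LocallyIntegrable g μ) :
    ∀ᵐ x ∂μ, Tendsto (fun k => ∫ y, (bump E k).normed μ (x - y) * g y ∂μ) atTop (𝓝 (g x)) := by
  -- The constant 2 is the ratio of the outer to the inner radius of the bumps; its boundedness is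
  -- what Lebesgue differentiation requires.
  filter_upwards [ContDiffBump.ae_convolution_tendsto_right_of_locallyIntegrable (K := 2)
    (tendsto_bump_rOut E) (.of_forall fun k => by simp only [bump]; field_simp; rfl) hg] with x hx
  simpa only [convolution_lsmul_swap, smul_eq_mul] using hx

end

/-- The difference of the averages at t and s is ∫ θ g with θ a difference of two bumps of mass one.
As θ has mean zero, it is the derivative of a test function ψ with |ψ| ≤ 1, and the weak derivative
turns ∫ ψ' g into -∫ ψ h. -/
theorem abs_bump_average_sub_le {a b : ℝ} {g h : ℝ → ℝ} (hg : IntegrableOn g (Set.Ioo a b))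
    (hh : IntegrableOn h (Set.Ioo a b))
    (hw : ∀ χ : ℝ → ℝ, ContDiff ℝ (⊤ : ℕ∞) χ → HasCompactSupport χ → tsupport χ ⊆ Set.Ioo a b →
      ∫ t, deriv χ t * g t = -∫ t, χ t * h t)
    {s t a' b' : ℝ} (ha : a < a') (hb : b' < b) (k : ℕ)
    (hs : Metric.closedBall s (bump ℝ k).rOut ⊆ Set.Icc a' b')
    (ht : Metric.closedBall t (bump ℝ k).rOut ⊆ Set.Icc a' b') :
    |(∫ r, (bump ℝ k).normed volume (t - r) * (Set.Ioo a b).indicator g r) -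
      ∫ r, (bump ℝ k).normed volume (s - r) * (Set.Ioo a b).indicator g r| ≤
      ∫ r in Set.Ioo a b, |h r| := by
  set η := (bump ℝ k).normed volume with hη
  have hη0 : ∀ c r, Metric.closedBall c (bump ℝ k).rOut ⊆ Set.Icc a' b' → r ∉ Set.Icc a' b' →
      η (c - r) = 0 := by
    intro c r hc hr
    refine image_eq_zero_of_notMem_tsupport fun h => hr (hc ?_)
    rw [hη, ContDiffBump.tsupport_normed_eq, mem_closedBall_zero_iff] at h
    rwa [Metric.mem_closedBall, dist_comm, dist_eq_norm]
  have hηc : ∀ c : ℝ, ContDiff ℝ (⊤ : ℕ∞) fun r => η (c - r) := fun c =>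
    (ContDiffBump.contDiff_normed _).comp (contDiff_const.sub contDiff_id)
  have hηi : ∀ c : ℝ, Integrable fun r => η (c - r) := fun c =>
    (ContDiffBump.integrable_normed _).comp_sub_left c
  have hη1 : ∀ c : ℝ, ∫ r, η (c - r) = 1 := fun c =>
    (integral_sub_left_eq_self η volume c).trans (ContDiffBump.integral_normed _)
  have hηnn : ∀ r, 0 ≤ η r := fun r => ContDiffBump.nonneg_normed _ r
  let θ : ℝ → ℝ := fun r => η (t - r) - η (s - r)
  have hθ0 : ∀ r ∉ Set.Icc a' b', θ r = 0 := fun r hr => by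
    simp only [θ, hη0 t r ht hr, hη0 s r hs hr, sub_zero]
  have hθc : ContDiff ℝ (⊤ : ℕ∞) θ := (hηc t).sub (hηc s)
  let ψ : ℝ → ℝ := fun r => ∫ x in a..r, θ x
  have hψd : ∀ r, HasDerivAt ψ (θ r) r := fun r =>
    hθc.continuous.integral_hasStrictDerivAt a r |>.hasDerivAt
  have hψ' : deriv ψ = θ := funext fun r => (hψd r).deriv
  have hψc : ContDiff ℝ (⊤ : ℕ∞) ψ := by
    refine contDiff_infty_iff_deriv.2 ⟨fun r => (hψd r).differentiableAt, ?_⟩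
    rw [hψ']
    exact hθc
  have hψ0 : ∀ r ∉ Set.Icc a' b', ψ r = 0 := by
    intro r hr
    rw [Set.mem_Icc, not_and_or, not_le, not_le] at hr
    rcases hr with hr | hr
    · refine intervalIntegral.integral_zero_ae (.of_forall fun x hx => hθ0 x fun hx' => ?_)
      have := (Set.mem_uIoc.1 hx)
      rcases this with h1 | h1
      · linarith [h1.2, hx'.1]
      · linarith [h1.2, hx'.1]
    -- To the right of both bumps ψ equals the total integral of θ, which is 1 - 1 = 0; this gives ψ
    -- compact support in (a, b).
    · have h1 : ψ r = ∫ x, θ x := by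
        refine intervalIntegral.integral_eq_integral_of_support_subset fun x hx => ?_
        have : x ∈ Set.Icc a' b' := by
          by_contra h
          exact hx (hθ0 x h)
        exact ⟨ha.trans_le this.1, this.2.trans hr.le⟩
      rw [h1, integral_sub (hηi t) (hηi s), hη1, hη1, sub_self]
  have hψ1 : ∀ r, |ψ r| ≤ 1 := by
    intro r
    by_cases hr : r ∈ Set.Icc a' b'
    swap
    · rw [hψ0 r hr]; simp
    have har : a ≤ r := ha.le.trans hr.1
    -- ψ(r) is a difference of two partial masses of bumps, each between 0 and 1.
    have hu : ∀ c : ℝ, (∫ x in a..r, η (c - x)) ∈ Set.Icc (0 : ℝ) 1 := by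
      intro c
      refine ⟨intervalIntegral.integral_nonneg har fun x _ => hηnn _, ?_⟩
      rw [intervalIntegral.integral_of_le har, ← hη1 c]
      exact setIntegral_le_integral (hηi c) (.of_forall fun x => hηnn _)
    have : ψ r = (∫ x in a..r, η (t - x)) - ∫ x in a..r, η (s - x) :=
      intervalIntegral.integral_sub (hηi t).intervalIntegrable (hηi s).intervalIntegrable
    rw [this, abs_le]
    constructor <;> linarith [(hu t).1, (hu t).2, (hu s).1, (hu s).2]
  have hψs : tsupport ψ ⊆ Set.Icc a' b' :=
    closure_minimal (fun r hr => by by_contra h; exact hr (hψ0 r h)) isClosed_Icc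
  have hsub : Set.Icc a' b' ⊆ Set.Ioo a b := fun r hr => ⟨ha.trans_le hr.1, hr.2.trans_lt hb⟩
  have key := hw ψ hψc (HasCompactSupport.of_support_subset_isCompact isCompact_Icc
    ((subset_tsupport ψ).trans hψs)) (hψs.trans hsub)
  have hG : Integrable ((Set.Ioo a b).indicator g) :=
    (integrable_indicator_iff measurableSet_Ioo).2 hg
  have hbd : ∀ c, Integrable fun r => η (c - r) * (Set.Ioo a b).indicator g r := fun c => by
    obtain ⟨D, hD⟩ := ((bump ℝ k).continuous_normed (μ := volume)).bounded_above_of_compact_support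
      ((bump ℝ k).hasCompactSupport_normed (μ := volume))
    exact hG.bdd_mul (hηc c).continuous.aestronglyMeasurable (.of_forall fun r => hD _)
  rw [← integral_sub (hbd t) (hbd s)]
  have e1 : ∫ r, (η (t - r) * (Set.Ioo a b).indicator g r - η (s - r) *
      (Set.Ioo a b).indicator g r) = ∫ r, deriv ψ r * g r := by
    rw [hψ']
    refine integral_congr_ae (.of_forall fun r => ?_)
    by_cases hr : r ∈ Set.Ioo a b
    · simp only [Set.indicator_of_mem hr, θ, sub_mul]
    · have : r ∉ Set.Icc a' b' := fun h => hr (hsub h)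
      simp only [Set.indicator_of_notMem hr, hθ0 r this, mul_zero, zero_mul, sub_zero]
  have e2 : ∫ r, ψ r * h r = ∫ r in Set.Ioo a b, ψ r * h r :=
    (setIntegral_eq_integral_of_forall_compl_eq_zero fun r hr => by
      rw [hψ0 r fun h => hr (hsub h), zero_mul]).symm
  rw [e1, key, abs_neg, e2, ← Real.norm_eq_abs]
  refine norm_integral_le_of_norm_le hh.norm (.of_forall fun r => ?_)
  rw [norm_mul]
  exact mul_le_of_le_one_left (norm_nonneg _) (hψ1 r)

/-- A function with an integrable weak derivative `h` is, off a null set, of oscillation at most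
`∫ |h|`. -/
theorem exists_full_set_abs_sub_le {a b : ℝ} {g h : ℝ → ℝ} (hg : IntegrableOn g (Set.Ioo a b))
    (hh : IntegrableOn h (Set.Ioo a b))
    (hw : ∀ χ : ℝ → ℝ, ContDiff ℝ (⊤ : ℕ∞) χ → HasCompactSupport χ → tsupport χ ⊆ Set.Ioo a b →
      ∫ t, deriv χ t * g t = -∫ t, χ t * h t) :
    ∃ A : Set ℝ, (∀ᵐ t, t ∈ Set.Ioo a b → t ∈ A) ∧
      ∀ s ∈ A, ∀ t ∈ A, |g t - g s| ≤ ∫ r in Set.Ioo a b, |h r| := by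
  have hG : Integrable ((Set.Ioo a b).indicator g) :=
    (integrable_indicator_iff measurableSet_Ioo).2 hg
  refine ⟨{t | t ∈ Set.Ioo a b ∧ Tendsto (fun k => ∫ y, (bump ℝ k).normed volume (t - y) *
    (Set.Ioo a b).indicator g y) atTop (𝓝 (g t))}, ?_, ?_⟩
  · filter_upwards [ae_tendsto_bump_average volume hG.locallyIntegrable] with t ht htab
    refine ⟨htab, ?_⟩
    rwa [Set.indicator_of_mem htab] at ht
  · rintro s ⟨hs, hs'⟩ t ⟨ht, ht'⟩
    refine le_of_tendsto (ht'.sub hs').abs ?_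
    -- The margins a < a' and b' < b keep small bumps around s and t inside a fixed compact
    -- subinterval of (a, b).
    obtain ⟨a', ha, ha'⟩ := exists_between (lt_min hs.1 ht.1)
    obtain ⟨b', hb', hb⟩ := exists_between (max_lt hs.2 ht.2)
    rw [lt_min_iff] at ha'
    rw [max_lt_iff] at hb'
    have hε : 0 < min (min (s - a') (t - a')) (min (b' - s) (b' - t)) := by
      simp only [lt_min_iff]
      refine ⟨⟨?_, ?_⟩, ?_, ?_⟩ <;> linarith [ha'.1, ha'.2, hb'.1, hb'.2]
    filter_upwards [(tendsto_bump_rOut ℝ).eventually_lt_const hε] with k hk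
    simp only [lt_min_iff] at hk
    refine abs_bump_average_sub_le hg hh hw ha hb k ?_ ?_ <;>
      rw [Real.closedBall_eq_Icc] <;> apply Set.Icc_subset_Icc <;>
      linarith [hk.1.1, hk.1.2, hk.2.1, hk.2.2]

/-! ### Integrability on slabs of space-time -/

section Slabs

variable {V : Type*} [NormedAddCommGroup V]

theorem locallyIntegrableOn_spaceTime_of_slices [MeasurableSpace V] [BorelSpace V]
    [SecondCountableTopology V] {F : ℝ × Space → V} (hF : Measurable F)
    {B : ℝ → ℝ} (hB : LocallyIntegrableOn B (Set.Ioi 0)) {c : ℝ → ℝ}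
    (hFB : ∀ R, ∀ t > 0, ∫⁻ x in Metric.closedBall 0 R, ‖F (t, x)‖ₑ ≤ ENNReal.ofReal (c R * B t)) :
    LocallyIntegrableOn F spaceTime := by
  rw [locallyIntegrableOn_iff spaceTime.isOpen.isLocallyClosed]
  intro K hK hKc
  obtain ⟨a, b, R, ha, -, -, hKb⟩ := exists_box hKc hK
  refine IntegrableOn.mono_set ⟨hF.aestronglyMeasurable, ?_⟩ hKb
  have hBi : IntegrableOn (fun t => c R * B t) (Set.Icc a b) :=
    (hB.integrableOn_compact_subset (fun t ht => ha.trans_le ht.1) isCompact_Icc).const_mul _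
  rw [hasFiniteIntegral_iff_enorm, restrict_box, lintegral_prod _ hF.enorm.aemeasurable]
  refine (setLIntegral_mono' measurableSet_Icc fun t ht =>
    (hFB R t (ha.trans_le ht.1)).trans (Real.ofReal_le_enorm _)).trans_lt hBi.2

theorem restrict_slab_ball (a b R : ℝ) : (volume.restrict (Set.Ioo a b)).prod
    (volume.restrict (Metric.closedBall (0 : Space) R)) =
      volume.restrict (Set.Ioo a b ×ˢ Metric.closedBall (0 : Space) R) := by
  rw [Measure.volume_eq_prod, Measure.prod_restrict]

theorem integrableOn_slab_ball {F : ℝ × Space → V} (hF : LocallyIntegrableOn F spaceTime)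
    {a : ℝ} (ha : 0 < a) (b R : ℝ) :
    IntegrableOn F (Set.Ioo a b ×ˢ Metric.closedBall (0 : Space) R) :=
  (hF.integrableOn_compact_subset (box_subset ha)
    (isCompact_Icc.prod (isCompact_closedBall (0 : Space) R))).mono_set
    (Set.prod_mono Set.Ioo_subset_Icc_self subset_rfl)

theorem aestronglyMeasurable_slab {F : ℝ × Space → V} (hF : LocallyIntegrableOn F spaceTime)
    {a : ℝ} (ha : 0 < a) (b : ℝ) :
    AEStronglyMeasurable F ((volume.restrict (Set.Ioo a b)).prod volume) := by
  have h1 : AEStronglyMeasurable F (volume.restrict spaceTime) := hF.aestronglyMeasurable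
  rw [restrict_spaceTime] at h1
  exact h1.mono_measure (Measure.prod_mono
    (Measure.restrict_mono (fun t ht => ha.trans ht.1) le_rfl) le_rfl)

theorem integrable_slab [NormedSpace ℝ V] {F : ℝ × Space → V} (hF : LocallyIntegrableOn F spaceTime)
    {a : ℝ} (ha : 0 < a) (b : ℝ) {m : Space → ℝ} (hm : Continuous m) (hmc : HasCompactSupport m) :
    Integrable (fun z : ℝ × Space => m z.2 • F z) ((volume.restrict (Set.Ioo a b)).prod volume) := by
  obtain ⟨R, hR⟩ := hmc.isCompact.isBounded.subset_closedBall (0 : Space)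
  obtain ⟨D, hD⟩ := hm.bounded_above_of_compact_support hmc
  have h2 : Integrable (fun z : ℝ × Space => m z.2 • F z)
      (volume.restrict (Set.Ioo a b ×ˢ Metric.closedBall (0 : Space) R)) :=
    (integrableOn_slab_ball hF ha b R).bdd_smul (φ := fun z : ℝ × Space => m z.2) D
      (hm.comp continuous_snd).aestronglyMeasurable (.of_forall fun z => hD _)
  have h3 : volume.restrict (Set.Ioo a b ×ˢ Metric.closedBall (0 : Space) R) =
      ((volume.restrict (Set.Ioo a b)).prod volume).restrict
        (Set.univ ×ˢ Metric.closedBall (0 : Space) R) := by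
    rw [← Measure.prod_restrict, Measure.restrict_univ, restrict_slab_ball]
  rw [h3] at h2
  have hsupp : Function.support (fun z : ℝ × Space => m z.2 • F z) ⊆
      Set.univ ×ˢ Metric.closedBall (0 : Space) R := fun z hz =>
    ⟨trivial, hR (subset_tsupport m (left_ne_zero_of_smul hz))⟩
  exact (integrableOn_iff_integrable_of_support_subset hsupp).1 h2

theorem integrable_slab_inner {F : ℝ × Space → Space} (hF : LocallyIntegrableOn F spaceTime)
    {a : ℝ} (ha : 0 < a) (b : ℝ) {η : Space → Space} (hη : Continuous η)
    (hηc : HasCompactSupport η) :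
    Integrable (fun z : ℝ × Space => inner ℝ (F z) (η z.2))
      ((volume.restrict (Set.Ioo a b)).prod volume) := by
  refine (integrable_slab hF ha b hη.norm hηc.norm).norm.mono'
    ((aestronglyMeasurable_slab hF ha b).inner (hη.comp continuous_snd).aestronglyMeasurable)
    (.of_forall fun z => ?_)
  rw [norm_smul, norm_norm, mul_comm]
  exact norm_inner_le_norm _ _

theorem integrable_inner_of_compactSupport {F : ℝ × Space → Space}
    (hF : LocallyIntegrableOn F spaceTime) {η : ℝ × Space → Space} (hη : Continuous η)
    (hηc : HasCompactSupport η) (hηs : tsupport η ⊆ (spaceTime : Set (ℝ × Space))) :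
    Integrable fun z => inner ℝ (F z) (η z) := by
  obtain ⟨D, hD⟩ := hη.bounded_above_of_compact_support hηc
  have hi := hF.integrableOn_compact_subset hηs hηc
  have h : IntegrableOn (fun z => inner ℝ (F z) (η z)) (tsupport η) := by
    refine (hi.norm.mul_const D).mono' (hi.1.inner hη.aestronglyMeasurable) (.of_forall fun z => ?_)
    exact (norm_inner_le_norm _ _).trans (mul_le_mul_of_nonneg_left (hD z) (norm_nonneg _))
  refine (integrableOn_iff_integrable_of_support_subset fun z hz => ?_).1 h
  by_contra h0
  exact hz (by simp [image_eq_zero_of_notMem_tsupport h0])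

end Slabs

/-- The test function `χ(t) m(x)`. -/
def tensorTest {χ : ℝ → ℝ} (hχ : ContDiff ℝ (⊤ : ℕ∞) χ) (hχc : HasCompactSupport χ)
    (hχs : tsupport χ ⊆ Set.Ioi 0) {m : Space → ℝ} (hm : ContDiff ℝ (⊤ : ℕ∞) m)
    (hmc : HasCompactSupport m) : 𝓓(spaceTime, ℝ) :=
  have hsub : tsupport (fun z : ℝ × Space => χ z.1 * m z.2) ⊆ tsupport χ ×ˢ tsupport m :=
    closure_minimal (fun _ hz => ⟨subset_tsupport χ (left_ne_zero_of_mul hz),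
      subset_tsupport m (right_ne_zero_of_mul hz)⟩)
      ((isClosed_tsupport χ).prod (isClosed_tsupport m))
  ⟨fun z => χ z.1 * m z.2, (hχ.comp contDiff_fst).mul (hm.comp contDiff_snd),
    (hχc.isCompact.prod hmc.isCompact).of_isClosed_subset (isClosed_tsupport _) hsub,
    fun _ hz => ⟨hχs (hsub hz).1, trivial⟩⟩

/-! ### Product test functions and Fubini -/

section TensorTest

variable {χ : ℝ → ℝ} (hχ : ContDiff ℝ (⊤ : ℕ∞) χ) (hχc : HasCompactSupport χ)
    (hχs : tsupport χ ⊆ Set.Ioi 0) {m : Space → ℝ} (hm : ContDiff ℝ (⊤ : ℕ∞) m)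
    (hmc : HasCompactSupport m)

theorem tensorTest_apply (z : ℝ × Space) :
    tensorTest hχ hχc hχs hm hmc z = χ z.1 * m z.2 := rfl

theorem fderiv_tensorTest (z v : ℝ × Space) :
    fderiv ℝ (tensorTest hχ hχc hχs hm hmc) z v =
      deriv χ z.1 * v.1 * m z.2 + χ z.1 * fderiv ℝ m z.2 v.2 := by
  have h1 : HasFDerivAt (fun z : ℝ × Space => χ z.1) _ z :=
    ((hχ.differentiable (by simp)) z.1).hasFDerivAt.comp z hasFDerivAt_fst
  have h2 : HasFDerivAt (fun z : ℝ × Space => m z.2) _ z :=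
    ((hm.differentiable (by simp)) z.2).hasFDerivAt.comp z hasFDerivAt_snd
  have h3 : fderiv ℝ (tensorTest hχ hχc hχs hm hmc) z = _ := (h1.mul h2).fderiv
  rw [h3]
  simp [fderiv_eq_smul_deriv]
  ring

theorem gradAlong_tensorTest (z : ℝ × Space) :
    gradAlong spaceIncl (tensorTest hχ hχc hχs hm hmc) z =
      χ z.1 • gradAlong (.id ℝ Space) m z.2 := by
  ext i
  simp [gradAlong_apply, fderiv_tensorTest]

theorem integral_time_deriv_tensorTest {u : ℝ × Space → ℝ} (hu : LocallyIntegrableOn u spaceTime) :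
    ofFun spaceTime u (∂_{((1, 0) : ℝ × Space)} (tensorTest hχ hχc hχs hm hmc)) =
      ∫ t, deriv χ t * ∫ x, m x * u (t, x) := by
  rw [ofFun_apply hu, Measure.volume_eq_prod, integral_prod]
  · refine integral_congr_ae (.of_forall fun t => ?_)
    simp only [lineDerivOp_testFunction_apply, fderiv_tensorTest]
    rw [← integral_const_mul]
    congr 1 with x
    simp [mul_assoc]
  · exact integrable_mul_testFunction hu _

theorem integral_tensorTest {u : ℝ × Space → ℝ} (hu : LocallyIntegrableOn u spaceTime) :
    ofFun spaceTime u (tensorTest hχ hχc hχs hm hmc) = ∫ t, χ t * ∫ x, m x * u (t, x) := by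
  rw [ofFun_apply hu, Measure.volume_eq_prod, integral_prod]
  · refine integral_congr_ae (.of_forall fun t => ?_)
    simp only [tensorTest_apply]
    rw [← integral_const_mul]
    congr 1 with x
    simp [mul_assoc]
  · exact integrable_mul_testFunction hu _

theorem spaceDiv_tensorTest {F : ℝ × Space → Space} (hF : LocallyIntegrableOn F spaceTime) :
    spaceDiv F (tensorTest hχ hχc hχs hm hmc) =
      -∫ t, χ t * ∫ x, inner ℝ (F (t, x)) (gradAlong (.id ℝ Space) m x) := by
  have hψ := (tensorTest hχ hχc hχs hm hmc).contDiff
  rw [spaceDiv_apply hF, Measure.volume_eq_prod, integral_prod]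
  · congr 1
    refine integral_congr_ae (.of_forall fun t => ?_)
    simp only [gradAlong_tensorTest, inner_smul_right]
    rw [← integral_const_mul]
  · exact integrable_inner_of_compactSupport hF (continuous_gradAlong _ (hψ.of_le (by simp)))
      (hasCompactSupport_gradAlong _ (tensorTest hχ hχc hχs hm hmc).hasCompactSupport)
      ((tsupport_gradAlong_subset _ _).trans (tensorTest hχ hχc hχs hm hmc).tsupport_subset)

end TensorTest

theorem timeDeriv_apply (T : 𝓓'(spaceTime, ℝ)) (φ : 𝓓(spaceTime, ℝ)) :
    timeDeriv T φ = -T (∂_{((1, 0) : ℝ × Space)} φ) := by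
  rw [timeDeriv, Distribution.lineDerivOp_apply_apply, map_neg]

/-- Cauchy–Schwarz in L²(ℝ³). -/
theorem abs_integral_inner_le {F η : Space → Space} (hF : AEStronglyMeasurable F volume)
    {M : ℝ} (hM0 : 0 ≤ M) (hM : eLpNorm F 2 volume ≤ ENNReal.ofReal M) (hη : MemLp η 2 volume) :
    |∫ x, inner ℝ (F x) (η x)| ≤ M * (eLpNorm η 2 volume).toReal := by
  have hF2 : MemLp F 2 volume := ⟨hF, hM.trans_lt ENNReal.ofReal_lt_top⟩
  have h := norm_inner_le_norm (𝕜 := ℝ) (hF2.toLp F) (hη.toLp η)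
  rw [Lp.norm_toLp, Lp.norm_toLp, L2.inner_def, Real.norm_eq_abs] at h
  have e : ∫ x, inner ℝ (F x) (η x) = ∫ x, inner ℝ (hF2.toLp F x) (hη.toLp η x) := by
    refine integral_congr_ae ?_
    filter_upwards [hF2.coeFn_toLp, hη.coeFn_toLp] with x h1 h2
    rw [h1, h2]
  rw [e]
  refine h.trans ?_
  gcongr
  exact ENNReal.toReal_le_of_le_ofReal hM0 hM

theorem eLpNorm_toReal_le_of_support {η : Space → Space} {R D : ℝ}
    (hD : ∀ x, ‖η x‖ ≤ D) (h0 : ∀ x, R < ‖x‖ → η x = 0) :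
    (eLpNorm η 2 volume).toReal ≤
      (volume (Metric.closedBall (0 : Space) R) ^ (1 / 2 : ℝ) * ENNReal.ofReal D).toReal := by
  have h1 : Function.support η ⊆ Metric.closedBall (0 : Space) R := fun x hx => by
    by_contra h
    exact hx (h0 x (by simpa using h))
  rw [← eLpNorm_restrict_eq_of_support_subset h1]
  refine ENNReal.toReal_mono (ENNReal.mul_ne_top (ENNReal.rpow_ne_top_of_nonneg (by norm_num)
    measure_closedBall_lt_top.ne) ENNReal.ofReal_ne_top) ?_
  have := eLpNorm_le_of_ae_bound (p := 2) (μ := volume.restrict (Metric.closedBall (0 : Space) R))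
    (f := η) (C := D) (.of_forall hD)
  rw [Measure.restrict_apply_univ] at this
  simpa using this

variable {𝒰 : Set UnitCell} {l : ℕ → ℝ} {ρ : ℕ → ℝ × Space → ℝ} {j : ℕ → ℝ × Space → Space}

/-! ### Convergence of the charges on space-time -/

namespace ChargeSequence

theorem exists_currentBound (h : ChargeSequence 𝒰 l ρ j) :
    ∃ M : ℝ → ℝ, LocallyIntegrableOn M (Set.Ioi 0) ∧ (∀ t, 0 ≤ M t) ∧
      ∀ n, ∀ t > 0, eLpNorm (fun x => j n (t, x)) 2 volume ≤ ENNReal.ofReal (M t) := by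
  obtain ⟨M, hM, hb⟩ := h.current_bound
  exact ⟨fun t => |M t|, hM.norm, fun t => abs_nonneg _, fun n t ht =>
    (hb n t ht).trans (ENNReal.ofReal_le_ofReal (le_abs_self _))⟩

theorem locallyIntegrableOn_charge (h : ChargeSequence 𝒰 l ρ j) {C : UnitCell} (hC : C ∈ 𝒰)
    (n : ℕ) : LocallyIntegrableOn (fun z => ρ n z / l n) spaceTime := by
  obtain ⟨B, hB, hB0, hb⟩ := h.exists_cellBound hC
  have h1 : LocallyIntegrableOn (ρ n) spaceTime :=
    locallyIntegrableOn_spaceTime_of_slices (h.measurable_charge n) hB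
      fun R t ht => UnitCell.lintegral_closedBall_le' (h.scale_mem n) (h.measurable_slice n t)
        (hb n t ht) R
  intro x hx
  obtain ⟨u, hu, hi⟩ := h1 x hx
  exact ⟨u, hu, hi.div_const _⟩

theorem locallyIntegrableOn_polarization (h : ChargeSequence 𝒰 l ρ j) {C : UnitCell} (hC : C ∈ 𝒰)
    (n : ℕ) : LocallyIntegrableOn (polarization C (l n) (ρ n)) spaceTime := by
  obtain ⟨B, hB, hB0, hb⟩ := h.exists_cellBound hC
  have hm : Measurable (polarization C (l n) (ρ n)) :=
    measurable_polarization C _ (h.measurable_charge n)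
  let c : ℝ := (volume.real C.shape)⁻¹ * (C.radius * C.embConst)
  have h1 : ∀ t > 0, ∀ x, ‖polarization C (l n) (ρ n) (t, x)‖ₑ ≤ ENNReal.ofReal (c * B t) := by
    intro t ht x
    have h2 : ‖C.dipole (l n) (fun x => ρ n (t, x)) x‖ ≤
        (volume.real C.shape)⁻¹ * (C.radius * (C.embConst * B t)) :=
      UnitCell.norm_dipole_le (h.measurable_slice n t) (hB0 t) (hb n t ht) x
    rw [← ofReal_norm]
    exact ENNReal.ofReal_le_ofReal (h2.trans (le_of_eq (by simp only [c]; ring)))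
  let c' : ℝ → ℝ := fun R => volume.real (Metric.closedBall (0 : Space) R) * c
  refine locallyIntegrableOn_spaceTime_of_slices hm hB (c := c') fun R t ht => ?_
  refine (lintegral_mono fun x => h1 t ht x).trans (le_of_eq ?_)
  rw [setLIntegral_const, ← ofReal_measureReal (measure_closedBall_lt_top (x := (0 : Space))).ne,
    mul_comm, ← ENNReal.ofReal_mul measureReal_nonneg, ← mul_assoc]

theorem locallyIntegrableOn_current (h : ChargeSequence 𝒰 l ρ j) (n : ℕ) :
    LocallyIntegrableOn (j n) spaceTime := by
  obtain ⟨M, hM, hM0, hb⟩ := h.exists_currentBound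
  refine locallyIntegrableOn_spaceTime_of_slices (h.measurable_current n) hM
    (c := fun R => (volume.real (Metric.closedBall (0 : Space) R)) ^ (1 / 2 : ℝ))
    fun R t ht => ?_
  have hm : Measurable fun x => j n (t, x) := (h.measurable_current n).comp measurable_prodMk_left
  have h1 := eLpNorm_le_eLpNorm_mul_rpow_measure_univ (p := 1) (q := 2) (by norm_num)
    (hm.aestronglyMeasurable (μ := volume.restrict (Metric.closedBall (0 : Space) R)))
  rw [eLpNorm_one_eq_lintegral_enorm,
    show (1 / ENNReal.toReal 1 - 1 / ENNReal.toReal 2) = 1 / 2 by norm_num] at h1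
  refine h1.trans ?_
  rw [mul_comm, Measure.restrict_apply_univ, ENNReal.ofReal_mul (by positivity),
    ← ENNReal.ofReal_rpow_of_nonneg measureReal_nonneg (by norm_num),
    ofReal_measureReal measure_closedBall_lt_top.ne]
  gcongr
  exact (eLpNorm_mono_measure _ Measure.restrict_le_self).trans (hb n t ht)

/-- The equation of continuity tested with χ(t) m(x): the charge seen by m, as a function of time,
has weak derivative ∫ j · ∇m. -/
theorem weakDeriv_charge (h : ChargeSequence 𝒰 l ρ j) {C : UnitCell} (hC : C ∈ 𝒰)
    (n : ℕ) {m : Space → ℝ} (hm : ContDiff ℝ (⊤ : ℕ∞) m) (hmc : HasCompactSupport m)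
    {χ : ℝ → ℝ} (hχ : ContDiff ℝ (⊤ : ℕ∞) χ) (hχc : HasCompactSupport χ)
    (hχs : tsupport χ ⊆ Set.Ioi 0) :
    ∫ t, deriv χ t * (∫ x, m x * (ρ n (t, x) / l n)) =
      -∫ t, χ t * ∫ x, inner ℝ (j n (t, x)) (gradAlong (.id ℝ Space) m x) := by
  have h1 := congrArg (fun T : 𝓓'(spaceTime, ℝ) => T (tensorTest hχ hχc hχs hm hmc))
    (h.continuity n)
  have h2 : timeDeriv (ofFun spaceTime fun z => ρ n z / l n) (tensorTest hχ hχc hχs hm hmc) +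
      spaceDiv (j n) (tensorTest hχ hχc hχs hm hmc) = 0 := h1
  rw [timeDeriv_apply, integral_time_deriv_tensorTest _ _ _ _ _ (h.locallyIntegrableOn_charge hC n),
    spaceDiv_tensorTest _ _ _ _ _ (h.locallyIntegrableOn_current n)] at h2
  linarith

/-- The charges, tested with a test function at fixed times, are bounded locally uniformly in
time. -/
theorem exists_ae_abs_charge_le (h : ChargeSequence 𝒰 l ρ j) {C : UnitCell} (hC : C ∈ 𝒰)
    {φ : ℝ × Space → ℝ} (hφ : ContDiff ℝ (⊤ : ℕ∞) φ) (hφc : HasCompactSupport φ) {a b : ℝ}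
    (ha : 0 < a) (hab : a < b) : ∃ Λ, ∀ᵐ t, t ∈ Set.Ioo a b →
      ∀ n, |∫ x, φ (t, x) * (ρ n (t, x) / l n)| ≤ Λ := by
  obtain ⟨B, hB, hB0, hb⟩ := h.exists_cellBound hC
  obtain ⟨M, hM, hM0, hj⟩ := h.exists_currentBound
  obtain ⟨R, hR⟩ := (hφc.isCompact.image continuous_snd).isBounded.subset_closedBall (0 : Space)
  have hφ0 : ∀ t x, R < ‖x‖ → φ (t, x) = 0 := fun t x hx =>
    image_eq_zero_of_notMem_tsupport fun h' =>
      absurd (mem_closedBall_zero_iff.1 (hR ⟨_, h', rfl⟩)) hx.not_ge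
  obtain ⟨D, hD⟩ := exists_isTame_slice (hφ.of_le two_le_smooth) hφc hφ0
  have hslice : ∀ t, ContDiff ℝ (⊤ : ℕ∞) fun x => φ (t, x) := fun t =>
    hφ.comp (contDiff_prodMk_right t)
  let N : ℝ := (volume (Metric.closedBall (0 : Space) R) ^ (1 / 2 : ℝ) *
    ENNReal.ofReal D).toReal
  have hgrad : ∀ t x, ‖gradAlong (.id ℝ Space) (fun x => φ (t, x)) x‖ ≤ D := fun t x => by
    refine (norm_gradAlong_le _ _ _).trans ?_
    refine (mul_le_of_le_one_right (norm_nonneg _) ContinuousLinearMap.norm_id_le).trans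
      ((hD t).bound_fderiv x)
  have hcg : ∀ t, Continuous (gradAlong (.id ℝ Space) fun x => φ (t, x)) := fun t =>
    continuous_gradAlong _ (hD t).contDiff
  have hcgs : ∀ t, HasCompactSupport (gradAlong (.id ℝ Space) fun x => φ (t, x)) := fun t =>
    hasCompactSupport_gradAlong _ (hD t).hasCompactSupport
  have hMi : IntegrableOn M (Set.Ioo a b) :=
    (hM.integrableOn_compact_subset (fun t ht => ha.trans_le ht.1) isCompact_Icc).mono_set
      Set.Ioo_subset_Icc_self
  -- The test function is frozen at a time q, so that the charge it sees has a weak derivative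
  -- involving only the current. Each choice of n and q costs a null set of times, hence q is
  -- restricted to the rationals.
  have hosc : ∀ (n : ℕ) (q : ℚ), ∃ A : Set ℝ, (∀ᵐ t, t ∈ Set.Ioo a b → t ∈ A) ∧
      ∀ s ∈ A, ∀ t ∈ A, |(∫ x, φ (q, x) * (ρ n (t, x) / l n)) -
        ∫ x, φ (q, x) * (ρ n (s, x) / l n)| ≤ ∫ t in Set.Ioo a b, M t * N := by
    intro n q
    have hg := (integrable_slab (h.locallyIntegrableOn_charge hC n) ha b
      (hslice q).continuous (hD q).hasCompactSupport).integral_prod_left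
    have hh := (integrable_slab_inner (h.locallyIntegrableOn_current n) ha b
      (hcg q) (hcgs q)).integral_prod_left
    obtain ⟨A, hA, hA'⟩ := exists_full_set_abs_sub_le hg hh fun χ hχ hχc hχs =>
      h.weakDeriv_charge hC n (hslice q) (hD q).hasCompactSupport hχ hχc
        (hχs.trans fun t ht => ha.trans ht.1)
    refine ⟨A, hA, fun s hs t ht => (hA' s hs t ht).trans ?_⟩
    refine setIntegral_mono_on hh.abs (hMi.mul_const N) measurableSet_Ioo fun t ht => ?_
    refine (abs_integral_inner_le ((h.measurable_current n).comp
      measurable_prodMk_left).aestronglyMeasurable (hM0 t) (hj n t (ha.trans ht.1))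
      ((hcg q).memLp_of_hasCompactSupport (hcgs q))).trans ?_
    refine mul_le_mul_of_nonneg_left ?_ (hM0 t)
    refine eLpNorm_toReal_le_of_support (hgrad q) fun x hx => ?_
    ext i
    simp [gradAlong_apply, (hD q).fderiv_eq_zero x hx]
  choose A hA hA' using hosc
  have hall : ∀ᵐ t, t ∈ Set.Ioo a b → ∀ n q, t ∈ A n q := by
    filter_upwards [ae_all_iff.2 fun n => ae_all_iff.2 fun q => hA n q] with t ht htab n q
    exact ht n q htab
  -- One reference time that is good for all n and q. The bound from neutrality is needed at this
  -- time only, so its uncontrolled dependence on time does no harm.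
  obtain ⟨s, hs, hsA⟩ : ∃ s ∈ Set.Ioo a b, ∀ n q, s ∈ A n q := by
    by_contra hne
    push Not at hne
    have h0 : volume (Set.Ioo a b) = 0 := by
      refine measure_mono_null (fun t ht => ?_) hall
      obtain ⟨n, q, h⟩ := hne t ht
      exact fun hall => h (hall ht n q)
    exact (isOpen_Ioo.measure_ne_zero volume (Set.nonempty_Ioo.2 hab)) h0
  obtain ⟨Λ, hΛ⟩ := exists_abs_charge_le h.scale_mem (fun n => h.measurable_slice n s) (hB0 s)
    (fun n => hb n s (ha.trans hs.1)) (h.neutral_tendsto hC (ha.trans hs.1)) R D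
  refine ⟨Λ + ∫ t in Set.Ioo a b, M t * N, ?_⟩
  filter_upwards [hall] with t ht htab n
  have hq : ∀ q : ℚ, |∫ x, φ (q, x) * (ρ n (t, x) / l n)| ≤
      Λ + ∫ t in Set.Ioo a b, M t * N := fun q => by
    have h1 := hA' n q s (hsA n q) t (ht htab n q)
    have h2 := hΛ _ (hD q) n
    have h3 := abs_sub_abs_le_abs_sub (∫ x, φ (q, x) * (ρ n (t, x) / l n))
      (∫ x, φ (q, x) * (ρ n (s, x) / l n))
    linarith
  have hloc : IntegrableOn (fun x => ρ n (t, x) / l n) (Metric.closedBall 0 R) :=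
    (UnitCell.integrableOn_closedBall (h.scale_mem n) (h.measurable_slice n t)
      (hb n t (ha.trans htab.1)) R).div_const _
  -- At a good time t the bound holds for all rational freezing times. Continuity in the freezing
  -- time r extends it to all real r, in particular to r = t.
  have hcont : Continuous fun r : ℝ => ∫ x, φ (r, x) * (ρ n (t, x) / l n) := by
    refine continuous_of_dominated (bound := (Metric.closedBall (0 : Space) R).indicator
      fun x => D * ‖ρ n (t, x) / l n‖) (fun r => ?_) (fun r => .of_forall fun x => ?_) ?_
      (.of_forall fun x => ?_)
    · exact (hslice r).continuous.aestronglyMeasurable.mul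
        ((h.measurable_slice n t).div_const _).aestronglyMeasurable
    · by_cases hx : x ∈ Metric.closedBall (0 : Space) R
      · rw [Set.indicator_of_mem hx, norm_mul]
        exact mul_le_mul_of_nonneg_right ((hD r).bound x) (norm_nonneg _)
      · rw [Set.indicator_of_notMem hx, hφ0 r x (by simpa using hx)]
        simp
    · rw [integrable_indicator_iff measurableSet_closedBall]
      exact hloc.norm.const_mul D
    · exact (hφ.continuous.comp (by fun_prop)).mul continuous_const
  have hcl : IsClosed {r : ℝ | |∫ x, φ (r, x) * (ρ n (t, x) / l n)| ≤
      Λ + ∫ t in Set.Ioo a b, M t * N} := isClosed_le hcont.abs continuous_const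
  exact Rat.denseRange_cast.induction_on (p := fun r : ℝ => |∫ x, φ (r, x) * (ρ n (t, x) / l n)| ≤
      Λ + ∫ t in Set.Ioo a b, M t * N) t hcl hq

/-- For each t > 0 the inner integral of charge minus polarization tends to zero by the fixed-time
result. It is dominated by Λ + c B(t) on the time support of φ: Λ comes from the equation of
continuity, c B(t) from the pointwise bound on the dipole. Dominated convergence then gives the
limit. -/
theorem tendsto_ofFun_charge (h : ChargeSequence 𝒰 l ρ j) {C : UnitCell} (hC : C ∈ 𝒰)
    {p : ℝ × Space → Space}
    (hp : IsWeakLimit spaceTime (fun n => polarization C (l n) (ρ n)) p) (φ : 𝓓(spaceTime, ℝ)) :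
    Tendsto (fun n => ofFun spaceTime (fun z => ρ n z / l n) φ) atTop (𝓝 (-spaceDiv p φ)) := by
  obtain ⟨B, hB, hB0, hb⟩ := h.exists_cellBound hC
  obtain ⟨a, b, R, ha, hab, -, hK⟩ := exists_box φ.hasCompactSupport φ.tsupport_subset
  have hz : ∀ z : ℝ × Space, z ∉ Set.Icc a b ×ˢ Metric.closedBall (0 : Space) R → φ z = 0 :=
    fun z hz => image_eq_zero_of_notMem_tsupport fun h => hz (hK h)
  have hφ0 : ∀ t x, R < ‖x‖ → φ (t, x) = 0 := fun t x hx => hz _ fun h' =>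
    absurd (mem_closedBall_zero_iff.1 h'.2) hx.not_ge
  have hφt : ∀ t ∉ Set.Icc a b, ∀ x, φ (t, x) = 0 := fun t ht x => hz _ fun h' => ht h'.1
  obtain ⟨D, hD⟩ := exists_isTame_slice (φ.contDiff.of_le two_le_smooth) φ.hasCompactSupport hφ0
  have hdiff : Differentiable ℝ φ := φ.contDiff.differentiable (by simp)
  have hη : Continuous (gradAlong spaceIncl φ) := continuous_gradAlong _ (φ.contDiff.of_le (by simp))
  have hηc := hasCompactSupport_gradAlong spaceIncl φ.hasCompactSupport
  have hηs := (tsupport_gradAlong_subset spaceIncl φ).trans φ.tsupport_subset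
  have h2 := hp.2 _ hη hηc hηs
  rw [spaceDiv_apply hp.1, neg_neg]
  let e : ℕ → ℝ → ℝ := fun n t => (∫ x, φ (t, x) * (ρ n (t, x) / l n)) -
    ∫ x, inner ℝ (polarization C (l n) (ρ n) (t, x)) (gradAlong spaceIncl φ (t, x))
  have hi1 := fun n => integrable_mul_testFunction (h.locallyIntegrableOn_charge hC n) φ
  have hi2 := fun n => integrable_inner_of_compactSupport
    (h.locallyIntegrableOn_polarization hC n) hη hηc hηs
  have hi1' := fun n => (Measure.volume_eq_prod ℝ Space ▸ hi1 n)
  have hi2' := fun n => (Measure.volume_eq_prod ℝ Space ▸ hi2 n)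
  have he : ∀ n, ∫ t, e n t = ofFun spaceTime (fun z => ρ n z / l n) φ -
      ∫ z, inner ℝ (polarization C (l n) (ρ n) z) (gradAlong spaceIncl φ z) := by
    intro n
    rw [ofFun_apply (h.locallyIntegrableOn_charge hC n), Measure.volume_eq_prod,
      integral_prod _ (hi1' n), integral_prod _ (hi2' n)]
    exact integral_sub (hi1' n).integral_prod_left (hi2' n).integral_prod_left
  -- The open interval (a/2, b + 1) contains the time support [a, b] and stays away from 0.
  obtain ⟨Λ, hΛ⟩ := h.exists_ae_abs_charge_le hC φ.contDiff φ.hasCompactSupport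
    (half_pos ha) (b := b + 1) (by linarith)
  have hslice : ∀ n t, ∫ x, inner ℝ (polarization C (l n) (ρ n) (t, x))
      (gradAlong spaceIncl φ (t, x)) = ∫ x, inner ℝ (C.dipole (l n) (fun x => ρ n (t, x)) x)
        (gradAlong (.id ℝ Space) (fun x => φ (t, x)) x) := fun n t => by
    simp only [gradAlong_slice hdiff]
    rfl
  let c : ℝ := (volume.real C.shape)⁻¹ * (C.radius * C.embConst) * D *
        volume.real (Metric.closedBall (0 : Space) R)
  have hpol : ∀ n, ∀ t > 0, |∫ x, inner ℝ (polarization C (l n) (ρ n) (t, x))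
      (gradAlong spaceIncl φ (t, x))| ≤ c * B t := by
    intro n t ht
    have h0 : ∫ x in Metric.closedBall (0 : Space) R,
        inner ℝ (polarization C (l n) (ρ n) (t, x)) (gradAlong spaceIncl φ (t, x)) =
        ∫ x, inner ℝ (polarization C (l n) (ρ n) (t, x)) (gradAlong spaceIncl φ (t, x)) := by
      refine setIntegral_eq_integral_of_forall_compl_eq_zero fun x hx => ?_
      rw [← gradAlong_slice hdiff, inner_gradAlong,
        (hD t).fderiv_eq_zero x (by simpa using hx)]
      rfl
    rw [← h0, ← Real.norm_eq_abs]
    refine (norm_setIntegral_le_of_norm_le_const (C := (volume.real C.shape)⁻¹ * (C.radius *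
      (C.embConst * B t)) * D) measure_closedBall_lt_top fun x _ => ?_).trans (le_of_eq ?_)
    · rw [← gradAlong_slice hdiff, inner_gradAlong, ContinuousLinearMap.id_apply, mul_comm]
      refine ((fderiv ℝ _ x).le_opNorm _).trans ?_
      gcongr
      · exact (hD t).bound 0 |>.trans' (abs_nonneg _)
      · exact (hD t).bound_fderiv x
      · exact UnitCell.norm_dipole_le (h.measurable_slice n t) (hB0 t) (hb n t ht) x
    · simp only [c]; ring
  have hlim : Tendsto (fun n => ∫ t, e n t) atTop (𝓝 (∫ _ : ℝ, 0)) := by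
    refine tendsto_integral_of_dominated_convergence
      ((Set.Icc a b).indicator fun t => Λ + c * B t) (fun n => ?_) ?_ (fun n => ?_) ?_
    · exact ((hi1' n).integral_prod_left.sub (hi2' n).integral_prod_left).aestronglyMeasurable
    · rw [integrable_indicator_iff measurableSet_Icc]
      exact (integrableOn_const (by simp)).add ((hB.integrableOn_compact_subset
        (fun t ht => ha.trans_le ht.1) isCompact_Icc).const_mul c)
    · filter_upwards [hΛ] with t ht
      by_cases htab : t ∈ Set.Icc a b
      · rw [Set.indicator_of_mem htab]
        have h1 := ht ⟨by linarith [htab.1], by linarith [htab.2]⟩ n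
        have h2 := hpol n t (ha.trans_le htab.1)
        exact (abs_sub _ _).trans (add_le_add h1 h2)
      · rw [Set.indicator_of_notMem htab]
        have hg0 : ∀ x, gradAlong spaceIncl φ (t, x) = 0 := fun x => by
          have hc0 : (fun x => φ (t, x)) = fun _ => 0 := funext (hφt t htab)
          rw [← gradAlong_slice hdiff, hc0]
          ext i
          simp [gradAlong_apply]
        simp [e, hφt t htab, hg0]
    · refine .of_forall fun t => ?_
      by_cases ht : 0 < t
      · simp only [e, hslice]
        exact tendsto_charge_sub_polarization h.scale_mem h.scale_tendsto
          (fun n => h.measurable_slice n t) (hB0 t) (fun n => hb n t ht)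
          (h.neutral_tendsto hC ht) (hD t)
      · have htab : t ∉ Set.Icc a b := fun h' => ht (ha.trans_le h'.1)
        have hg0 : ∀ x, gradAlong spaceIncl φ (t, x) = 0 := fun x => by
          have hc0 : (fun x => φ (t, x)) = fun _ => 0 := funext (hφt t htab)
          rw [← gradAlong_slice hdiff, hc0]
          ext i
          simp [gradAlong_apply]
        simp [e, hφt t htab, hg0]
  rw [integral_zero] at hlim
  have h3 := hlim.add h2
  rw [zero_add] at h3
  refine h3.congr fun n => ?_
  rw [he, sub_add_cancel]

end ChargeSequence

/-! ### A Liouville theorem for functions vanishing at infinity on average -/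

section Liouville

/-- The Laplacian of a function, as the sum of its second partial derivatives. -/
def lap (m : Space → ℝ) (x : Space) : ℝ :=
  ∑ i : Fin 3, fderiv ℝ (fun z => fderiv ℝ m z (EuclideanSpace.single i 1)) x
    (EuclideanSpace.single i 1)

theorem contDiff_fderiv_apply {E : Type*} [NormedAddCommGroup E] [NormedSpace ℝ E] {m : E → ℝ}
    (hm : ContDiff ℝ (⊤ : ℕ∞) m) (v : E) : ContDiff ℝ (⊤ : ℕ∞) fun z => fderiv ℝ m z v :=
  (hm.fderiv_right (m := (⊤ : ℕ∞)) (by simp)).clm_apply contDiff_const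

theorem hasCompactSupport_fderiv_apply {E : Type*} [NormedAddCommGroup E] [NormedSpace ℝ E]
    {m : E → ℝ} (hm : HasCompactSupport m) (v : E) :
    HasCompactSupport fun z => fderiv ℝ m z v :=
  (hm.fderiv ℝ).comp_left (g := fun L : E →L[ℝ] ℝ => L v) rfl

theorem contDiff_lap {m : Space → ℝ} (hm : ContDiff ℝ (⊤ : ℕ∞) m) :
    ContDiff ℝ (⊤ : ℕ∞) (lap m) :=
  ContDiff.sum fun _ _ => contDiff_fderiv_apply (contDiff_fderiv_apply hm _) _

theorem hasCompactSupport_lap {m : Space → ℝ} (hm : HasCompactSupport m) :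
    HasCompactSupport (lap m) := by
  unfold lap
  simp only [Fin.sum_univ_three]
  have := fun i : Fin 3 => hasCompactSupport_fderiv_apply (hasCompactSupport_fderiv_apply hm
    (EuclideanSpace.single i (1 : ℝ))) (EuclideanSpace.single i (1 : ℝ))
  exact ((this 0).add (this 1)).add (this 2)

/-- At a local maximum the second derivative test would also give a local minimum, so g would be
locally constant, with zero second derivative. -/
theorem not_isLocalMax_of_deriv_deriv_pos {g : ℝ → ℝ} {s : ℝ} (h : 0 < deriv (deriv g) s)
    (hc : ContinuousAt g s) : ¬ IsLocalMax g s := fun hmax => by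
  have hmin := isLocalMin_of_deriv_deriv_pos h hmax.deriv_eq_zero hc
  have : g =ᶠ[𝓝 s] fun _ => g s := by
    filter_upwards [hmin, hmax] with r h1 h2
    exact le_antisymm h2 h1
  have h2 : deriv (deriv g) s = 0 := by
    rw [this.deriv.deriv_eq]
    simp
  exact h.ne' h2

/-- The maximum principle for functions harmonic on `ℝ³` and vanishing at infinity. -/
theorem nonpos_of_lap_eq_zero {F : Space → ℝ} (hF : ContDiff ℝ (⊤ : ℕ∞) F)
    (hlap : ∀ x, lap F x = 0) (h0 : Tendsto F (cocompact Space) (𝓝 0)) (x₀ : Space) :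
    F x₀ ≤ 0 := by
  by_contra! hpos
  have hev : ∀ᶠ x in cocompact Space, F x < F x₀ / 2 :=
    h0.eventually_lt_const (by linarith)
  obtain ⟨R, hRx, hR⟩ : ∃ R, ‖x₀‖ < R ∧ ∀ x : Space, R ≤ ‖x‖ → F x < F x₀ / 2 := by
    rw [← Metric.cobounded_eq_cocompact] at hev
    obtain ⟨r, hr⟩ :=
      (Metric.hasBasis_cobounded_compl_closedBall (0 : Space)).eventually_iff.1 hev
    refine ⟨max (r + 1) (‖x₀‖ + 1), (lt_add_one _).trans_le (le_max_right _ _), fun x hx => ?_⟩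
    refine hr.2 ?_
    simp only [Set.mem_compl_iff, mem_closedBall_zero_iff, not_le]
    linarith [(le_max_left (r + 1) (‖x₀‖ + 1)).trans hx]
  have hR0 : 0 < R := (norm_nonneg _).trans_lt hRx
  -- The perturbation δ ‖x‖² makes the Laplacian strictly positive. With δ R² = F(x₀)/4 the
  -- perturbed function is below 3 F(x₀)/4 on the sphere of radius R, so its maximum on the ball is
  -- interior.
  let δ : ℝ := F x₀ / (4 * R ^ 2)
  have hδ : 0 < δ := by positivity
  have hδR : δ * R ^ 2 = F x₀ / 4 := by simp only [δ]; field_simp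
  let G : Space → ℝ := fun x => F x + δ * ‖x‖ ^ 2
  have hGc : Continuous G := hF.continuous.add (continuous_const.mul (continuous_norm.pow 2))
  obtain ⟨x₁, hx₁, hmax⟩ := (isCompact_closedBall (0 : Space) R).exists_isMaxOn
    ⟨x₀, by simpa using hRx.le⟩ hGc.continuousOn
  have hG0 : F x₀ ≤ G x₁ := by
    have h1 : G x₀ ≤ G x₁ := hmax (by simpa using hRx.le)
    have h2 : F x₀ ≤ G x₀ := by
      simp only [G]
      have := mul_nonneg hδ.le (sq_nonneg ‖x₀‖)
      linarith
    exact h2.trans h1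
  have hx₁' : ‖x₁‖ < R := by
    refine lt_of_le_of_ne (by simpa using hx₁) fun h => ?_
    have h1 := hR x₁ h.ge
    have h2 : G x₁ = F x₁ + δ * R ^ 2 := by simp only [G, h]
    linarith
  have hloc : IsLocalMax G x₁ :=
    hmax.isLocalMax (mem_of_superset (Metric.isOpen_ball.mem_nhds (by simpa using hx₁'))
      Metric.ball_subset_closedBall)
  -- At an interior maximum each pure second derivative of F + δ ‖x‖² is at most zero. Summing the
  -- three gives ΔF + 6 δ ≤ 0, against ΔF = 0.
  have hline : ∀ i : Fin 3, fderiv ℝ (fun z => fderiv ℝ F z (EuclideanSpace.single i 1)) x₁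
      (EuclideanSpace.single i 1) + 2 * δ ≤ 0 := by
    intro i
    by_contra! hi
    set e : Space := EuclideanSpace.single i 1 with he
    let γ : ℝ → Space := fun s => x₁ + s • e
    have hγ : ∀ s, HasDerivAt γ e s := fun s => by
      have := ((hasDerivAt_id s).smul_const e).const_add x₁
      rw [one_smul] at this
      exact this
    have hd : ∀ s, HasDerivAt (fun s => G (γ s)) (fderiv ℝ F (γ s) e +
        δ * (2 * inner ℝ (γ s) e)) s := fun s =>
      ((hF.differentiable (by simp) (γ s)).hasFDerivAt.comp_hasDerivAt s (hγ s)).add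
        ((hγ s).norm_sq.const_mul δ)
    have hd1 : deriv (fun s => G (γ s)) = fun s => fderiv ℝ F (γ s) e +
        δ * (2 * inner ℝ (γ s) e) := funext fun s => (hd s).deriv
    have hd2 : deriv (deriv fun s => G (γ s)) 0 =
        fderiv ℝ (fun z => fderiv ℝ F z e) x₁ e + 2 * δ := by
      rw [hd1]
      have h1 : HasDerivAt (fun s => fderiv ℝ F (γ s) e)
          (fderiv ℝ (fun z => fderiv ℝ F z e) (γ 0) e) 0 :=
        ((contDiff_fderiv_apply hF e).differentiable (by simp) (γ 0)).hasFDerivAt.comp_hasDerivAt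
          0 (hγ 0)
      have h2 : HasDerivAt (fun s => δ * (2 * inner ℝ (γ s) e)) (δ * (2 * inner ℝ e e)) 0 := by
        have := (((hγ 0).inner ℝ (hasDerivAt_const (0 : ℝ) e)).const_mul 2).const_mul δ
        simpa using this
      have h5 : deriv (fun s => fderiv ℝ F (γ s) e + δ * (2 * inner ℝ (γ s) e)) 0 = _ :=
        (h1.add h2).deriv
      rw [h5]
      have h3 : inner ℝ e e = 1 := by
        rw [real_inner_self_eq_norm_sq, he]
        simp
      have h4 : γ 0 = x₁ := by simp [γ]
      rw [h3, h4]
      ring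
    refine not_isLocalMax_of_deriv_deriv_pos (g := fun s => G (γ s)) (s := 0) (hd2 ▸ hi)
      (hd 0).continuousAt ?_
    have h4 : γ 0 = x₁ := by simp [γ]
    have h6 : IsLocalMax G (γ 0) := h4.symm ▸ hloc
    exact IsMaxFilter.comp_tendsto h6 (hγ 0).continuousAt
  have hsum := hlap x₁
  rw [lap, Fin.sum_univ_three] at hsum
  linarith [hline 0, hline 1, hline 2]

theorem lap_neg (m : Space → ℝ) (x : Space) : lap (fun x => -m x) x = -lap m x := by
  simp [lap, ← Finset.sum_neg_distrib, fderiv_fun_neg]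

theorem eq_zero_of_lap_eq_zero {F : Space → ℝ} (hF : ContDiff ℝ (⊤ : ℕ∞) F)
    (hlap : ∀ x, lap F x = 0) (h0 : Tendsto F (cocompact Space) (𝓝 0)) (x : Space) : F x = 0 := by
  refine le_antisymm (nonpos_of_lap_eq_zero hF hlap h0 x) ?_
  have := nonpos_of_lap_eq_zero hF.neg (fun x => by rw [lap_neg, hlap, neg_zero])
    (by simpa using h0.neg) x
  simpa using this

/-- The average of `f` with weight `m(y - ·)`. -/
def mollify (f m : Space → ℝ) (y : Space) : ℝ := ∫ x, f x * m (y - x)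

theorem mollify_eq (f m : Space → ℝ) :
    mollify f m = convolution f m (ContinuousLinearMap.mul ℝ ℝ) volume := rfl

variable {f m : Space → ℝ}

theorem contDiff_mollify (hf : LocallyIntegrable f) (hm : ContDiff ℝ (⊤ : ℕ∞) m)
    (hc : HasCompactSupport m) : ContDiff ℝ (⊤ : ℕ∞) (mollify f m) := by
  rw [mollify_eq]
  exact hc.contDiff_convolution_right _ hf hm

theorem fderiv_mollify (hf : LocallyIntegrable f) (hm : ContDiff ℝ (⊤ : ℕ∞) m)
    (hc : HasCompactSupport m) (y v : Space) :
    fderiv ℝ (mollify f m) y v = mollify f (fun z => fderiv ℝ m z v) y := by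
  rw [mollify_eq, (hc.hasFDerivAt_convolution_right _ hf (hm.of_le (by simp)) y).fderiv,
    convolution_precompR_apply _ hf (hc.fderiv ℝ) (hm.continuous_fderiv (by simp)), mollify_eq]

theorem lap_mollify (hf : LocallyIntegrable f) (hm : ContDiff ℝ (⊤ : ℕ∞) m)
    (hc : HasCompactSupport m) (y : Space) : lap (mollify f m) y = mollify f (lap m) y := by
  have h1 : ∀ i : Fin 3, Integrable fun x => f x * fderiv ℝ (fun z => fderiv ℝ m z
      (EuclideanSpace.single i 1)) (y - x) (EuclideanSpace.single i 1) := fun i =>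
    (hasCompactSupport_fderiv_apply (hasCompactSupport_fderiv_apply hc _) _).convolutionExists_right
      (ContinuousLinearMap.mul ℝ ℝ) hf (contDiff_fderiv_apply (contDiff_fderiv_apply hm _) _).continuous y
  simp only [lap, fderiv_mollify hf hm hc]
  simp only [fun i : Fin 3 => fderiv_mollify hf (contDiff_fderiv_apply hm
    (EuclideanSpace.single i (1 : ℝ))) (hasCompactSupport_fderiv_apply hc _)]
  simp only [mollify, lap, Finset.mul_sum]
  rw [integral_finsetSum _ fun i _ => h1 i]

/-- A locally integrable function whose local averages vanish at infinity. -/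
structure Vanishes (f : Space → ℝ) : Prop where
  locallyIntegrable : LocallyIntegrable f
  tendsto : Tendsto (fun x : Space => ∫⁻ y in Metric.ball x 1, ‖f y‖ₑ) (cocompact Space) (𝓝 0)

theorem Vanishes.sub {g : Space → ℝ} (hf : Vanishes f) (hg : Vanishes g) :
    Vanishes fun x => f x - g x := by
  refine ⟨hf.1.sub hg.1, ?_⟩
  have h := hf.2.add hg.2
  rw [add_zero] at h
  refine tendsto_of_tendsto_of_tendsto_of_le_of_le tendsto_const_nhds h (fun x => zero_le)
    fun x => ?_
  simp only
  rw [← lintegral_add_left' hf.1.aestronglyMeasurable.enorm.restrict]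
  exact lintegral_mono fun y => enorm_sub_le

/-- The mollified value at x is at most sup |m| times the integral of |f| over the unit ball around
x. This is why the radii of the bumps are at most 1. -/
theorem Vanishes.tendsto_mollify (hf : Vanishes f) (hm : Continuous m) (hc : HasCompactSupport m)
    (hs : Function.support m ⊆ Metric.ball 0 1) :
    Tendsto (mollify f m) (cocompact Space) (𝓝 0) := by
  obtain ⟨D, hD⟩ := hm.bounded_above_of_compact_support hc
  have h1 : Tendsto (fun x => (ENNReal.ofReal D * ∫⁻ y in Metric.ball x 1, ‖f y‖ₑ).toReal)
      (cocompact Space) (𝓝 0) := by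
    have := ENNReal.Tendsto.const_mul hf.2 (.inr (ENNReal.ofReal_ne_top (r := D)))
    rw [mul_zero] at this
    exact (ENNReal.tendsto_toReal ENNReal.zero_ne_top).comp this
  refine squeeze_zero_norm (fun x => ?_) h1
  have hfin : ∫⁻ y in Metric.ball x 1, ‖f y‖ₑ ≠ ⊤ :=
    ((hf.1.integrableOn_isCompact (isCompact_closedBall x 1)).mono_set
      Metric.ball_subset_closedBall).2.ne
  have h0 : ∀ y ∉ Metric.ball x 1, f y * m (x - y) = 0 := fun y hy => by
    have : m (x - y) = 0 := by
      by_contra h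
      have := hs h
      rw [mem_ball_zero_iff, ← dist_eq_norm, dist_comm] at this
      exact hy this
    rw [this, mul_zero]
  have h2 : mollify f m x = ∫ y in Metric.ball x 1, f y * m (x - y) :=
    (setIntegral_eq_integral_of_forall_compl_eq_zero h0).symm
  rw [h2]
  refine (norm_integral_le_lintegral_norm _).trans (ENNReal.toReal_mono
    (ENNReal.mul_ne_top ENNReal.ofReal_ne_top hfin) ?_)
  rw [← lintegral_const_mul' _ _ ENNReal.ofReal_ne_top]
  refine lintegral_mono fun y => ?_
  rw [norm_mul, ENNReal.ofReal_mul (norm_nonneg _), ofReal_norm, mul_comm]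
  gcongr
  exact hD _

/-- The hypothesis says that all mollifications of f are harmonic. They vanish at infinity, hence
are zero, and they converge to f at almost every point. -/
theorem Vanishes.ae_eq_zero (hf : Vanishes f)
    (h : ∀ k y, mollify f (lap ((bump Space k).normed volume)) y = 0) : f =ᵐ[volume] 0 := by
  filter_upwards [ae_tendsto_bump_average volume hf.1] with x hx
  have : ∀ k, ∫ y, (bump Space k).normed volume (x - y) * f y = 0 := by
    intro k
    have hm : ContDiff ℝ (⊤ : ℕ∞) ((bump Space k).normed volume) := (bump Space k).contDiff_normed
    have hc : HasCompactSupport ((bump Space k).normed volume) :=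
      (bump Space k).hasCompactSupport_normed
    have := eq_zero_of_lap_eq_zero (contDiff_mollify hf.1 hm hc)
      (fun y => (lap_mollify hf.1 hm hc y).trans (h k y))
      (hf.tendsto_mollify hm.continuous hc (by
        rw [ContDiffBump.support_normed_eq]
        exact Metric.ball_subset_ball (bump_rOut_le_one Space k))) x
    simpa only [mollify, mul_comm] using this
  simp only [this] at hx
  exact tendsto_nhds_unique hx tendsto_const_nhds

end Liouville

/-! ### Uniqueness of potentials -/

theorem ofFun_sub {Φ Ψ : ℝ × Space → ℝ} (hΦ : LocallyIntegrableOn Φ spaceTime)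
    (hΨ : LocallyIntegrableOn Ψ spaceTime) :
    ofFun spaceTime (fun z => Φ z - Ψ z) = ofFun spaceTime Φ - ofFun spaceTime Ψ := by
  ext φ
  have h : LocallyIntegrableOn (fun z => Φ z - Ψ z) spaceTime := hΦ.sub hΨ
  have h2 : (ofFun spaceTime Φ - ofFun spaceTime Ψ) φ =
      ofFun spaceTime Φ φ - ofFun spaceTime Ψ φ := rfl
  rw [h2, ofFun_apply h, ofFun_apply hΦ, ofFun_apply hΨ,
    ← integral_sub (integrable_mul_testFunction hΦ φ) (integrable_mul_testFunction hΨ φ)]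
  simp only [mul_sub]

theorem spaceLaplacian_apply (T : 𝓓'(spaceTime, ℝ)) (φ : 𝓓(spaceTime, ℝ)) :
    spaceLaplacian T φ = ∑ i : Fin 3, T (∂_{((0, EuclideanSpace.single i 1) : ℝ × Space)}
      (∂_{((0, EuclideanSpace.single i 1) : ℝ × Space)} φ)) := by
  have : spaceLaplacian T φ = ∑ i : Fin 3, spaceDeriv i (spaceDeriv i T) φ := by
    simp only [spaceLaplacian, Fin.sum_univ_three]
    rfl
  rw [this]
  simp only [spaceDeriv, Distribution.lineDerivOp_apply_apply, map_neg, neg_neg]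

theorem spaceLaplacian_sub (T S : 𝓓'(spaceTime, ℝ)) :
    spaceLaplacian (T - S) = spaceLaplacian T - spaceLaplacian S := by
  ext φ
  have h : (spaceLaplacian T - spaceLaplacian S) φ =
    spaceLaplacian T φ - spaceLaplacian S φ := rfl
  have h2 : ∀ ψ, (T - S) ψ = T ψ - S ψ := fun ψ => rfl
  rw [h]
  simp only [spaceLaplacian_apply, h2, Finset.sum_sub_distrib]

section

variable {χ : ℝ → ℝ} (hχ : ContDiff ℝ (⊤ : ℕ∞) χ) (hχc : HasCompactSupport χ)
    (hχs : tsupport χ ⊆ Set.Ioi 0) {m : Space → ℝ} (hm : ContDiff ℝ (⊤ : ℕ∞) m)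
    (hmc : HasCompactSupport m)

theorem lineDerivOp_tensorTest_space (v : Space) :
    ∂_{((0, v) : ℝ × Space)} (tensorTest hχ hχc hχs hm hmc) =
      tensorTest hχ hχc hχs (contDiff_fderiv_apply hm v) (hasCompactSupport_fderiv_apply hmc v) := by
  ext z
  rw [lineDerivOp_testFunction_apply, fderiv_tensorTest, tensorTest_apply]
  simp

theorem contDiff_deriv_of_smooth (hχ : ContDiff ℝ (⊤ : ℕ∞) χ) :
    ContDiff ℝ (⊤ : ℕ∞) (deriv χ) := (contDiff_infty_iff_deriv.1 hχ).2

theorem lineDerivOp_tensorTest_time :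
    ∂_{((1, 0) : ℝ × Space)} (tensorTest hχ hχc hχs hm hmc) =
      tensorTest (contDiff_deriv_of_smooth hχ) hχc.deriv
        (tsupport_deriv_subset.trans hχs) hm hmc := by
  ext z
  rw [lineDerivOp_testFunction_apply, fderiv_tensorTest, tensorTest_apply]
  simp

theorem spaceLaplacian_tensorTest {Φ : ℝ × Space → ℝ} (hΦ : LocallyIntegrableOn Φ spaceTime) :
    spaceLaplacian (ofFun spaceTime Φ) (tensorTest hχ hχc hχs hm hmc) =
      ∫ t, χ t * ∫ x, lap m x * Φ (t, x) := by
  rw [spaceLaplacian_apply]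
  simp only [lineDerivOp_tensorTest_space]
  rw [← integral_tensorTest hχ hχc hχs (contDiff_lap hm) (hasCompactSupport_lap hmc) hΦ]
  rw [← map_sum]
  congr 1
  ext z
  simp only [Fin.sum_univ_three]
  simp only [add_apply, tensorTest_apply, lap, Fin.sum_univ_three]
  ring

end

theorem fderiv_comp_const_sub {g : Space → ℝ} (hg : Differentiable ℝ g) (y x v : Space) :
    fderiv ℝ (fun x => g (y - x)) x v = -fderiv ℝ g (y - x) v := by
  have h : HasFDerivAt (fun x => y - x) (-ContinuousLinearMap.id ℝ Space) x :=
    (hasFDerivAt_id x).const_sub y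
  have h2 : fderiv ℝ (fun x => g (y - x)) x = _ := ((hg (y - x)).hasFDerivAt.comp x h).fderiv
  rw [h2]
  simp

/-- Reflection changes the sign twice in a second derivative. -/
theorem lap_comp_const_sub {m : Space → ℝ} (hm : ContDiff ℝ (⊤ : ℕ∞) m) (y x : Space) :
    lap (fun x => m (y - x)) x = lap m (y - x) := by
  refine Finset.sum_congr rfl fun i _ => ?_
  simp only [fderiv_comp_const_sub (hm.differentiable (by simp)), fderiv_fun_neg,
    neg_apply]
  rw [fderiv_comp_const_sub ((contDiff_fderiv_apply hm _).differentiable (by simp)), neg_neg]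

/-- The reflected and translated bump function. -/
def bumpAt (k : ℕ) (y x : Space) : ℝ := (bump Space k).normed volume (y - x)

theorem contDiff_bumpAt (k : ℕ) (y : Space) : ContDiff ℝ (⊤ : ℕ∞) (bumpAt k y) :=
  (bump Space k).contDiff_normed.comp (contDiff_const.sub contDiff_id)

theorem hasCompactSupport_bumpAt (k : ℕ) (y : Space) : HasCompactSupport (bumpAt k y) :=
  (bump Space k).hasCompactSupport_normed.comp_homeomorph (Homeomorph.subLeft y)

theorem integral_lap_bumpAt (f : Space → ℝ) (k : ℕ) (y : Space) :
    ∫ x, lap (bumpAt k y) x * f x = mollify f (lap ((bump Space k).normed volume)) y := by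
  refine integral_congr_ae (.of_forall fun x => ?_)
  have := lap_comp_const_sub ((bump Space k).contDiff_normed (μ := volume) (n := (⊤ : ℕ∞))) y x
  simp only [← this, mul_comm (f x)]
  rfl

/-- Fubini on a countable exhaustion of space-time by slabs times balls. -/
theorem ae_locallyIntegrable_slice {Φ : ℝ × Space → ℝ} (hΦ : LocallyIntegrableOn Φ spaceTime) :
    ∀ᵐ t ∂volume.restrict (Set.Ioi (0 : ℝ)), LocallyIntegrable fun x => Φ (t, x) := by
  have h1 : ∀ N : ℕ, ∀ᵐ t, t ∈ Set.Ioo (1 / ((N : ℝ) + 1)) (N + 1) →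
      IntegrableOn (fun x => Φ (t, x)) (Metric.closedBall 0 ((N : ℝ) + 1)) := fun N => by
    have h2 := integrableOn_slab_ball hΦ (a := 1 / ((N : ℝ) + 1)) (by positivity) (N + 1) (N + 1)
    rw [IntegrableOn, ← restrict_slab_ball] at h2
    exact (ae_restrict_iff' measurableSet_Ioo).1 h2.prod_right_ae
  rw [ae_restrict_iff' measurableSet_Ioi]
  filter_upwards [ae_all_iff.2 h1] with t ht ht0 x
  have ht0 : 0 < t := ht0
  obtain ⟨N, hN⟩ := exists_nat_gt (max (max t t⁻¹) ‖x‖)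
  simp only [max_lt_iff] at hN
  refine ⟨Metric.closedBall 0 (N + 1), mem_of_superset (Metric.isOpen_ball.mem_nhds
    (by simpa using hN.2.trans (lt_add_one _))) Metric.ball_subset_closedBall, ht N ⟨?_, ?_⟩⟩
  · rw [one_div]
    exact inv_lt_of_inv_lt₀ ht0 (hN.1.2.trans (lt_add_one _))
  · exact hN.1.1.trans (lt_add_one _)

theorem IsPotential.ae_vanishes {Φ : ℝ × Space → ℝ} {S : 𝓓'(spaceTime, ℝ)}
    (h : IsPotential Φ S) :
    ∀ᵐ t ∂volume.restrict (Set.Ioi (0 : ℝ)), Vanishes fun x => Φ (t, x) := by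
  filter_upwards [ae_locallyIntegrable_slice h.locallyIntegrable, h.vanishes] with t h1 h2
  exact ⟨h1, h2⟩

theorem integrableOn_integral_slice {Ψ : ℝ × Space → ℝ} (hΨ : LocallyIntegrableOn Ψ spaceTime)
    {m : Space → ℝ} (hm : Continuous m) (hc : HasCompactSupport m) {a : ℝ} (ha : 0 < a) (b : ℝ) :
    IntegrableOn (fun t => ∫ x, m x * Ψ (t, x)) (Set.Ioo a b) :=
  (integrable_slab hΨ ha b hm hc).integral_prod_left

/-- Mollifications are continuous in y, so countably many centres suffice. This keeps the
exceptional sets of times countable in number when the hypothesis is known only for almost every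
time. -/
theorem mollify_eq_of_denseSeq {f g : Space → ℝ} (hf : LocallyIntegrable f)
    (hg : LocallyIntegrable g) {k : ℕ}
    (h : ∀ i, mollify f (lap ((bump Space k).normed volume)) (denseSeq Space i) =
      mollify g (lap ((bump Space k).normed volume)) (denseSeq Space i)) (y : Space) :
    mollify f (lap ((bump Space k).normed volume)) y =
      mollify g (lap ((bump Space k).normed volume)) y := by
  have hm := contDiff_lap ((bump Space k).contDiff_normed (μ := volume) (n := (⊤ : ℕ∞)))
  have hc := hasCompactSupport_lap ((bump Space k).hasCompactSupport_normed (μ := volume))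
  exact congrFun ((contDiff_mollify hf hm hc).continuous.ext_on (denseRange_denseSeq Space)
    (contDiff_mollify hg hm hc).continuous (by rintro _ ⟨i, rfl⟩; exact h i)) y

/-- Testing ΔΨ = 0 with χ(t) times a bump around y shows that a function of t integrates to zero
against every χ, so it vanishes at almost every time. -/
theorem ae_mollify_eq_zero {Ψ : ℝ × Space → ℝ} (hΨ : LocallyIntegrableOn Ψ spaceTime)
    (h : spaceLaplacian (ofFun spaceTime Ψ) = 0) :
    ∀ᵐ t ∂volume.restrict (Set.Ioi (0 : ℝ)), ∀ k y,
      mollify (fun x => Ψ (t, x)) (lap ((bump Space k).normed volume)) y = 0 := by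
  have h1 : ∀ k i, ∀ᵐ t, t ∈ Set.Ioi (0 : ℝ) →
      ∫ x, lap (bumpAt k (denseSeq Space i)) x * Ψ (t, x) = 0 := by
    intro k i
    have hm := contDiff_bumpAt k (denseSeq Space i)
    have hc := hasCompactSupport_bumpAt k (denseSeq Space i)
    refine isOpen_Ioi.ae_eq_zero_of_integral_contDiff_smul_eq_zero (fun t ht => ?_)
      fun χ hχ hχc hχs => ?_
    · have ht : 0 < t := ht
      exact ⟨Set.Ioo (t / 2) (t + 1), mem_nhdsWithin_of_mem_nhds
        (isOpen_Ioo.mem_nhds ⟨by linarith, by linarith⟩),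
        integrableOn_integral_slice hΨ (contDiff_lap hm).continuous (hasCompactSupport_lap hc)
          (by linarith) _⟩
    · have := spaceLaplacian_tensorTest hχ hχc hχs hm hc hΨ
      rw [h] at this
      exact this.symm
  rw [ae_restrict_iff' measurableSet_Ioi]
  have h2 := (ae_restrict_iff' measurableSet_Ioi).1 (ae_locallyIntegrable_slice hΨ)
  filter_upwards [ae_all_iff.2 fun k => ae_all_iff.2 (h1 k), h2] with t ht ht2 ht0 k y
  have h0 : ∀ y, mollify (fun _ => 0) (lap ((bump Space k).normed volume)) y = 0 := fun y => by
    simp [mollify]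
  rw [← h0 y]
  refine mollify_eq_of_denseSeq (ht2 ht0) (locallyIntegrable_const 0) (fun i => ?_) y
  rw [h0, ← integral_lap_bumpAt]
  exact ht k i ht0

/-- With the Laplacian moved onto a bump, the hypothesis says that a function of time has weak
derivative zero. The oscillation bound with h = 0 then makes it constant on a set of full measure,
and countably many such sets are combined. -/
theorem exists_full_set_mollify_eq {Ψ : ℝ × Space → ℝ} (hΨ : LocallyIntegrableOn Ψ spaceTime)
    (h : timeDeriv (spaceLaplacian (ofFun spaceTime Ψ)) = 0) :
    ∃ A : Set ℝ, (∀ᵐ t ∂volume.restrict (Set.Ioi (0 : ℝ)), t ∈ A) ∧ ∀ s ∈ A, ∀ t ∈ A, ∀ k y,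
      mollify (fun x => Ψ (t, x)) (lap ((bump Space k).normed volume)) y =
      mollify (fun x => Ψ (s, x)) (lap ((bump Space k).normed volume)) y := by
  have h1 : ∀ N k i : ℕ, ∃ A : Set ℝ,
      (∀ᵐ t, t ∈ Set.Ioo (1 / ((N : ℝ) + 1)) (N + 1) → t ∈ A) ∧ ∀ s ∈ A, ∀ t ∈ A,
      ∫ x, lap (bumpAt k (denseSeq Space i)) x * Ψ (t, x) =
      ∫ x, lap (bumpAt k (denseSeq Space i)) x * Ψ (s, x) := by
    intro N k i
    have hm := contDiff_bumpAt k (denseSeq Space i)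
    have hc := hasCompactSupport_bumpAt k (denseSeq Space i)
    have ha : 0 < 1 / ((N : ℝ) + 1) := by positivity
    obtain ⟨A, hA, hA'⟩ := exists_full_set_abs_sub_le (h := fun _ => 0)
      (integrableOn_integral_slice hΨ (contDiff_lap hm).continuous (hasCompactSupport_lap hc)
        ha (N + 1)) integrableOn_zero fun χ hχ hχc hχs => by
        have hχs' : tsupport χ ⊆ Set.Ioi 0 := hχs.trans fun t ht => ha.trans ht.1
        have h2 : timeDeriv (spaceLaplacian (ofFun spaceTime Ψ))
          (tensorTest hχ hχc hχs' hm hc) = 0 := by rw [h]; rfl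
        rw [timeDeriv_apply, lineDerivOp_tensorTest_time, spaceLaplacian_tensorTest _ _ _ _ _ hΨ,
          neg_eq_zero] at h2
        simpa using h2
    refine ⟨A, hA, fun s hs t ht => ?_⟩
    have := hA' s hs t ht
    simp only [abs_zero, integral_zero] at this
    exact sub_eq_zero.1 (abs_eq_zero.1 (le_antisymm this (abs_nonneg _)))
  choose A hA hA' using h1
  refine ⟨{t | 0 < t ∧ LocallyIntegrable (fun x => Ψ (t, x)) ∧
    ∀ N k i : ℕ, t ∈ Set.Ioo (1 / ((N : ℝ) + 1)) (N + 1) → t ∈ A N k i}, ?_, ?_⟩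
  · rw [ae_restrict_iff' measurableSet_Ioi]
    have h2 := (ae_restrict_iff' measurableSet_Ioi).1 (ae_locallyIntegrable_slice hΨ)
    filter_upwards [ae_all_iff.2 fun N => ae_all_iff.2 fun k => ae_all_iff.2 fun i => hA N k i, h2]
      with t ht ht2 ht0
    exact ⟨ht0, ht2 ht0, ht⟩
  · rintro s ⟨hs0, hs, hsA⟩ t ⟨ht0, ht, htA⟩ k y
    refine mollify_eq_of_denseSeq ht hs (fun i => ?_) y
    rw [← integral_lap_bumpAt, ← integral_lap_bumpAt]
    obtain ⟨N, hN⟩ := exists_nat_gt (max (max t t⁻¹) (max s s⁻¹))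
    simp only [max_lt_iff] at hN
    refine hA' N k i s (hsA N k i ⟨?_, hN.2.1.trans (lt_add_one _)⟩) t
      (htA N k i ⟨?_, hN.1.1.trans (lt_add_one _)⟩) <;> rw [one_div]
    · exact inv_lt_of_inv_lt₀ hs0 (hN.2.2.trans (lt_add_one _))
    · exact inv_lt_of_inv_lt₀ ht0 (hN.1.2.trans (lt_add_one _))

theorem IsPotential.spaceLaplacian_eq {Φ : ℝ × Space → ℝ} {S : 𝓓'(spaceTime, ℝ)}
    (h : IsPotential Φ S) : spaceLaplacian (ofFun spaceTime Φ) = -S := by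
  rw [← h.poisson, neg_neg]

theorem IsPotential.ae_eq {Φ Ψ : ℝ × Space → ℝ} {S : 𝓓'(spaceTime, ℝ)} (hΦ : IsPotential Φ S)
    (hΨ : IsPotential Ψ S) : Φ =ᵐ[volume.restrict spaceTime] Ψ := by
  have hi : LocallyIntegrableOn (fun z => Φ z - Ψ z) spaceTime :=
    hΦ.locallyIntegrable.sub hΨ.locallyIntegrable
  have h0 : spaceLaplacian (ofFun spaceTime fun z => Φ z - Ψ z) = 0 := by
    rw [ofFun_sub hΦ.locallyIntegrable hΨ.locallyIntegrable, spaceLaplacian_sub,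
      hΦ.spaceLaplacian_eq, hΨ.spaceLaplacian_eq, sub_self]
  have h1 : ∀ᵐ t ∂volume.restrict (Set.Ioi (0 : ℝ)), ∀ᵐ x, Φ (t, x) - Ψ (t, x) = 0 := by
    filter_upwards [ae_mollify_eq_zero hi h0, hΦ.ae_vanishes, hΨ.ae_vanishes] with t h1 h2 h3
    exact (h2.sub h3).ae_eq_zero h1
  have hm : AEStronglyMeasurable (fun z => Φ z - Ψ z) (volume.restrict spaceTime) :=
    hi.aestronglyMeasurable
  rw [restrict_spaceTime] at hm ⊢
  -- Passing from almost every slice to almost every point of space-time requires a measurable set,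
  -- so the difference is replaced by a measurable representative.
  have h2 := hm.ae_eq_mk
  have h3 : ∀ᵐ t ∂volume.restrict (Set.Ioi (0 : ℝ)), ∀ᵐ x, hm.mk _ (t, x) = 0 := by
    filter_upwards [h1, Measure.ae_ae_of_ae_prod h2] with t h1 h2
    filter_upwards [h1, h2] with x h1 h2
    rw [← h2, h1]
  have h4 := (Measure.ae_prod_iff_ae_ae
    (hm.stronglyMeasurable_mk.measurable (measurableSet_singleton (0 : ℝ)))).2 h3
  filter_upwards [h2, h4] with z h2 h4
  exact sub_eq_zero.1 (h2.trans h4)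

/-- The Laplacian of Φ - Ψ does not depend on time. Its increment between two good times is
therefore weakly harmonic in x and vanishes at infinity, hence is zero. -/
theorem IsPotential.ae_sub_eq {Φ Ψ : ℝ × Space → ℝ} {S T : 𝓓'(spaceTime, ℝ)}
    (hΦ : IsPotential Φ S) (hΨ : IsPotential Ψ T) (hST : timeDeriv S = timeDeriv T) :
    ∀ᵐ s ∂volume.restrict (Set.Ioi (0 : ℝ)), ∀ᵐ t ∂volume.restrict (Set.Ioi (0 : ℝ)),
      (fun x => Φ (t, x) - Φ (s, x)) =ᵐ[volume] fun x => Ψ (t, x) - Ψ (s, x) := by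
  have hi : LocallyIntegrableOn (fun z => Φ z - Ψ z) spaceTime :=
    hΦ.locallyIntegrable.sub hΨ.locallyIntegrable
  have h0 : timeDeriv (spaceLaplacian (ofFun spaceTime fun z => Φ z - Ψ z)) = 0 := by
    rw [ofFun_sub hΦ.locallyIntegrable hΨ.locallyIntegrable, spaceLaplacian_sub,
      hΦ.spaceLaplacian_eq, hΨ.spaceLaplacian_eq]
    ext φ
    have h2 : timeDeriv S φ = timeDeriv T φ := by rw [hST]
    simp only [timeDeriv_apply, neg_inj] at h2 ⊢
    change -(-S _ - -T _) = 0
    rw [h2]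
    simp
  obtain ⟨A, hA, hA'⟩ := exists_full_set_mollify_eq hi h0
  filter_upwards [hA, hΦ.ae_vanishes, hΨ.ae_vanishes] with s hs h1s h2s
  filter_upwards [hA, hΦ.ae_vanishes, hΨ.ae_vanishes] with t ht h1t h2t
  have hvt := h1t.sub h2t
  have hvs := h1s.sub h2s
  have key := (hvt.sub hvs).ae_eq_zero fun k y => by
    have hm := contDiff_lap ((bump Space k).contDiff_normed (μ := volume) (n := (⊤ : ℕ∞)))
    have hc := hasCompactSupport_lap ((bump Space k).hasCompactSupport_normed (μ := volume))
    have e := hA' s hs t ht k y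
    have hint := fun {f : Space → ℝ} (hf : LocallyIntegrable f) =>
      hc.convolutionExists_right (ContinuousLinearMap.mul ℝ ℝ) hf hm.continuous y
    have i1 := hint hvt.locallyIntegrable
    have i2 := hint hvs.locallyIntegrable
    rw [← sub_eq_zero] at e
    rw [← e]
    refine Eq.trans ?_ (integral_sub i1 i2)
    exact integral_congr_ae (.of_forall fun x => sub_mul _ _ _)
  filter_upwards [key] with x hx
  simp only [Pi.zero_apply] at hx
  linarith

/-! ### Weak limits on space-time and the limit equation -/

theorem IsWeakLimit.comp {E : Type*} [NormedAddCommGroup E] [NormedSpace ℝ E] [MeasureSpace E]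
    {Ω : Opens E} {F : ℕ → E → Space} {G : E → Space} (h : IsWeakLimit Ω F G) {τ : ℕ → ℕ}
    (hτ : StrictMono τ) : IsWeakLimit Ω (fun n => F (τ n)) G :=
  ⟨h.1, fun η h1 h2 h3 => (h.2 η h1 h2 h3).comp hτ.tendsto_atTop⟩

variable {𝒰 : Set UnitCell} {l : ℕ → ℝ} {ρ : ℕ → ℝ × Space → ℝ} {j : ℕ → ℝ × Space → Space}

namespace ChargeSequence

theorem exists_weakLimit_polarization (h : ChargeSequence 𝒰 l ρ j) {C : UnitCell} (hC : C ∈ 𝒰) :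
    ∃ τ : ℕ → ℕ, StrictMono τ ∧ ∃ p,
      IsWeakLimit spaceTime (fun n => polarization C (l (τ n)) (ρ (τ n))) p := by
  obtain ⟨B, hB, hB0, hb⟩ := h.exists_cellBound hC
  have hm : ∀ n, Measurable (polarization C (l n) (ρ n)) := fun n =>
    measurable_polarization C _ (h.measurable_charge n)
  let W : ℝ := (eLpNorm spaceWeight 2 volume).toReal
  let c : ℝ := (volume.real C.shape)⁻¹ * (C.radius * C.embConst) * W
  have hB' : LocallyIntegrableOn (fun t => c * B t) (Set.Ioi 0) := fun t ht => by
    obtain ⟨u, hu, hi⟩ := hB t ht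
    exact ⟨u, hu, hi.const_mul c⟩
  refine exists_isWeakLimit_subseq_spaceTime (F := fun n => polarization C (l n) (ρ n)) hm hB'
    fun n t ht => ?_
  have h1 : ∀ x, ‖C.dipole (l n) (fun x => ρ n (t, x)) x‖ ≤
      (volume.real C.shape)⁻¹ * (C.radius * (C.embConst * B t)) :=
    UnitCell.norm_dipole_le (h.measurable_slice n t) (hB0 t) (hb n t ht)
  refine (eLpNorm_spaceWeight_smul_le h1).trans (le_of_eq ?_)
  congr 1
  simp only [c, W]
  ring

theorem exists_weakLimit_current (h : ChargeSequence 𝒰 l ρ j) :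
    ∃ τ : ℕ → ℕ, StrictMono τ ∧ ∃ j₀, IsWeakLimit spaceTime (fun n => j (τ n)) j₀ := by
  obtain ⟨M, hM, hM0, hb⟩ := h.exists_currentBound
  refine exists_isWeakLimit_subseq_spaceTime h.measurable_current hM fun n t ht =>
    (eLpNorm_mono fun x => ?_).trans (hb n t ht)
  rw [norm_smul, Real.norm_of_nonneg (spaceWeight_pos x).le]
  exact mul_le_of_le_one_left (norm_nonneg _) (spaceWeight_le_one x)

theorem tendsto_spaceDiv_current {F : ℕ → ℝ × Space → Space} {G : ℝ × Space → Space}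
    (hF : ∀ n, LocallyIntegrableOn (F n) spaceTime) (hG : IsWeakLimit spaceTime F G)
    (φ : 𝓓(spaceTime, ℝ)) :
    Tendsto (fun n => spaceDiv (F n) φ) atTop (𝓝 (spaceDiv G φ)) := by
  rw [spaceDiv_apply hG.1]
  refine (hG.2 _ (continuous_gradAlong spaceIncl (φ.contDiff.of_le (by simp)))
    (hasCompactSupport_gradAlong _ φ.hasCompactSupport)
    ((tsupport_gradAlong_subset _ _).trans φ.tsupport_subset)).neg.congr fun n => ?_
  rw [spaceDiv_apply (hF n)]

/-- The limit of the equation of continuity. -/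
theorem timeDeriv_spaceDiv_eq (h : ChargeSequence 𝒰 l ρ j) {C : UnitCell} (hC : C ∈ 𝒰)
    {p j₀ : ℝ × Space → Space}
    (hp : IsWeakLimit spaceTime (fun n => polarization C (l n) (ρ n)) p)
    (hj : IsWeakLimit spaceTime j j₀) : timeDeriv (spaceDiv p) = spaceDiv j₀ := by
  ext φ
  have h1 := tendsto_spaceDiv_current h.locallyIntegrableOn_current hj φ
  -- Testing the charges with ∂ₜφ is, by the equation of continuity, testing div j n with φ; the two
  -- limits must agree.
  have h2 := h.tendsto_ofFun_charge hC hp (∂_{((1, 0) : ℝ × Space)} φ)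
  rw [timeDeriv_apply]
  refine tendsto_nhds_unique (h2.congr fun n => ?_) h1
  have h3 : timeDeriv (ofFun spaceTime fun z => ρ n z / l n) φ + spaceDiv (j n) φ = 0 :=
    congrArg (fun T : 𝓓'(spaceTime, ℝ) => T φ) (h.continuity n)
  rw [timeDeriv_apply] at h3
  linarith

end ChargeSequence

theorem timeDeriv_neg (T : 𝓓'(spaceTime, ℝ)) : timeDeriv (-T) = -timeDeriv T :=
  LineDeriv.lineDerivOp_neg _ _

end Polarization

end

open Polarization

theorem theorem4p1 (𝒰 : Set UnitCell) (l : ℕ → ℝ) (ρ : ℕ → ℝ × Space → ℝ)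
    (j : ℕ → ℝ × Space → Space) (h : ChargeSequence 𝒰 l ρ j) :
    -- at every fixed time, the polarizations have weak limits along subsequences
    (∀ t > 0, ∀ σ : ℕ → ℕ, StrictMono σ → ∀ C ∈ 𝒰, ∃ τ : ℕ → ℕ, StrictMono τ ∧
      ∃ p : Space → Space,
        IsWeakLimit ⊤ (fun n => C.dipole (l (σ (τ n))) fun x => ρ (σ (τ n)) (t, x)) p) ∧
    -- at every fixed time, the bound charge does not depend on the unit cell
    (∀ t > 0, ∀ σ : ℕ → ℕ, StrictMono σ → ∀ C ∈ 𝒰, ∀ p : Space → Space,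
      IsWeakLimit ⊤ (fun n => C.dipole (l (σ n)) fun x => ρ (σ n) (t, x)) p →
      ∃ ρb : 𝓓'((⊤ : Opens Space), ℝ),
        (∀ φ, Tendsto (fun n => ofFun ⊤ (fun x => ρ (σ n) (t, x) / l (σ n)) φ)
          atTop (𝓝 (ρb φ))) ∧
        ∀ C' ∈ 𝒰, ∀ κ : ℕ → ℕ, StrictMono κ → ∀ p' : Space → Space,
          IsWeakLimit ⊤
            (fun n => C'.dipole (l (σ (κ n))) fun x => ρ (σ (κ n)) (t, x)) p' →
          divergence p' = -ρb) ∧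
    -- on space-time, polarizations and currents have weak limits along subsequences
    (∀ σ : ℕ → ℕ, StrictMono σ → ∀ C ∈ 𝒰, ∃ τ : ℕ → ℕ, StrictMono τ ∧
      ∃ p j₀ : ℝ × Space → Space,
        IsWeakLimit spaceTime (fun n => polarization C (l (σ (τ n))) (ρ (σ (τ n)))) p ∧
        IsWeakLimit spaceTime (fun n => j (σ (τ n))) j₀) ∧
    -- the homogenized limit
    (∀ σ : ℕ → ℕ, StrictMono σ → ∀ C ∈ 𝒰, ∀ p j₀ : ℝ × Space → Space,
      IsWeakLimit spaceTime (fun n => polarization C (l (σ n)) (ρ (σ n))) p →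
      IsWeakLimit spaceTime (fun n => j (σ n)) j₀ →
      ∃ ρb : 𝓓'(spaceTime, ℝ),
        -- `ρb` is the limit of the charges, and is the bound charge for every unit cell
        (∀ ψ, Tendsto (fun n => ofFun spaceTime (fun z => ρ (σ n) z / l (σ n)) ψ)
          atTop (𝓝 (ρb ψ))) ∧
        (∀ C' ∈ 𝒰, ∀ κ : ℕ → ℕ, StrictMono κ → ∀ p' : ℝ × Space → Space,
          IsWeakLimit spaceTime
            (fun n => polarization C' (l (σ (κ n))) (ρ (σ (κ n)))) p' →
          spaceDiv p' = -ρb) ∧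
        -- the relation between polarization, bound charge and current
        spaceDivTimeDeriv p = -timeDeriv ρb ∧
        -timeDeriv ρb = spaceDiv j₀ ∧
        -- weak limits of the microscopic potentials solve the homogenized problem
        (∀ (Φ : ℕ → ℝ × Space → ℝ) (Φ₀ : ℝ × Space → ℝ),
          (∀ n, IsPotential (Φ n) (ofFun spaceTime fun z => ρ (σ n) z / l (σ n))) →
          LocallyIntegrableOn Φ₀ spaceTime →
          (∀ ψ, Tendsto (fun n => ofFun spaceTime (Φ n) ψ) atTop
            (𝓝 (ofFun spaceTime Φ₀ ψ))) →
          spaceLaplacian (ofFun spaceTime Φ₀) = spaceDiv p) ∧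
        -- the rate of change of the potential computed from `p` and from the current is the same
        (∀ Φcl ΦT : ℝ × Space → ℝ, IsPotential Φcl (-spaceDivTimeDeriv p) →
          IsPotential ΦT (-spaceDiv j₀) →
          Φcl =ᵐ[volume.restrict spaceTime] ΦT) ∧
        -- the changes of the potentials of the classical and the transport polarization agree
        (∀ (P : ℝ × Space → Space) (Φcl ΦT : ℝ × Space → ℝ), IsTransportPolarization P j₀ →
          IsPotential Φcl (-spaceDiv p) → IsPotential ΦT (-spaceDiv P) →
          ∀ᵐ s ∂volume.restrict (Set.Ioi (0 : ℝ)), ∀ᵐ t ∂volume.restrict (Set.Ioi (0 : ℝ)),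
            (fun x => Φcl (t, x) - Φcl (s, x)) =ᵐ[volume] fun x => ΦT (t, x) - ΦT (s, x))) := by
  refine ⟨fun t ht σ hσ C hC => (h.comp hσ).exists_weakLimit_slice hC ht, ?_, ?_, ?_⟩
  · intro t ht σ hσ C hC p hp
    have h1 := fun φ => (h.comp hσ).tendsto_ofFun_slice hC ht hp φ
    -- The bound charge is the limit of the charges themselves. Any further weak limit for any other
    -- cell yields the same number, by uniqueness of limits.
    refine ⟨-divergence p, h1, fun C' hC' κ hκ p' hp' => ?_⟩
    rw [neg_neg]
    ext φ
    have h2 := ((h.comp hσ).comp hκ).tendsto_ofFun_slice hC' ht hp' φ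
    exact neg_injective (tendsto_nhds_unique h2 ((h1 φ).comp hκ.tendsto_atTop))
  · intro σ hσ C hC
    obtain ⟨τ, hτ, p, hp⟩ := (h.comp hσ).exists_weakLimit_polarization hC
    obtain ⟨κ, hκ, j₀, hj⟩ := ((h.comp hσ).comp hτ).exists_weakLimit_current
    exact ⟨fun n => τ (κ n), hτ.comp hκ, p, j₀, hp.comp hκ, hj⟩
  · intro σ hσ C hC p j₀ hp hj
    have hσ' := h.comp hσ
    have h1 := fun φ => hσ'.tendsto_ofFun_charge hC hp φ
    have h2 : timeDeriv (spaceDiv p) = spaceDiv j₀ := hσ'.timeDeriv_spaceDiv_eq hC hp hj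
    have h3 : -timeDeriv (-spaceDiv p) = timeDeriv (spaceDiv p) := by
      rw [timeDeriv_neg, neg_neg]
    refine ⟨-spaceDiv p, h1, fun C' hC' κ hκ p' hp' => ?_, ?_, h3.trans h2, ?_, ?_, ?_⟩
    · rw [neg_neg]
      ext φ
      have h2 := (hσ'.comp hκ).tendsto_ofFun_charge hC' hp' φ
      exact neg_injective (tendsto_nhds_unique h2 ((h1 φ).comp hκ.tendsto_atTop))
    · rw [h3, spaceDivTimeDeriv_eq]
    · intro Φ Φ₀ hΦ hΦ₀ hlim
      ext φ
      have h4 : Tendsto (fun n => spaceLaplacian (ofFun spaceTime (Φ n)) φ) atTop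
          (𝓝 (spaceLaplacian (ofFun spaceTime Φ₀) φ)) := by
        simp only [spaceLaplacian_apply]
        exact tendsto_finsetSum _ fun i _ => hlim _
      refine tendsto_nhds_unique (h4.congr fun n => ?_) (by simpa using (h1 φ).neg)
      rw [(hΦ n).spaceLaplacian_eq]
      rfl
    · intro Φcl ΦT hcl hT
      -- The limit equation makes the two sources equal, so uniqueness of the potential applies.
      rw [spaceDivTimeDeriv_eq, h2] at hcl
      exact hcl.ae_eq hT
    · intro P Φcl ΦT hP hcl hT
      refine hcl.ae_sub_eq hT ?_
      -- The sources themselves may differ, but their time derivatives agree: ∂ₜ div p = div j₀ =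
      -- div ∂ₜP.
      rw [timeDeriv_neg, timeDeriv_neg, h2, ← spaceDivTimeDeriv_eq, spaceDivTimeDeriv, spaceDiv]
      simp only [hP.2]
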